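/- **Parabolic weak Harnack inequality.** Notation. Let $d\ge 1$. $B_r(x_0)\subset\mathbb{R}^d$ is the open Euclidean ball, $Q_R(t_0,x_0)=(t_0-R^2,t_0]\times B_R(x_0)$, $Q_R=Q_R(0,0)$, $v_+=\max(v,0)$, $v_-=\max(-v,0)$. Let $I=(a,b]$, let $B\subset\mathbb{R}^d$ be an open ball, let $S\in L^2(I\times B)$, and fix constants $C^+,C^-\ge 1$. A measurable function $u:I\times B\to\mathbb{R}$ with measurable sections $u(t,\cdot)$ lies in $\mathrm{pDG}^+(I\times B,S)$ (with constant $C^+$) if $u\in L^\infty(I,L^2(B))$, its weak spatial gradient satisfies $\nabla_x u\in L^2(I\times B)$, and for all $X_0=(t_0,x_0)\in I\times B$, all $0<r<R$ with $Q_R(X_0)\subset I\times B$ and all $\kappa\in\mathbb{R}$, $$\sup_{t\in(t_0-r^2,t_0]}\int_{B_r(x_0)}(u(t,x)-\kappa)_+^2\,dx+\int_{Q_r(X_0)}|\nabla_x(u-\kappa)_+|^2\,dt\,dx\le C^+\Big(\frac1{(R-r)^2}+\frac1{r^2}\Big)\int_{Q_R(X_0)}(u-\kappa)_+^2\,dt\,dx+C^+\int_{Q_R(X_0)}|S|(u-\kappa)_+\,dt\,dx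 .$$ A function $u$ lies in $\mathrm{pDG}^-(I\times B,S)$ (with constants $C^+,C^-$) if $-u\in\mathrm{pDG}^+(I\times B,S)$ with constant $C^+$ and, for all $X_0=(t_0,x_0)\in I\times B$, all $0<r<R$ with $Q_R(X_0)\subset I\times B$, all $\kappa\in\mathbb{R}$ and all $t_1<t_2$ in $(t_0-R^2,t_0]$, $$\int_{B_r(x_0)}(u-\kappa)_-^2(t_2,x)\,dx\le\int_{B_R(x_0)}(u-\kappa)_-^2(t_1,x)\,dx+\frac{C^-}{(R-r)^2}\int_{t_1}^{t_2}\!\!\int_{B_R(x_0)}(u-\kappa)_-^2\,dx\,dt+C^-\int_{t_1}^{t_2}\!\!\int_{B_R(x_0)}|S|(u-\kappa)_-\,dx\,dt .$$ Theorem. There exist constants $\omega\in(0,1)$, $C>0$ and $p_0>0$, depending only on $d$, $C^+$ and $C^-$, such that, with $Q_{\rm past}=Q_\omega(-1+\omega^2,0)$ and $Q_{\rm future}=Q_\omega$, every $u\in\mathrm{pDG}^-(Q_1,S)$ with $S\in L^\infty(Q_1)$ and $u\ge 0$ a.e. in $Q_1$ satisfies $$\Big(\int_{Q_{\rm past}}u^{p_0}\,dt\,dx\Big)^{1/p_0}\le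 C\Big(\operatorname*{ess\,inf}_{Q_{\rm future}}u+\|S\|_{L^\infty(Q_1)}\Big).$$ -/

import Mathlib

open MeasureTheory Set
open scoped ENNReal

/-- The open ball `B_r(x₀)` in the Euclidean space `ℝ^d`. -/
abbrev euclBall {d : ℕ} (x₀ : EuclideanSpace ℝ (Fin d)) (r : ℝ) :
    Set (EuclideanSpace ℝ (Fin d)) :=
  Metric.ball x₀ r

/-- The parabolic cylinder `Q_R(t₀, x₀) = (t₀ - R², t₀] × B_R(x₀)`. -/
def parabolicCylinder {d : ℕ} (X₀ : ℝ × EuclideanSpace ℝ (Fin d)) (R : ℝ) :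
    Set (ℝ × EuclideanSpace ℝ (Fin d)) :=
  Ioc (X₀.1 - R ^ 2) X₀.1 ×ˢ euclBall X₀.2 R

/-- `g` is the weak gradient with respect to the space variable of the function `u(t, x)` in the
open set `Ω` of `ℝ × ℝ^d`: both are locally integrable in `Ω` and
`∫_Ω u ∂_e φ = - ∫_Ω (g · e) φ` for all test functions `φ` and all spatial directions `e`. -/
structure IsWeakSpatialGradient {d : ℕ} (Ω : Set (ℝ × EuclideanSpace ℝ (Fin d)))
    (u : ℝ × EuclideanSpace ℝ (Fin d) → ℝ)
    (g : ℝ × EuclideanSpace ℝ (Fin d) → EuclideanSpace ℝ (Fin d)) : Prop where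
  locallyIntegrable : LocallyIntegrableOn u Ω volume
  locallyIntegrable_grad : LocallyIntegrableOn g Ω volume
  integral_eq : ∀ φ : ℝ × EuclideanSpace ℝ (Fin d) → ℝ,
    ContDiff ℝ ((⊤ : ℕ∞) : WithTop ℕ∞) φ → HasCompactSupport φ → tsupport φ ⊆ Ω →
    ∀ e : EuclideanSpace ℝ (Fin d),
      ∫ X in Ω, u X * fderiv ℝ φ X (0, e) = - ∫ X in Ω, inner ℝ (g X) e * φ X

/-- The parabolic De Giorgi class `pDG⁺(I × B, S)` with constant `C`, for `I = (a, b]` and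
`B = B_ρ(c)`. All integrals of non-negative functions are taken in `[0, ∞]`. -/
structure MemPDGPlus {d : ℕ} (C a b : ℝ) (c : EuclideanSpace ℝ (Fin d)) (ρ : ℝ)
    (S u : ℝ × EuclideanSpace ℝ (Fin d) → ℝ) : Prop where
  /-- `u` is measurable, and so is `u(t, ·)` for every time `t`. -/
  aestronglyMeasurable :
    AEStronglyMeasurable u (volume.restrict (Ioc a b ×ˢ euclBall c ρ))
  aestronglyMeasurable_section : ∀ t ∈ Ioc a b,
    AEStronglyMeasurable (fun x => u (t, x)) (volume.restrict (euclBall c ρ))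
  /-- `u ∈ L^∞(I, L²(B))`. -/
  essSup_lt_top :
    essSup (fun t => eLpNorm (fun x => u (t, x)) 2 (volume.restrict (euclBall c ρ)))
      (volume.restrict (Ioc a b)) < ∞
  /-- `∇ₓ u ∈ L²(I × B)`. -/
  exists_grad : ∃ g : ℝ × EuclideanSpace ℝ (Fin d) → EuclideanSpace ℝ (Fin d),
    IsWeakSpatialGradient (Ioo a b ×ˢ euclBall c ρ) u g ∧
    MemLp g 2 (volume.restrict (Ioc a b ×ˢ euclBall c ρ))
  /-- The local energy estimates; `G` is the weak gradient `∇ₓ (u - κ)₊`. -/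
  energy : ∀ κ : ℝ, ∃ G : ℝ × EuclideanSpace ℝ (Fin d) → EuclideanSpace ℝ (Fin d),
    IsWeakSpatialGradient (Ioo a b ×ˢ euclBall c ρ) (fun X => max (u X - κ) 0) G ∧
    ∀ X₀ ∈ Ioc a b ×ˢ euclBall c ρ, ∀ r R : ℝ, 0 < r → r < R →
      parabolicCylinder X₀ R ⊆ Ioc a b ×ˢ euclBall c ρ →
      (⨆ t ∈ Ioc (X₀.1 - r ^ 2) X₀.1,
          ∫⁻ x in euclBall X₀.2 r, ENNReal.ofReal (max (u (t, x) - κ) 0 ^ 2))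
        + ∫⁻ X in parabolicCylinder X₀ r, ENNReal.ofReal (‖G X‖ ^ 2)
      ≤ ENNReal.ofReal (C * (1 / (R - r) ^ 2 + 1 / r ^ 2)) *
          (∫⁻ X in parabolicCylinder X₀ R, ENNReal.ofReal (max (u X - κ) 0 ^ 2))
        + ENNReal.ofReal C *
          (∫⁻ X in parabolicCylinder X₀ R, ENNReal.ofReal (|S X| * max (u X - κ) 0))

/-- The parabolic De Giorgi class `pDG⁻(I × B, S)` with constants `C⁺` and `C⁻`, for
`I = (a, b]` and `B = B_ρ(c)`. Here `(u - κ)₋ = max (κ - u) 0`. -/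
structure MemPDGMinus {d : ℕ} (Cplus Cminus a b : ℝ) (c : EuclideanSpace ℝ (Fin d)) (ρ : ℝ)
    (S u : ℝ × EuclideanSpace ℝ (Fin d) → ℝ) : Prop where
  source_memLp : MemLp S 2 (volume.restrict (Ioc a b ×ˢ euclBall c ρ))
  neg_memPDGPlus : MemPDGPlus Cplus a b c ρ S (fun X => - u X)
  /-- Propagation in time of the local `L²` norm of `(u - κ)₋`. -/
  propagation : ∀ X₀ ∈ Ioc a b ×ˢ euclBall c ρ, ∀ r R : ℝ, 0 < r → r < R →
    parabolicCylinder X₀ R ⊆ Ioc a b ×ˢ euclBall c ρ →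
    ∀ κ : ℝ, ∀ t₁ ∈ Ioc (X₀.1 - R ^ 2) X₀.1, ∀ t₂ ∈ Ioc (X₀.1 - R ^ 2) X₀.1, t₁ < t₂ →
      ∫⁻ x in euclBall X₀.2 r, ENNReal.ofReal (max (κ - u (t₂, x)) 0 ^ 2)
      ≤ (∫⁻ x in euclBall X₀.2 R, ENNReal.ofReal (max (κ - u (t₁, x)) 0 ^ 2))
        + ENNReal.ofReal (Cminus / (R - r) ^ 2) *
          (∫⁻ X in Ioc t₁ t₂ ×ˢ euclBall X₀.2 R, ENNReal.ofReal (max (κ - u X) 0 ^ 2))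
        + ENNReal.ofReal Cminus *
          (∫⁻ X in Ioc t₁ t₂ ×ˢ euclBall X₀.2 R, ENNReal.ofReal (|S X| * max (κ - u X) 0))

/-! Positivity at an early time reaches the future cylinder at a price polynomial in its density.
Suppose `u(s, ·) ≥ l` on a fraction `α` of the ball of radius `1/16`, with `s` in the past time
interval. Then either the bound on the source exceeds `c α^q l`, or `u ≥ c α^q l` a.e. in the future
cylinder (`NonnegDeGiorgi.exists_power_expansion_constants`). Read backwards, with `M = ess inf u +
‖S‖_∞`, every past slice satisfies `α ≤ (M / (c l))^(1/q)`. This is a weak `L^(1/q)` bound, and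
integration over the levels `l` gives the `L^p₀` bound with `p₀ = 1/(2q)`.

The power law has two sources. Clustering (`exists_clustering_constant`): the energy bound forbids a
superlevel set of density `α` to be spread thinly at a scale `ε ~ α³`, so shortly afterwards some
ball of radius `ε` is half filled, at the level `α l / 16`. Expansion of positivity
(`exists_expansion_constants`): half filling of a ball of radius `ρ` gives, after a time of order
`ρ²`, a lower bound on the doubled ball with a fixed loss `2^(-m)`. About `log₂ (1/α³)` doublings
bring the radius to `1/16` and cost a power of `α`; boundedly many steps at that radius then reach
any time of the future cylinder.

Expansion of positivity combines propagation in time of the measure information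
(`exists_propagation_constant`), shrinking of the sublevel sets `{u ≤ κ / 2^J}` by an isoperimetric
inequality (`exists_measure_sublevel_constant`), and De Giorgi's first lemma
(`exists_pointwise_bound_constant`). The functional inequalities behind these, `isoperimetric`,
`lintegral_sq_le_of_small_support` and `measure_ge_le_of_half_balls`, all come from `L²` bounds on
the increments `v(t, x + z) - v(t, x)`, averaged over `z`; no Sobolev embedding is used. -/

/-! ### Increments of functions with a weak directional derivative -/

section Translation

variable {F : Type*} [NormedAddCommGroup F] [NormedSpace ℝ F] [FiniteDimensional ℝ F]
  [MeasurableSpace F] [BorelSpace F]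

/-- Testing the weak identity with the translates `ψ(· - sZ)` and integrating over `s` turns the
derivative of `ψ` along `Z` into the difference `ψ - ψ(· - Z)`. Moving that difference onto `V`
identifies `V(· + Z) - V` as a distribution. The segment condition `hconv` keeps the supports of all
the translates inside `Ω`. -/
theorem sub_translate_eq_integral_of_weak_deriv (μ : Measure F) [μ.IsAddHaarMeasure]
    {Ω : Set F} (hΩ : IsOpen Ω) {V g : F → ℝ} (hV : Integrable V μ) (hg : Integrable g μ)
    (hgm : Measurable g) (Z : F)
    (hconv : ∀ X ∈ Ω, X + Z ∈ Ω → ∀ s ∈ Icc (0 : ℝ) 1, X + s • Z ∈ Ω)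
    (hweak : ∀ φ : F → ℝ, ContDiff ℝ ((⊤ : ℕ∞) : WithTop ℕ∞) φ → HasCompactSupport φ →
      tsupport φ ⊆ Ω → ∫ X, V X * fderiv ℝ φ X Z ∂μ = - ∫ X, g X * φ X ∂μ) :
    ∀ᵐ X ∂μ, X ∈ Ω → X + Z ∈ Ω → V (X + Z) - V X = ∫ s in Ioc (0 : ℝ) 1, g (X + s • Z) := by
  have hgs : Integrable (fun p : F × ℝ => g (p.1 + p.2 • Z))
      (μ.prod (volume.restrict (Ioc (0 : ℝ) 1))) := by
    have hm : Measurable (fun p : F × ℝ => g (p.1 + p.2 • Z)) := by fun_prop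
    rw [integrable_prod_iff' hm.aestronglyMeasurable]
    refine ⟨ae_of_all _ fun s => hg.comp_add_right (s • Z), ?_⟩
    have : ∀ s : ℝ, ∫ x, ‖g (x + s • Z)‖ ∂μ = ∫ x, ‖g x‖ ∂μ := fun s =>
      integral_add_right_eq_self (fun x => ‖g x‖) (s • Z)
    simp only [this]
    exact integrable_const _
  have hgI : Integrable (fun X => ∫ s in Ioc (0 : ℝ) 1, g (X + s • Z)) μ := hgs.integral_prod_left
  have hVZ : Integrable (fun X => V (X + Z)) μ := hV.comp_add_right Z
  have hopen : IsOpen (Ω ∩ (fun X => X + Z) ⁻¹' Ω) :=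
    hΩ.inter (hΩ.preimage (continuous_id.add continuous_const))
  have key := hopen.ae_eq_zero_of_integral_contDiff_smul_eq_zero (μ := μ)
    (f := fun X => V (X + Z) - V X - ∫ s in Ioc (0 : ℝ) 1, g (X + s • Z))
    (((hVZ.sub hV).sub hgI).locallyIntegrable.locallyIntegrableOn _) ?_
  · filter_upwards [key] with X hX h1 h2
    exact sub_eq_zero.1 (hX ⟨h1, h2⟩)
  intro ψ hψ hψc hψs
  have hψ1 : ContDiff ℝ 1 ψ := hψ.of_le (by exact_mod_cast le_top)
  have hψcont : Continuous ψ := hψ.continuous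
  obtain ⟨M, hM⟩ := hψcont.bounded_above_of_compact_support hψc
  have hdc : Continuous (fun X => fderiv ℝ ψ X Z) :=
    (hψ1.continuous_fderiv one_ne_zero).clm_apply continuous_const
  obtain ⟨M', hM'⟩ := hdc.bounded_above_of_compact_support (hψc.fderiv_apply (𝕜 := ℝ) Z)
  -- the weak formulation tested with the translates of `ψ`
  have h1 : ∀ s ∈ Icc (0 : ℝ) 1,
      ∫ X, V X * fderiv ℝ ψ (X - s • Z) Z ∂μ = - ∫ X, g (X + s • Z) * ψ X ∂μ := by
    intro s hs
    have hts : tsupport (fun X => ψ (X - s • Z)) = (fun X => X - s • Z) ⁻¹' tsupport ψ :=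
      tsupport_comp_eq_preimage ψ (Homeomorph.subRight (s • Z))
    have := hweak (fun X => ψ (X - s • Z)) (hψ.comp (contDiff_id.sub contDiff_const))
      (hψc.comp_homeomorph (Homeomorph.subRight (s • Z))) (by
        rw [hts]
        intro X hX
        have h := hψs hX
        have := hconv _ h.1 h.2 s hs
        simpa using this)
    simp only [fderiv_comp_sub] at this
    rw [this]
    congr 1
    have := integral_add_right_eq_self (μ := μ) (fun X => g X * ψ (X - s • Z)) (s • Z)
    simp only [add_sub_cancel_right] at this
    exact this.symm
  have h2 : ∫ s in Ioc (0 : ℝ) 1, ∫ X, V X * fderiv ℝ ψ (X - s • Z) Z ∂μ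
      = ∫ s in Ioc (0 : ℝ) 1, - ∫ X, g (X + s • Z) * ψ X ∂μ :=
    setIntegral_congr_fun measurableSet_Ioc fun s hs => h1 s (Ioc_subset_Icc_self hs)
  have hVD : Integrable (fun p : F × ℝ => V p.1 * fderiv ℝ ψ (p.1 - p.2 • Z) Z)
      (μ.prod (volume.restrict (Ioc (0 : ℝ) 1))) := by
    refine (hV.comp_fst _).mul_bdd (c := M') ?_ (ae_of_all _ fun p => hM' _)
    exact (hdc.comp (by fun_prop)).aestronglyMeasurable
  have hgψ : Integrable (fun p : F × ℝ => g (p.1 + p.2 • Z) * ψ p.1)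
      (μ.prod (volume.restrict (Ioc (0 : ℝ) 1))) := by
    refine hgs.mul_bdd (c := M) ?_ (ae_of_all _ fun p => hM _)
    exact (hψcont.comp (by fun_prop)).aestronglyMeasurable
  have sw1 := integral_integral_swap (f := fun X s => V X * fderiv ℝ ψ (X - s • Z) Z) hVD
  have sw2 := integral_integral_swap (f := fun X s => g (X + s • Z) * ψ X) hgψ
  rw [integral_neg, ← sw1, ← sw2] at h2
  have h3 : ∀ X, ∫ s in Ioc (0 : ℝ) 1, V X * fderiv ℝ ψ (X - s • Z) Z
      = V X * (ψ X - ψ (X - Z)) := by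
    intro X
    rw [integral_const_mul]
    congr 1
    have hd : ∀ s ∈ uIcc (0 : ℝ) 1, HasDerivAt (fun s : ℝ => - ψ (X - s • Z))
        (fderiv ℝ ψ (X - s • Z) Z) s := by
      intro s _
      have h4 : HasDerivAt (fun s : ℝ => X - s • Z) (-Z) s := by
        simpa using ((hasDerivAt_id s).smul_const Z).const_sub X
      have h5 := ((hψ1.differentiable one_ne_zero (X - s • Z)).hasFDerivAt).comp_hasDerivAt s h4
      have h6 := h5.neg
      rw [map_neg, neg_neg] at h6
      exact h6
    have h6 := intervalIntegral.integral_eq_sub_of_hasDerivAt hd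
      ((hdc.comp (by fun_prop : Continuous fun s : ℝ => X - s • Z)).intervalIntegrable _ _)
    rw [intervalIntegral.integral_of_le zero_le_one] at h6
    rw [h6]
    simp
    ring
  have h4 : ∫ X, V X * (ψ X - ψ (X - Z)) ∂μ = ∫ X, (V X - V (X + Z)) * ψ X ∂μ := by
    have i1 : Integrable (fun X => V X * ψ X) μ :=
      hV.mul_bdd (c := M) hψcont.aestronglyMeasurable (ae_of_all _ hM)
    have i2 : Integrable (fun X => V X * ψ (X - Z)) μ :=
      hV.mul_bdd (c := M) (hψcont.comp (by fun_prop)).aestronglyMeasurable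
        (ae_of_all _ fun X => hM _)
    have i3 : Integrable (fun X => V (X + Z) * ψ X) μ :=
      hVZ.mul_bdd (c := M) hψcont.aestronglyMeasurable (ae_of_all _ hM)
    simp only [mul_sub, sub_mul]
    rw [integral_sub i1 i2, integral_sub i1 i3]
    congr 1
    have := integral_add_right_eq_self (μ := μ) (fun X => V X * ψ (X - Z)) Z
    simp only [add_sub_cancel_right] at this
    exact this.symm
  simp only [h3, h4, integral_mul_const] at h2
  have i4 : Integrable (fun X => (V (X + Z) - V X) * ψ X) μ :=
    (hVZ.sub hV).mul_bdd (c := M) hψcont.aestronglyMeasurable (ae_of_all _ hM)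
  have i5 : Integrable (fun X => (∫ s in Ioc (0 : ℝ) 1, g (X + s • Z)) * ψ X) μ :=
    hgI.mul_bdd (c := M) hψcont.aestronglyMeasurable (ae_of_all _ hM)
  calc ∫ X, ψ X • (V (X + Z) - V X - ∫ s in Ioc (0 : ℝ) 1, g (X + s • Z)) ∂μ
      = ∫ X, ((V (X + Z) - V X) * ψ X - (∫ s in Ioc (0 : ℝ) 1, g (X + s • Z)) * ψ X) ∂μ := by
        congr 1; ext X; simp only [smul_eq_mul]; ring
    _ = 0 := by
        rw [integral_sub i4 i5]
        have : ∫ X, (V X - V (X + Z)) * ψ X ∂μ = - ∫ X, (V (X + Z) - V X) * ψ X ∂μ := by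
          rw [← integral_neg]; congr 1; ext X; ring
        rw [this] at h2
        linarith

/-- Jensen's inequality on the probability space `(0, 1]`. -/
theorem sq_enorm_setIntegral_Ioc_le (f : ℝ → ℝ) (hf : Measurable f) :
    ENNReal.ofReal ((∫ s in Ioc (0 : ℝ) 1, f s) ^ 2)
      ≤ ∫⁻ s in Ioc (0 : ℝ) 1, ENNReal.ofReal (f s ^ 2) := by
  have hp : IsProbabilityMeasure (volume.restrict (Ioc (0 : ℝ) 1)) := ⟨by simp⟩
  have e : ∀ x : ℝ, ENNReal.ofReal (x ^ 2) = ‖x‖ₑ ^ (2 : ℝ) := by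
    intro x
    rw [← ofReal_norm, Real.norm_eq_abs, ENNReal.ofReal_rpow_of_nonneg (abs_nonneg _)
      (by norm_num)]
    simp
  simp only [e]
  have h1 := eLpNorm_le_eLpNorm_of_exponent_le (μ := volume.restrict (Ioc (0 : ℝ) 1))
    (p := 1) (q := 2) (by norm_num) hf.aestronglyMeasurable
  rw [eLpNorm_one_eq_lintegral_enorm, eLpNorm_eq_lintegral_rpow_enorm_toReal (by norm_num)
    (by norm_num)] at h1
  have h2 := ENNReal.rpow_le_rpow ((enorm_integral_le_lintegral_enorm f).trans h1)
    (by norm_num : (0 : ℝ) ≤ 2)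
  rw [ENNReal.toReal_ofNat, ← ENNReal.rpow_mul] at h2
  norm_num at h2 ⊢
  exact h2

end Translation

/-! ### Spatial difference quotients -/

variable {d : ℕ}

local notation "E" => EuclideanSpace ℝ (Fin d)

/-- The `L²` norms of the spatial difference quotients of `v` in `I × K` are controlled by the
energy `Γ`. -/
def DiffQuotientBound {d : ℕ} (I : Set ℝ) (K : Set (EuclideanSpace ℝ (Fin d)))
    (v : ℝ × EuclideanSpace ℝ (Fin d) → ℝ) (Γ : ℝ≥0∞) : Prop :=
  ∀ z : EuclideanSpace ℝ (Fin d),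
    ∫⁻ X in {X : ℝ × EuclideanSpace ℝ (Fin d) | X.1 ∈ I ∧ X.2 ∈ K ∧ X.2 + z ∈ K},
      ENNReal.ofReal ((v (X.1, X.2 + z) - v X) ^ 2) ≤ ENNReal.ofReal (‖z‖ ^ 2) * Γ



instance isAddHaarMeasure_volume_real_prod : (volume : Measure (ℝ × E)).IsAddHaarMeasure :=
  inferInstanceAs (Measure.prod volume volume).IsAddHaarMeasure

theorem measurableSet_translate_mem {I : Set ℝ} {K : Set E} (hI : MeasurableSet I)
    (hK : MeasurableSet K) (z : E) :
    MeasurableSet {X : ℝ × E | X.1 ∈ I ∧ X.2 ∈ K ∧ X.2 + z ∈ K} :=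
  (measurable_fst hI).inter ((measurable_snd hK).inter
    ((measurable_snd.add_const z) hK))

theorem pair_add_eq (X : ℝ × E) (z : E) : (X.1, X.2 + z) = X + (0, z) := by
  ext <;> simp

theorem ae_translate (z : E) {p : ℝ × E → Prop} (hp : ∀ᵐ X : ℝ × E, p X) :
    ∀ᵐ X : ℝ × E, p (X.1, X.2 + z) := by
  have h := (measurePreserving_add_right (volume : Measure (ℝ × E)) (0, z)).quasiMeasurePreserving.ae
    hp
  filter_upwards [h] with X hX
  rwa [pair_add_eq]

theorem DiffQuotientBound.congr_ae {I : Set ℝ} {K : Set E} {v w : ℝ × E → ℝ} {Γ : ℝ≥0∞}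
    (hI : MeasurableSet I) (hK : MeasurableSet K)
    (h : DiffQuotientBound I K v Γ) (hvw : v =ᵐ[volume.restrict (I ×ˢ K)] w) :
    DiffQuotientBound I K w Γ := by
  intro z
  refine le_of_eq_of_le ?_ (h z)
  have h1 := (ae_restrict_iff' (hI.prod hK)).1 hvw
  refine setLIntegral_congr_fun_ae (measurableSet_translate_mem hI hK z) ?_
  filter_upwards [h1, ae_translate z h1] with X hX hX' hm
  rw [hX ⟨hm.1, hm.2.1⟩, hX' ⟨hm.1, hm.2.2⟩]

theorem DiffQuotientBound.mono_energy {I : Set ℝ} {K : Set E} {v : ℝ × E → ℝ} {Γ Γ' : ℝ≥0∞}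
    (h : DiffQuotientBound I K v Γ) (hΓ : Γ ≤ Γ') : DiffQuotientBound I K v Γ' :=
  fun z => (h z).trans (by gcongr)

/-- The increment along `z` is the mean of `G · z` over the segment from `X` to `X + (0, z)`;
Jensen, Cauchy–Schwarz and translation invariance give the bound. Convexity of `K` keeps the segment
in the domain, and extension by zero brings the problem to the whole space. -/
theorem diffQuotientBound_of_measurable {a b : ℝ} {K : Set E} (hK : IsOpen K)
    (hKc : Convex ℝ K) {v : ℝ × E → ℝ} {G : ℝ × E → E} (hGm : Measurable G)
    (hv : IntegrableOn v (Ioo a b ×ˢ K)) (hfin : volume (Ioo a b ×ˢ K) ≠ ∞)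
    (hweak : ∀ φ : ℝ × E → ℝ,
      ContDiff ℝ ((⊤ : ℕ∞) : WithTop ℕ∞) φ → HasCompactSupport φ → tsupport φ ⊆ Ioo a b ×ˢ K →
      ∀ e : E, ∫ X in Ioo a b ×ˢ K, v X * fderiv ℝ φ X (0, e)
        = - ∫ X in Ioo a b ×ˢ K, inner ℝ (G X) e * φ X) :
    DiffQuotientBound (Ioo a b) K v (∫⁻ X in Ioo a b ×ˢ K, ENNReal.ofReal (‖G X‖ ^ 2)) := by
  intro z
  set Ω : Set (ℝ × E) := Ioo a b ×ˢ K with hΩdef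
  have hΩo : IsOpen Ω := isOpen_Ioo.prod hK
  have hΩm : MeasurableSet Ω := hΩo.measurableSet
  -- Since `0 * ∞ = 0`, an infinite energy makes the claim trivial only for `z ≠ 0`.
  by_cases hz : z = 0
  · simp [hz]
  by_cases htop : ∫⁻ X in Ω, ENNReal.ofReal (‖G X‖ ^ 2) = ∞
  · rw [htop, ENNReal.mul_top]
    · exact le_top
    · have : 0 < ‖z‖ := norm_pos_iff.2 hz
      simp only [ne_eq, ENNReal.ofReal_eq_zero, not_le]
      positivity
  have hfm : IsFiniteMeasure (volume.restrict Ω) := ⟨by simpa using hfin.lt_top⟩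
  have hG2 : MemLp G 2 (volume.restrict Ω) := by
    refine ⟨hGm.aestronglyMeasurable, ?_⟩
    rw [eLpNorm_lt_top_iff_lintegral_rpow_enorm_lt_top (by norm_num) (by norm_num)]
    refine lt_of_eq_of_lt ?_ (lt_top_iff_ne_top.2 htop)
    refine lintegral_congr fun X => ?_
    rw [← ofReal_norm, ENNReal.ofReal_rpow_of_nonneg (norm_nonneg _) (by norm_num)]
    simp
  have hG1 : Integrable G (volume.restrict Ω) := hG2.integrable (by norm_num)
  let g : ℝ × E → ℝ := Ω.indicator fun X => inner ℝ (G X) z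
  have hgm : Measurable g := (Measurable.inner hGm measurable_const).indicator hΩm
  have hgi : Integrable g := by
    rw [integrable_indicator_iff hΩm]
    exact hG1.inner_const z
  have hVi : Integrable (Ω.indicator v) := by
    rwa [integrable_indicator_iff hΩm]
  have key := sub_translate_eq_integral_of_weak_deriv volume hΩo hVi hgi hgm (0, z) (by
      intro X hX hXz s hs
      refine ⟨by simpa using hX.1, ?_⟩
      have h2 : X.2 + z ∈ K := hXz.2
      have := hKc hX.2 h2 (sub_nonneg.2 hs.2) hs.1 (by ring)
      convert this using 1
      simp only [Prod.snd_add, Prod.smul_snd]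
      module) (by
      intro φ hφ hφc hφs
      have h1 := hweak φ hφ hφc hφs z
      rw [← integral_indicator hΩm, ← integral_indicator hΩm] at h1
      have e1 : ∀ X, Ω.indicator (fun X => v X * fderiv ℝ φ X (0, z)) X
          = Ω.indicator v X * fderiv ℝ φ X (0, z) := fun X => indicator_mul_left _ _ _
      have e2 : ∀ X, Ω.indicator (fun X => inner ℝ (G X) z * φ X) X = g X * φ X :=
        fun X => indicator_mul_left _ _ _
      simpa only [e1, e2] using h1)
  have hsub : {X : ℝ × E | X.1 ∈ Ioo a b ∧ X.2 ∈ K ∧ X.2 + z ∈ K} = Ω ∩ {X | X + (0, z) ∈ Ω} := by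
    ext X
    simp only [hΩdef, mem_ofPred_eq, mem_inter_iff, mem_prod, Prod.fst_add, Prod.snd_add, add_zero]
    tauto
  have hm := measurableSet_translate_mem (measurableSet_Ioo (a := a) (b := b)) hK.measurableSet z
  calc ∫⁻ X in {X : ℝ × E | X.1 ∈ Ioo a b ∧ X.2 ∈ K ∧ X.2 + z ∈ K},
        ENNReal.ofReal ((v (X.1, X.2 + z) - v X) ^ 2)
      ≤ ∫⁻ X in {X : ℝ × E | X.1 ∈ Ioo a b ∧ X.2 ∈ K ∧ X.2 + z ∈ K},
        ∫⁻ s in Ioc (0 : ℝ) 1, ENNReal.ofReal (g (X + s • (0, z)) ^ 2) := by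
        refine setLIntegral_mono_ae' hm ?_
        filter_upwards [key] with X hX hXm
        have hXm : X ∈ Ω ∩ {X | X + (0, z) ∈ Ω} := hsub ▸ hXm
        have h1 := hX hXm.1 hXm.2
        have hXz : X + (0, z) ∈ Ω := hXm.2
        rw [indicator_of_mem hXm.1, indicator_of_mem hXz] at h1
        rw [pair_add_eq, h1]
        exact sq_enorm_setIntegral_Ioc_le _ (hgm.comp (by fun_prop))
    _ ≤ ∫⁻ X, ∫⁻ s in Ioc (0 : ℝ) 1, ENNReal.ofReal (g (X + s • (0, z)) ^ 2) :=
        setLIntegral_le_lintegral _ _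
    _ = ∫⁻ s in Ioc (0 : ℝ) 1, ∫⁻ X, ENNReal.ofReal (g (X + s • (0, z)) ^ 2) := by
        rw [lintegral_lintegral_swap]
        exact Measurable.aemeasurable (by fun_prop)
    _ = ∫⁻ X, ENNReal.ofReal (g X ^ 2) := by
        have : ∀ s : ℝ, ∫⁻ X, ENNReal.ofReal (g (X + s • (0, z)) ^ 2)
            = ∫⁻ X, ENNReal.ofReal (g X ^ 2) := fun s =>
          lintegral_add_right_eq_self (fun X => ENNReal.ofReal (g X ^ 2)) (s • (0, z))
        simp only [this, lintegral_const, Measure.restrict_apply_univ, Real.volume_Ioc]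
        simp
    _ ≤ ∫⁻ X, Ω.indicator (fun X => ENNReal.ofReal (‖z‖ ^ 2) * ENNReal.ofReal (‖G X‖ ^ 2)) X := by
        refine lintegral_mono fun X => ?_
        by_cases hX : X ∈ Ω
        · simp only [g, indicator_of_mem hX]
          rw [← ENNReal.ofReal_mul (by positivity)]
          refine ENNReal.ofReal_le_ofReal ?_
          rw [← sq_abs, ← mul_pow, mul_comm]
          gcongr
          exact abs_real_inner_le_norm _ _
        · simp [g, hX]
    _ = ENNReal.ofReal (‖z‖ ^ 2) * ∫⁻ X in Ω, ENNReal.ofReal (‖G X‖ ^ 2) := by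
        rw [lintegral_indicator hΩm, lintegral_const_mul]
        fun_prop

theorem IsWeakSpatialGradient.diffQuotientBound {Ω : Set (ℝ × E)} {v : ℝ × E → ℝ} {G : ℝ × E → E}
    (h : IsWeakSpatialGradient Ω v G) {a b : ℝ} {K : Set E} (hK : IsOpen K) (hKc : Convex ℝ K)
    (hsub : Ioo a b ×ˢ K ⊆ Ω) (hv : IntegrableOn v (Ioo a b ×ˢ K))
    (hfin : volume (Ioo a b ×ˢ K) ≠ ∞) :
    DiffQuotientBound (Ioo a b) K v (∫⁻ X in Ioo a b ×ˢ K, ENNReal.ofReal (‖G X‖ ^ 2)) := by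
  have hΩm : MeasurableSet (Ioo a b ×ˢ K) := (isOpen_Ioo.prod hK).measurableSet
  have hGs : AEStronglyMeasurable G (volume.restrict (Ioo a b ×ˢ K)) :=
    (h.locallyIntegrable_grad.mono_set hsub).aestronglyMeasurable
  obtain ⟨G', hG'm, hGG'⟩ : ∃ G', Measurable G' ∧ G =ᵐ[volume.restrict (Ioo a b ×ˢ K)] G' :=
    ⟨_, hGs.stronglyMeasurable_mk.measurable, hGs.ae_eq_mk⟩
  have e : ∫⁻ X in Ioo a b ×ˢ K, ENNReal.ofReal (‖G X‖ ^ 2)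
      = ∫⁻ X in Ioo a b ×ˢ K, ENNReal.ofReal (‖G' X‖ ^ 2) := by
    refine lintegral_congr_ae ?_
    filter_upwards [hGG'] with X hX
    rw [hX]
  rw [e]
  refine diffQuotientBound_of_measurable hK hKc hG'm hv hfin fun φ hφ hφc hφs e => ?_
  have h1 := h.integral_eq φ hφ hφc (hφs.trans hsub) e
  have h2 : ∀ f : ℝ × E → ℝ, (∀ X, X ∉ tsupport φ → f X = 0) →
      ∫ X in Ω, f X = ∫ X in Ioo a b ×ˢ K, f X := by
    intro f hf
    rw [setIntegral_eq_integral_of_forall_compl_eq_zero fun X hX =>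
        hf X fun h => hX (hsub (hφs h)),
      setIntegral_eq_integral_of_forall_compl_eq_zero fun X hX => hf X fun h => hX (hφs h)]
  rw [h2, h2] at h1
  · rw [h1]
    congr 1
    refine integral_congr_ae ?_
    filter_upwards [hGG'] with X hX
    rw [hX]
  · intro X hX
    rw [image_eq_zero_of_notMem_tsupport hX, mul_zero]
  · intro X hX
    have : fderiv ℝ φ X = 0 :=
      image_eq_zero_of_notMem_tsupport fun h => hX (tsupport_fderiv_subset ℝ h)
    simp [this]

/-! ### The isoperimetric inequality between two levels -/

/-- If one of the two values lies in the band `(κ₂, κ₁)`, Young's inequality bounds the increment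
`D` of `(κ₁ - u)₊`, and the constant it produces is paid by the indicator of the band. Otherwise the
truncation is unchanged or jumps by the full width `κ₁ - κ₂ ≤ |D|`, which is at most `D² / (κ₁ -
κ₂)`. -/
theorem abs_sub_truncation_le {κ₁ κ₂ a b c : ℝ} (hκ : κ₂ < κ₁) (hc : 0 < c) :
    |max (min (κ₁ - b) (κ₁ - κ₂)) 0 - max (min (κ₁ - a) (κ₁ - κ₂)) 0|
      ≤ (c / 2 + 1 / (κ₁ - κ₂)) * (max (κ₁ - b) 0 - max (κ₁ - a) 0) ^ 2
        + 1 / (2 * c) * ((if κ₂ < a ∧ a < κ₁ then 1 else 0)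
          + (if κ₂ < b ∧ b < κ₁ then 1 else 0)) := by
  have hδ : 0 < κ₁ - κ₂ := sub_pos.2 hκ
  set D := max (κ₁ - b) 0 - max (κ₁ - a) 0 with hD
  set W := max (min (κ₁ - b) (κ₁ - κ₂)) 0 - max (min (κ₁ - a) (κ₁ - κ₂)) 0 with hW
  have hWD : |W| ≤ |D| := by
    have e : ∀ t, max (min (κ₁ - t) (κ₁ - κ₂)) 0 = min (max (κ₁ - t) 0) (κ₁ - κ₂) := by
      intro t
      rw [max_min_distrib_right, max_eq_left hδ.le]
    rw [hW, e, e]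
    exact (abs_min_sub_min_le_max _ _ _ _).trans (by simp [hD])
  have h2 : |D| ≤ c / 2 * D ^ 2 + 1 / (2 * c) := by
    have h3 : 0 ≤ (c * |D| - 1) ^ 2 / (2 * c) := by positivity
    have h4 : (c * |D| - 1) ^ 2 / (2 * c) = c / 2 * D ^ 2 + 1 / (2 * c) - |D| := by
      rw [← sq_abs D]; field_simp; ring
    linarith
  have h5 : 0 ≤ 1 / (κ₁ - κ₂) * D ^ 2 := by positivity
  have h6 : 0 < 1 / (2 * c) := by positivity
  have h7 : 0 ≤ c / 2 * D ^ 2 := by positivity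
  by_cases hA : (κ₂ < a ∧ a < κ₁) ∨ (κ₂ < b ∧ b < κ₁)
  · have h8 : 1 / (2 * c) ≤ 1 / (2 * c) * ((if κ₂ < a ∧ a < κ₁ then 1 else 0)
          + (if κ₂ < b ∧ b < κ₁ then 1 else 0)) := by
      refine le_mul_of_one_le_right h6.le ?_
      rcases hA with hA | hA <;> rw [if_pos hA] <;> split_ifs <;> norm_num
    nlinarith
  · push Not at hA
    have h8 : 0 ≤ 1 / (2 * c) * ((if κ₂ < a ∧ a < κ₁ then (1 : ℝ) else 0)
          + (if κ₂ < b ∧ b < κ₁ then 1 else 0)) := by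
      refine mul_nonneg h6.le ?_
      split_ifs <;> norm_num
    have h9 : |W| ≤ 1 / (κ₁ - κ₂) * D ^ 2 := by
      have hv : ∀ t, (κ₂ < t → κ₁ ≤ t) → (max (min (κ₁ - t) (κ₁ - κ₂)) 0 = 0 ∧ max (κ₁ - t) 0 = 0)
          ∨ (max (min (κ₁ - t) (κ₁ - κ₂)) 0 = κ₁ - κ₂ ∧ κ₁ - κ₂ ≤ max (κ₁ - t) 0) := by
        intro t ht
        by_cases h : κ₂ < t
        · left
          have := ht h
          refine ⟨max_eq_right ((min_le_left _ _).trans (by linarith)),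
            max_eq_right (by linarith)⟩
        · right
          push Not at h
          rw [min_eq_right (by linarith), max_eq_left hδ.le]
          exact ⟨rfl, le_max_of_le_left (by linarith)⟩
      have hjump : κ₁ - κ₂ ≤ |D| → κ₁ - κ₂ ≤ 1 / (κ₁ - κ₂) * D ^ 2 := by
        intro h
        rw [one_div, inv_mul_eq_div, le_div_iff₀ hδ, ← sq_abs D]
        nlinarith
      rcases hv a hA.1 with ⟨ha, ha'⟩ | ⟨ha, ha'⟩ <;> rcases hv b hA.2 with ⟨hb, hb'⟩ | ⟨hb, hb'⟩
      · rw [hW, ha, hb]; simpa using h5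
      · rw [hW, ha, hb, sub_zero, abs_of_pos hδ]
        apply hjump
        rw [hD, ha', sub_zero]
        exact hb'.trans (le_abs_self _)
      · rw [hW, ha, hb, zero_sub, abs_neg, abs_of_pos hδ]
        apply hjump
        rw [hD, hb', zero_sub, abs_neg]
        exact ha'.trans (le_abs_self _)
      · rw [hW, ha, hb]; simpa using h5
    nlinarith

theorem setLIntegral_translate_le {I : Set ℝ} {K : Set E} (hI : MeasurableSet I)
    (hK : MeasurableSet K) {S : Set (ℝ × E)} (hS : MeasurableSet S) (z y : E)
    (hSK : ∀ X ∈ S, X.1 ∈ I ∧ X.2 + y ∈ K ∧ X.2 + y + z ∈ K) (f : ℝ × E → ℝ≥0∞) :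
    ∫⁻ X in S, f (X.1, X.2 + y)
      ≤ ∫⁻ X in {X : ℝ × E | X.1 ∈ I ∧ X.2 ∈ K ∧ X.2 + z ∈ K}, f X := by
  have hm := measurableSet_translate_mem hI hK z
  rw [← lintegral_indicator hS, ← lintegral_indicator hm,
    ← lintegral_add_right_eq_self (indicator {X : ℝ × E | X.1 ∈ I ∧ X.2 ∈ K ∧ X.2 + z ∈ K} f)
      ((0, y) : ℝ × E)]
  refine lintegral_mono fun X => ?_
  by_cases hX : X ∈ S
  · have : X + (0, y) ∈ {X : ℝ × E | X.1 ∈ I ∧ X.2 ∈ K ∧ X.2 + z ∈ K} := by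
      have := hSK X hX
      simpa using this
    rw [indicator_of_mem hX, indicator_of_mem this, pair_add_eq]
  · simp [hX]

/-- Integrated form for a single displacement. The term `1 / (κ₁ - κ₂)` comes from jumps across the
band and is removed in `lintegral_abs_sub_truncation_le`. -/
theorem lintegral_abs_sub_truncation_step {I : Set ℝ} {K : Set E} (hI : MeasurableSet I)
    (hK : MeasurableSet K) {u : ℝ × E → ℝ} (hu : Measurable u)
    {κ₁ κ₂ : ℝ} (hκ : κ₂ < κ₁) {Γ : ℝ≥0∞}
    (hDQ : DiffQuotientBound I K (fun X => max (κ₁ - u X) 0) Γ) (z : E) {c : ℝ} (hc : 0 < c) :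
    ∫⁻ X in {X : ℝ × E | X.1 ∈ I ∧ X.2 ∈ K ∧ X.2 + z ∈ K},
        ENNReal.ofReal |max (min (κ₁ - u (X.1, X.2 + z)) (κ₁ - κ₂)) 0
          - max (min (κ₁ - u X) (κ₁ - κ₂)) 0|
      ≤ ENNReal.ofReal ((c / 2 + 1 / (κ₁ - κ₂)) * ‖z‖ ^ 2) * Γ
        + ENNReal.ofReal (1 / c) * volume ((I ×ˢ K) ∩ {X | κ₂ < u X ∧ u X < κ₁}) := by
  have hδ : 0 < κ₁ - κ₂ := sub_pos.2 hκ
  set S := {X : ℝ × E | X.1 ∈ I ∧ X.2 ∈ K ∧ X.2 + z ∈ K} with hS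
  have hm : MeasurableSet S := measurableSet_translate_mem hI hK z
  set A : Set (ℝ × E) := (I ×ˢ K) ∩ {X | κ₂ < u X ∧ u X < κ₁} with hA
  have hAm : MeasurableSet A := (hI.prod hK).inter
    ((measurableSet_lt measurable_const hu).inter (measurableSet_lt hu measurable_const))
  have hS0 : ∀ X ∈ S, X ∈ I ×ˢ K ∧ (X.1, X.2 + z) ∈ I ×ˢ K := fun X hX =>
    ⟨⟨hX.1, hX.2.1⟩, ⟨hX.1, hX.2.2⟩⟩
  have h1 : ∫⁻ X in S, A.indicator 1 X ≤ volume A := by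
    refine (setLIntegral_le_lintegral _ _).trans ?_
    rw [lintegral_indicator_one hAm]
  have h2 : ∫⁻ X in S, A.indicator 1 (X.1, X.2 + z) ≤ volume A := by
    refine (setLIntegral_le_lintegral _ _).trans ?_
    simp only [pair_add_eq]
    rw [lintegral_add_right_eq_self (fun X => A.indicator (1 : ℝ × E → ℝ≥0∞) X),
      lintegral_indicator_one hAm]
  have hum : Measurable (fun X : ℝ × E => u (X.1, X.2 + z)) := hu.comp (by fun_prop)
  have hAi : Measurable (A.indicator (1 : ℝ × E → ℝ≥0∞)) := measurable_one.indicator hAm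
  have hAi2 : Measurable (fun X : ℝ × E => A.indicator (1 : ℝ × E → ℝ≥0∞) (X.1, X.2 + z)) :=
    hAi.comp (by fun_prop)
  calc _ ≤ ∫⁻ X in S, (ENNReal.ofReal (c / 2 + 1 / (κ₁ - κ₂)) *
          ENNReal.ofReal ((max (κ₁ - u (X.1, X.2 + z)) 0 - max (κ₁ - u X) 0) ^ 2)
          + ENNReal.ofReal (1 / (2 * c)) * (A.indicator 1 X + A.indicator 1 (X.1, X.2 + z))) := by
        refine setLIntegral_mono' hm fun X hX => ?_
        refine (ENNReal.ofReal_le_ofReal (abs_sub_truncation_le hκ hc (a := u X))).trans ?_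
        have hcp : 0 ≤ c / 2 + 1 / (κ₁ - κ₂) := by positivity
        have hi : ∀ p : Prop, [Decidable p] → (0 : ℝ) ≤ if p then 1 else 0 := by
          intro p _; split_ifs <;> norm_num
        rw [ENNReal.ofReal_add (mul_nonneg hcp (sq_nonneg _))
            (mul_nonneg (by positivity) (add_nonneg (hi _) (hi _))), ENNReal.ofReal_mul hcp,
          ENNReal.ofReal_mul (by positivity : (0 : ℝ) ≤ 1 / (2 * c)),
          ENNReal.ofReal_add (hi _) (hi _)]
        have e1 : ENNReal.ofReal (if κ₂ < u X ∧ u X < κ₁ then 1 else 0) = A.indicator 1 X := by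
          by_cases h : κ₂ < u X ∧ u X < κ₁
          · have : X ∈ A := ⟨(hS0 X hX).1, h⟩
            simp [h, this]
          · have : X ∉ A := fun h' => h h'.2
            simp [h, this]
        have e2 : ENNReal.ofReal (if κ₂ < u (X.1, X.2 + z) ∧ u (X.1, X.2 + z) < κ₁ then 1 else 0)
            = A.indicator 1 (X.1, X.2 + z) := by
          by_cases h : κ₂ < u (X.1, X.2 + z) ∧ u (X.1, X.2 + z) < κ₁
          · have : (X.1, X.2 + z) ∈ A := ⟨(hS0 X hX).2, h⟩
            simp [h, this]
          · have : (X.1, X.2 + z) ∉ A := fun h' => h h'.2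
            simp [h, this]
        rw [e1, e2]
    _ = ENNReal.ofReal (c / 2 + 1 / (κ₁ - κ₂)) * (∫⁻ X in S,
          ENNReal.ofReal ((max (κ₁ - u (X.1, X.2 + z)) 0 - max (κ₁ - u X) 0) ^ 2))
          + ENNReal.ofReal (1 / (2 * c)) *
            ((∫⁻ X in S, A.indicator 1 X) + ∫⁻ X in S, A.indicator 1 (X.1, X.2 + z)) := by
        rw [lintegral_add_left (by fun_prop), lintegral_const_mul _ (by fun_prop),
          lintegral_const_mul _ (by fun_prop), lintegral_add_left hAi]
    _ ≤ ENNReal.ofReal (c / 2 + 1 / (κ₁ - κ₂)) * (ENNReal.ofReal (‖z‖ ^ 2) * Γ)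
          + ENNReal.ofReal (1 / (2 * c)) * (volume A + volume A) := by
        gcongr
        exact hDQ z
    _ = _ := by
        rw [← mul_assoc, ← ENNReal.ofReal_mul (by positivity), ← two_mul, ← mul_assoc]
        congr 2
        rw [show (2 : ℝ≥0∞) = ENNReal.ofReal 2 by simp, ← ENNReal.ofReal_mul (by positivity)]
        congr 1
        field_simp

/-- Cutting `z` into `n` equal pieces exploits that the jump term is quadratic in the displacement:
it sums to order `‖z‖² / (n (κ₁ - κ₂))`. This is a discrete form of the fact that a Sobolev function
does not jump across the band. The parameter `n c` on each piece leaves the sums of the other two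
terms independent of `n`. -/
theorem lintegral_abs_sub_truncation_le {I : Set ℝ} {K : Set E} (hI : MeasurableSet I)
    (hK : MeasurableSet K) (hKc : Convex ℝ K) {u : ℝ × E → ℝ} (hu : Measurable u)
    {κ₁ κ₂ : ℝ} (hκ : κ₂ < κ₁) {Γ : ℝ≥0∞}
    (hDQ : DiffQuotientBound I K (fun X => max (κ₁ - u X) 0) Γ) (z : E) {c : ℝ} (hc : 0 < c) :
    ∫⁻ X in {X : ℝ × E | X.1 ∈ I ∧ X.2 ∈ K ∧ X.2 + z ∈ K},
        ENNReal.ofReal |max (min (κ₁ - u (X.1, X.2 + z)) (κ₁ - κ₂)) 0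
          - max (min (κ₁ - u X) (κ₁ - κ₂)) 0|
      ≤ ENNReal.ofReal (c * ‖z‖ ^ 2) * Γ
        + ENNReal.ofReal (1 / c) * volume ((I ×ˢ K) ∩ {X | κ₂ < u X ∧ u X < κ₁}) := by
  have hδ : 0 < κ₁ - κ₂ := sub_pos.2 hκ
  -- For such `n`, `1 / (κ₁ - κ₂) ≤ n c / 2`: the jump term is no larger than the Young term.
  obtain ⟨n, hn⟩ := exists_nat_gt (2 / (c * (κ₁ - κ₂)))
  have hn0 : (0 : ℝ) < n := lt_trans (by positivity) hn
  set S := {X : ℝ × E | X.1 ∈ I ∧ X.2 ∈ K ∧ X.2 + z ∈ K} with hS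
  have hm : MeasurableSet S := measurableSet_translate_mem hI hK z
  set w : ℝ × E → ℝ := fun X => max (min (κ₁ - u X) (κ₁ - κ₂)) 0 with hw
  have hwm : Measurable w := by fun_prop
  set ζ : E := (1 / (n : ℝ)) • z with hζ
  have hseg : ∀ X ∈ S, ∀ i : ℕ, i ≤ n → X.2 + (i : ℝ) • ζ ∈ K := by
    intro X hX i hi
    have h1 : (i : ℝ) / n ≤ 1 := by
      rw [div_le_one hn0]; exact_mod_cast hi
    have := hKc hX.2.1 hX.2.2 (sub_nonneg.2 h1) (by positivity : (0 : ℝ) ≤ i / n) (by ring)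
    convert this using 1
    rw [hζ, smul_smul, mul_one_div]
    module
  have hstep := lintegral_abs_sub_truncation_step hI hK hu hκ hDQ ζ
    (mul_pos hn0 hc : 0 < (n : ℝ) * c)
  set T := ENNReal.ofReal (((n : ℝ) * c / 2 + 1 / (κ₁ - κ₂)) * ‖ζ‖ ^ 2) * Γ
        + ENNReal.ofReal (1 / ((n : ℝ) * c)) * volume ((I ×ˢ K) ∩ {X | κ₂ < u X ∧ u X < κ₁})
    with hT
  have hpt : ∀ X : ℝ × E, ENNReal.ofReal |w (X.1, X.2 + z) - w X|
      ≤ ∑ i ∈ Finset.range n, ENNReal.ofReal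
        |w (X.1, (X.2 + (i : ℝ) • ζ) + ζ) - w (X.1, X.2 + (i : ℝ) • ζ)| := by
    intro X
    rw [← ENNReal.ofReal_sum_of_nonneg fun _ _ => abs_nonneg _]
    refine ENNReal.ofReal_le_ofReal ?_
    have h1 := Finset.sum_range_sub (fun i : ℕ => w (X.1, X.2 + (i : ℝ) • ζ)) n
    have e1 : X.2 + (n : ℝ) • ζ = X.2 + z := by
      rw [hζ, smul_smul, mul_one_div_cancel hn0.ne', one_smul]
    simp only [e1, Nat.cast_zero, zero_smul, add_zero] at h1
    rw [← h1]
    refine (Finset.abs_sum_le_sum_abs _ _).trans (le_of_eq ?_)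
    refine Finset.sum_congr rfl fun i _ => ?_
    rw [Nat.cast_succ, add_smul, one_smul, add_assoc]
  calc ∫⁻ X in S, ENNReal.ofReal |w (X.1, X.2 + z) - w X|
      ≤ ∫⁻ X in S, ∑ i ∈ Finset.range n, ENNReal.ofReal
        |w (X.1, (X.2 + (i : ℝ) • ζ) + ζ) - w (X.1, X.2 + (i : ℝ) • ζ)| :=
        lintegral_mono fun X => hpt X
    _ = ∑ i ∈ Finset.range n, ∫⁻ X in S, ENNReal.ofReal
        |w (X.1, (X.2 + (i : ℝ) • ζ) + ζ) - w (X.1, X.2 + (i : ℝ) • ζ)| := by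
        refine lintegral_finsetSum _ fun i _ => ?_
        have h1 : Measurable fun X : ℝ × E => w (X.1, (X.2 + (i : ℝ) • ζ) + ζ) :=
          hwm.comp (by fun_prop)
        have h2 : Measurable fun X : ℝ × E => w (X.1, X.2 + (i : ℝ) • ζ) :=
          hwm.comp (by fun_prop)
        exact (measurable_norm.comp (h1.sub h2)).ennreal_ofReal
    _ ≤ ∑ i ∈ Finset.range n, T := by
        refine Finset.sum_le_sum fun i hi => le_trans ?_ hstep
        refine setLIntegral_translate_le hI hK hm ζ ((i : ℝ) • ζ) (fun X hX => ?_)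
          (fun X => ENNReal.ofReal |w (X.1, X.2 + ζ) - w X|)
        rw [Finset.mem_range] at hi
        refine ⟨hX.1, hseg X hX i hi.le, ?_⟩
        have := hseg X hX (i + 1) hi
        rwa [Nat.cast_succ, add_smul, one_smul, ← add_assoc] at this
    _ = (n : ℝ≥0∞) * T := by simp
    _ ≤ _ := by
        rw [hT, mul_add, ← mul_assoc, ← mul_assoc, ← ENNReal.ofReal_natCast,
          ← ENNReal.ofReal_mul hn0.le, ← ENNReal.ofReal_mul hn0.le]
        refine add_le_add (mul_le_mul_left (ENNReal.ofReal_le_ofReal ?_) _)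
          (mul_le_mul_left (ENNReal.ofReal_le_ofReal ?_) _)
        · have e : ‖ζ‖ = ‖z‖ / n := by
            rw [hζ, norm_smul, Real.norm_eq_abs, abs_of_pos (by positivity), one_div_mul_eq_div]
          rw [e]
          have h1 : 1 / (κ₁ - κ₂) ≤ n * c / 2 := by
            rw [div_lt_iff₀ (by positivity)] at hn
            rw [div_le_div_iff₀ hδ (by norm_num)]
            linarith
          calc (n : ℝ) * ((n * c / 2 + 1 / (κ₁ - κ₂)) * (‖z‖ / n) ^ 2)
              ≤ (n : ℝ) * ((n * c / 2 + n * c / 2) * (‖z‖ / n) ^ 2) := by gcongr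
            _ = c * ‖z‖ ^ 2 := by field_simp; ring
        · refine le_of_eq ?_
          field_simp

theorem ae_prod_of_ae_fst {p : ℝ → Prop} (h : ∀ᵐ t, p t) : ∀ᵐ X : ℝ × E, p X.1 :=
  Measure.quasiMeasurePreserving_fst.ae h

theorem ae_slice_eq {I : Set ℝ} {K : Set E} {u w : ℝ × E → ℝ}
    (h : u =ᵐ[volume.restrict (I ×ˢ K)] w) :
    ∀ᵐ t ∂volume.restrict I, (fun x => u (t, x)) =ᵐ[volume.restrict K] fun x => w (t, x) := by
  rw [Measure.volume_eq_prod, ← Measure.prod_restrict] at h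
  exact Measure.ae_ae_of_ae_prod h

theorem measure_inter_congr_of_ae_restrict {α : Type*} [MeasurableSpace α] {μ : Measure α}
    {K : Set α} (hK : MeasurableSet K) {f g : α → ℝ} (h : f =ᵐ[μ.restrict K] g) (p : ℝ → Prop) :
    μ (K ∩ {x | p (f x)}) = μ (K ∩ {x | p (g x)}) := by
  refine measure_congr ?_
  filter_upwards [(ae_restrict_iff' hK).1 h] with x hx
  refine propext ⟨fun hh => ⟨hh.1, ?_⟩, fun hh => ⟨hh.1, ?_⟩⟩
  · have h1 : p (f x) := hh.2
    rwa [hx hh.1] at h1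
  · have h1 : p (g x) := hh.2
    rwa [← hx hh.1] at h1

/-- Double counting of pairs `(X, z)`: from a point where `u ≤ κ₂`, the displacements leading into
`{κ₁ ≤ u}` have measure at least `m`, and each changes the truncation by `κ₁ - κ₂`. All of them lie
in the ball of radius `2 r`, over which the `L¹` increment bound is integrated. -/
theorem isoperimetric_of_measurable {I : Set ℝ} (hI : MeasurableSet I) (y : E) {r : ℝ}
    {u : ℝ × E → ℝ} (hu : Measurable u)
    {κ₁ κ₂ : ℝ} (hκ : κ₂ < κ₁) {Γ m : ℝ≥0∞}
    (hDQ : DiffQuotientBound I (Metric.ball y r) (fun X => max (κ₁ - u X) 0) Γ)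
    (hm : ∀ᵐ t ∂volume.restrict I, m ≤ volume (Metric.ball y r ∩ {x | κ₁ ≤ u (t, x)}))
    {c : ℝ} (hc : 0 < c) :
    m * ENNReal.ofReal (κ₁ - κ₂) * volume ((I ×ˢ Metric.ball y r) ∩ {X | u X ≤ κ₂})
      ≤ volume (Metric.ball (0 : E) (2 * r)) * (ENNReal.ofReal (c * (2 * r) ^ 2) * Γ
        + ENNReal.ofReal (1 / c) *
          volume ((I ×ˢ Metric.ball y r) ∩ {X | κ₂ < u X ∧ u X < κ₁})) := by
  set K := Metric.ball y r with hKdef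
  have hK : MeasurableSet K := measurableSet_ball
  have hδ : 0 < κ₁ - κ₂ := sub_pos.2 hκ
  set w : ℝ × E → ℝ := fun X => max (min (κ₁ - u X) (κ₁ - κ₂)) 0 with hw
  have hwm : Measurable w := by fun_prop
  set A : Set (ℝ × E) := (I ×ˢ K) ∩ {X | u X ≤ κ₂} with hA
  have hAm : MeasurableSet A := (hI.prod hK).inter (measurableSet_le hu measurable_const)
  let T : Set ((ℝ × E) × E) := {p | p.1.1 ∈ I ∧ p.1.2 ∈ K ∧ p.1.2 + p.2 ∈ K}
  have hT : MeasurableSet T :=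
    (by fun_prop : Measurable fun p : (ℝ × E) × E => p.1.1) hI |>.inter
      (((by fun_prop : Measurable fun p : (ℝ × E) × E => p.1.2) hK).inter
        ((by fun_prop : Measurable fun p : (ℝ × E) × E => p.1.2 + p.2) hK))
  let F : (ℝ × E) × E → ℝ≥0∞ := T.indicator fun p =>
    ENNReal.ofReal |w (p.1.1, p.1.2 + p.2) - w p.1|
  have hF : Measurable F := by
    refine Measurable.indicator ?_ hT
    have h1 : Measurable fun p : (ℝ × E) × E => w (p.1.1, p.1.2 + p.2) := hwm.comp (by fun_prop)
    have h2 : Measurable fun p : (ℝ × E) × E => w p.1 := hwm.comp (by fun_prop)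
    exact (measurable_norm.comp (h1.sub h2)).ennreal_ofReal
  have hm' : ∀ᵐ X : ℝ × E, X.1 ∈ I → m ≤ volume (K ∩ {x | κ₁ ≤ u (X.1, x)}) :=
    ae_prod_of_ae_fst ((ae_restrict_iff' hI).1 hm)
  calc m * ENNReal.ofReal (κ₁ - κ₂) * volume A
      = ∫⁻ X in A, m * ENNReal.ofReal (κ₁ - κ₂) := by rw [setLIntegral_const]
    _ ≤ ∫⁻ X in A, ∫⁻ z in Metric.ball (0 : E) (2 * r), F (X, z) := by
        refine setLIntegral_mono_ae' hAm ?_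
        filter_upwards [hm'] with X hX hXA
        have h0 : X.1 ∈ I := hXA.1.1
        have hXK : X.2 ∈ K := hXA.1.2
        have huX : u X ≤ κ₂ := hXA.2
        let Z : Set E := {z | X.2 + z ∈ K ∩ {x | κ₁ ≤ u (X.1, x)}}
        have hB : MeasurableSet (K ∩ {x | κ₁ ≤ u (X.1, x)}) :=
          hK.inter (measurableSet_le measurable_const (by fun_prop))
        have hZ : MeasurableSet Z := (measurable_const_add X.2) hB
        have hvZ : volume Z = volume (K ∩ {x | κ₁ ≤ u (X.1, x)}) :=
          measure_preimage_add volume X.2 _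
        have hZ2 : Z ⊆ Metric.ball 0 (2 * r) := by
          intro z hz
          have h1 : X.2 + z ∈ Metric.ball y r := hz.1
          have h2 : X.2 ∈ Metric.ball y r := hXK
          rw [mem_ball_iff_norm] at h1 h2 ⊢
          calc ‖z - 0‖ = ‖(X.2 + z - y) - (X.2 - y)‖ := by congr 1; abel
            _ ≤ ‖X.2 + z - y‖ + ‖X.2 - y‖ := norm_sub_le _ _
            _ < 2 * r := by linarith
        calc m * ENNReal.ofReal (κ₁ - κ₂) ≤ volume Z * ENNReal.ofReal (κ₁ - κ₂) := by
              rw [hvZ]; gcongr; exact hX h0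
          _ = ∫⁻ z in Z, ENNReal.ofReal (κ₁ - κ₂) := by rw [setLIntegral_const, mul_comm]
          _ ≤ ∫⁻ z in Z, F (X, z) := by
              refine setLIntegral_mono' hZ fun z hz => ?_
              have hTz : (X, z) ∈ T := ⟨h0, hXK, hz.1⟩
              have h1 : κ₁ ≤ u (X.1, X.2 + z) := hz.2
              have e1 : w (X.1, X.2 + z) = 0 := by
                simp only [hw]
                exact max_eq_right ((min_le_left _ _).trans (by linarith))
              have e2 : w X = κ₁ - κ₂ := by
                simp only [hw]
                rw [min_eq_right (by linarith), max_eq_left hδ.le]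
              simp only [F]
              rw [indicator_of_mem hTz, e1, e2, zero_sub, abs_neg, abs_of_pos hδ]
          _ ≤ ∫⁻ z in Metric.ball (0 : E) (2 * r), F (X, z) := lintegral_mono_set hZ2
    _ ≤ ∫⁻ X, ∫⁻ z in Metric.ball (0 : E) (2 * r), F (X, z) := setLIntegral_le_lintegral _ _
    _ = ∫⁻ z in Metric.ball (0 : E) (2 * r), ∫⁻ X, F (X, z) :=
        lintegral_lintegral_swap hF.aemeasurable
    _ ≤ ∫⁻ z in Metric.ball (0 : E) (2 * r), (ENNReal.ofReal (c * (2 * r) ^ 2) * Γ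
        + ENNReal.ofReal (1 / c) * volume ((I ×ˢ K) ∩ {X | κ₂ < u X ∧ u X < κ₁})) := by
        refine setLIntegral_mono' measurableSet_ball fun z hz => ?_
        have e : ∫⁻ X, F (X, z) = ∫⁻ X in {X : ℝ × E | X.1 ∈ I ∧ X.2 ∈ K ∧ X.2 + z ∈ K},
            ENNReal.ofReal |w (X.1, X.2 + z) - w X| := by
          rw [← lintegral_indicator (measurableSet_translate_mem hI hK z)]
          rfl
        rw [e]
        refine (lintegral_abs_sub_truncation_le hI hK (convex_ball y r) hu hκ hDQ z hc).trans ?_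
        have : ‖z‖ < 2 * r := by simpa using hz
        gcongr
    _ = _ := by rw [setLIntegral_const, mul_comm]

/-- The slices of a measurable representative agree with those of `u` only at almost every time,
which is why `isoperimetric_of_measurable` asks for the slice bound almost everywhere. -/
theorem isoperimetric {I : Set ℝ} (hI : MeasurableSet I) (y : E) {r : ℝ}
    {u : ℝ × E → ℝ} (hu : AEMeasurable u (volume.restrict (I ×ˢ Metric.ball y r)))
    {κ₁ κ₂ : ℝ} (hκ : κ₂ < κ₁) {Γ m : ℝ≥0∞}
    (hDQ : DiffQuotientBound I (Metric.ball y r) (fun X => max (κ₁ - u X) 0) Γ)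
    (hm : ∀ t ∈ I, m ≤ volume (Metric.ball y r ∩ {x | κ₁ ≤ u (t, x)}))
    {c : ℝ} (hc : 0 < c) :
    m * ENNReal.ofReal (κ₁ - κ₂) * volume ((I ×ˢ Metric.ball y r) ∩ {X | u X ≤ κ₂})
      ≤ volume (Metric.ball (0 : E) (2 * r)) * (ENNReal.ofReal (c * (2 * r) ^ 2) * Γ
        + ENNReal.ofReal (1 / c) *
          volume ((I ×ˢ Metric.ball y r) ∩ {X | κ₂ < u X ∧ u X < κ₁})) := by
  have hIK : MeasurableSet (I ×ˢ Metric.ball y r) := hI.prod measurableSet_ball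
  obtain ⟨w, hwm, huw⟩ : ∃ w, Measurable w ∧ u =ᵐ[volume.restrict (I ×ˢ Metric.ball y r)] w :=
    ⟨_, hu.measurable_mk, hu.ae_eq_mk⟩
  rw [measure_inter_congr_of_ae_restrict hIK huw (· ≤ κ₂),
    measure_inter_congr_of_ae_restrict hIK huw (fun s => κ₂ < s ∧ s < κ₁)]
  refine isoperimetric_of_measurable hI y hwm hκ
    (hDQ.congr_ae hI measurableSet_ball ?_) ?_ hc
  · filter_upwards [huw] with X hX
    rw [hX]
  · filter_upwards [ae_slice_eq huw, ae_restrict_mem hI] with t ht htI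
    rw [← measure_inter_congr_of_ae_restrict measurableSet_ball ht (κ₁ ≤ ·)]
    exact hm t htI

/-! ### Averaging over displacements: Faber–Krahn and half-filled balls -/

/-- Chebyshev's inequality in `z`: if half of the displacements in `B_ε` give a squared increment at
least `c X`, the mean squared increment is at least `c X / 2`, and Fubini passes it to the
difference quotient bound. -/
theorem lintegral_le_of_diffQuotientBound {I : Set ℝ} {K : Set E} {v : ℝ × E → ℝ}
    (hv : Measurable v) {Γ : ℝ≥0∞} (hDQ : DiffQuotientBound I K v Γ) {ε : ℝ} (hε : 0 < ε)
    {P : Set (ℝ × E)}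
    (hPK : ∀ X ∈ P, X.1 ∈ I ∧ X.2 ∈ K ∧ ∀ z ∈ Metric.ball (0 : E) ε, X.2 + z ∈ K)
    (c : ℝ × E → ℝ≥0∞)
    (hc : ∀ᵐ X ∂volume.restrict P, volume (Metric.ball (0 : E) ε) ≤
      2 * volume (Metric.ball (0 : E) ε ∩
        {z | c X ≤ ENNReal.ofReal ((v (X.1, X.2 + z) - v X) ^ 2)})) :
    ∫⁻ X in P, c X ≤ 2 * (ENNReal.ofReal (ε ^ 2) * Γ) := by
  set B := Metric.ball (0 : E) ε with hB
  have hBm : MeasurableSet B := measurableSet_ball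
  have hB0 : volume B ≠ 0 := (Metric.measure_ball_pos volume 0 hε).ne'
  have hBt : volume B ≠ ∞ := measure_ball_lt_top.ne
  have hF : Measurable fun p : (ℝ × E) × E =>
      ENNReal.ofReal ((v (p.1.1, p.1.2 + p.2) - v p.1) ^ 2) := by
    have h1 : Measurable fun p : (ℝ × E) × E => v (p.1.1, p.1.2 + p.2) := hv.comp (by fun_prop)
    fun_prop
  have key : volume B * ∫⁻ X in P, c X ≤ volume B * (2 * (ENNReal.ofReal (ε ^ 2) * Γ)) := by
    calc volume B * ∫⁻ X in P, c X = ∫⁻ X in P, volume B * c X := by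
          rw [lintegral_const_mul' _ _ hBt]
      _ ≤ ∫⁻ X in P, 2 * ∫⁻ z in B, ENNReal.ofReal ((v (X.1, X.2 + z) - v X) ^ 2) := by
          refine lintegral_mono_ae ?_
          filter_upwards [hc] with X hX
          have hm : Measurable fun z : E => ENNReal.ofReal ((v (X.1, X.2 + z) - v X) ^ 2) :=
            hF.comp (by fun_prop : Measurable fun z : E => (X, z))
          have h1 := mul_meas_ge_le_lintegral (μ := volume.restrict B) hm (c X)
          rw [Measure.restrict_apply (measurableSet_le measurable_const hm), inter_comm] at h1
          calc volume B * c X ≤ 2 * volume (B ∩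
                {z | c X ≤ ENNReal.ofReal ((v (X.1, X.2 + z) - v X) ^ 2)}) * c X := by gcongr
            _ = 2 * (c X * volume (B ∩
                {z | c X ≤ ENNReal.ofReal ((v (X.1, X.2 + z) - v X) ^ 2)})) := by ring
            _ ≤ _ := by gcongr
      _ = 2 * ∫⁻ X in P, ∫⁻ z in B, ENNReal.ofReal ((v (X.1, X.2 + z) - v X) ^ 2) := by
          rw [lintegral_const_mul' _ _ (by norm_num)]
      _ = 2 * ∫⁻ z in B, ∫⁻ X in P, ENNReal.ofReal ((v (X.1, X.2 + z) - v X) ^ 2) := by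
          rw [lintegral_lintegral_swap hF.aemeasurable]
      _ ≤ 2 * ∫⁻ z in B, ENNReal.ofReal (ε ^ 2) * Γ := by
          gcongr 2 * ?_
          refine setLIntegral_mono' hBm fun z hz => ?_
          have hz' : ‖z‖ < ε := by simpa [hB] using hz
          calc _ ≤ ∫⁻ X in {X : ℝ × E | X.1 ∈ I ∧ X.2 ∈ K ∧ X.2 + z ∈ K},
                ENNReal.ofReal ((v (X.1, X.2 + z) - v X) ^ 2) :=
                lintegral_mono_set fun X hX => ⟨(hPK X hX).1, (hPK X hX).2.1, (hPK X hX).2.2 z hz⟩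
            _ ≤ ENNReal.ofReal (‖z‖ ^ 2) * Γ := hDQ z
            _ ≤ _ := by gcongr
      _ = _ := by rw [setLIntegral_const]; ring
  exact (ENNReal.mul_le_mul_iff_right hB0 hBt).1 key

theorem measure_le_two_mul_of_compl {α : Type*} [MeasurableSpace α] {μ : Measure α}
    {B N A : Set α} (hBt : μ B ≠ ∞) (hN : 2 * μ (B ∩ N) ≤ μ B)
    (hA : ∀ x ∈ B, x ∉ N → x ∈ A) : μ B ≤ 2 * μ (B ∩ A) := by
  have h1 : μ B ≤ μ (B ∩ N) + μ (B ∩ A) := by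
    refine (measure_mono fun x hx => ?_).trans (measure_union_le _ _)
    by_cases h : x ∈ N
    · exact Or.inl ⟨hx, h⟩
    · exact Or.inr ⟨hx, hA x hx h⟩
  have h2 : μ B + μ B ≤ μ B + 2 * μ (B ∩ A) := by
    calc μ B + μ B = 2 * μ B := (two_mul _).symm
      _ ≤ 2 * (μ (B ∩ N) + μ (B ∩ A)) := by gcongr
      _ = 2 * μ (B ∩ N) + 2 * μ (B ∩ A) := mul_add _ _ _
      _ ≤ _ := by gcongr
  exact (ENNReal.add_le_add_iff_left hBt).1 h2

theorem volume_ball_eq_zero_center (x : E) (r : ℝ) :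
    volume (Metric.ball x r) = volume (Metric.ball (0 : E) r) :=
  Measure.addHaar_ball_center volume x r

theorem volume_ball_inter_translate (x : E) (ε : ℝ) (N : Set E) :
    volume (Metric.ball (0 : E) ε ∩ {z | x + z ∈ N}) = volume (Metric.ball x ε ∩ N) := by
  rw [← measure_preimage_add volume x (Metric.ball x ε ∩ N)]
  congr 1
  ext z
  simp

theorem add_mem_ball_add {y x z : E} {r s : ℝ} (hx : x ∈ Metric.ball y r)
    (hz : z ∈ Metric.ball (0 : E) s) : x + z ∈ Metric.ball y (r + s) := by
  rw [mem_ball_iff_norm] at *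
  calc ‖x + z - y‖ = ‖(x - y) + (z - 0)‖ := by congr 1; abel
    _ ≤ ‖x - y‖ + ‖z - 0‖ := norm_add_le _ _
    _ < r + s := by linarith

/-- Faber–Krahn inequality: a function with small support is controlled by its gradient. -/
theorem lintegral_sq_le_of_small_support {I : Set ℝ} (hI : MeasurableSet I) (y : E) {r ρ : ℝ}
    (hρ : 0 < ρ) {v : ℝ × E → ℝ}
    (hv : AEMeasurable v (volume.restrict (I ×ˢ Metric.ball y (r + ρ)))) {Γ : ℝ≥0∞}
    (hDQ : DiffQuotientBound I (Metric.ball y (r + ρ)) v Γ)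
    (hs : ∀ t ∈ I, 2 * volume (Metric.ball y (r + ρ) ∩ {x | v (t, x) ≠ 0})
      ≤ volume (Metric.ball (0 : E) ρ)) :
    ∫⁻ X in I ×ˢ Metric.ball y r, ENNReal.ofReal (v X ^ 2)
      ≤ 2 * (ENNReal.ofReal (ρ ^ 2) * Γ) := by
  have hIK : MeasurableSet (I ×ˢ Metric.ball y (r + ρ)) := hI.prod measurableSet_ball
  have hsub : Metric.ball y r ⊆ Metric.ball y (r + ρ) := Metric.ball_subset_ball (by linarith)
  obtain ⟨w, hwm, hvw⟩ : ∃ w, Measurable w ∧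
      v =ᵐ[volume.restrict (I ×ˢ Metric.ball y (r + ρ))] w :=
    ⟨_, hv.measurable_mk, hv.ae_eq_mk⟩
  have e : ∫⁻ X in I ×ˢ Metric.ball y r, ENNReal.ofReal (v X ^ 2)
      = ∫⁻ X in I ×ˢ Metric.ball y r, ENNReal.ofReal (w X ^ 2) := by
    refine lintegral_congr_ae ?_
    filter_upwards [ae_restrict_of_ae_restrict_of_subset (prod_mono_right hsub) hvw] with X hX
    rw [hX]
  rw [e]
  have hDQ' := hDQ.congr_ae hI measurableSet_ball hvw
  refine lintegral_le_of_diffQuotientBound hwm hDQ' hρ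
    (fun X hX => ⟨hX.1, hsub hX.2, fun z hz => add_mem_ball_add hX.2 hz⟩) _ ?_
  have h1 : ∀ᵐ t ∂volume.restrict I, 2 * volume (Metric.ball y (r + ρ) ∩ {x | w (t, x) ≠ 0})
      ≤ volume (Metric.ball (0 : E) ρ) := by
    filter_upwards [ae_slice_eq hvw, ae_restrict_mem hI] with t ht htI
    rw [← measure_inter_congr_of_ae_restrict measurableSet_ball ht (· ≠ 0)]
    exact hs t htI
  rw [ae_restrict_iff' (hI.prod measurableSet_ball)]
  filter_upwards [ae_prod_of_ae_fst (d := d) ((ae_restrict_iff' hI).1 h1)] with X hX hXm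
  refine measure_le_two_mul_of_compl measure_ball_lt_top.ne
    (N := {z | X.2 + z ∈ {x | w (X.1, x) ≠ 0}}) ?_ fun z hz hzN => ?_
  · rw [volume_ball_inter_translate]
    refine le_trans ?_ (hX hXm.1)
    gcongr
    intro x hx
    have := add_mem_ball_add hXm.2 (z := x - X.2) (s := ρ) (by
      rw [mem_ball_iff_norm] at hx ⊢; simpa using hx)
    simpa using this
  -- Off the support the increment from `X` is `-w X`.
  · have h2 : w (X.1, X.2 + z) = 0 := by
      by_contra h; exact hzN h
    show ENNReal.ofReal (w X ^ 2) ≤ ENNReal.ofReal ((w (X.1, X.2 + z) - w X) ^ 2)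
    rw [h2]
    simp

/-- If `u` is below `κ₂` on half of every small ball, then `u` is rarely above `κ₁`. -/
theorem measure_ge_le_of_half_balls {I : Set ℝ} (hI : MeasurableSet I) (y : E) {r ε : ℝ}
    (hε : 0 < ε) {u : ℝ × E → ℝ} {κ₁ κ₂ : ℝ} (hκ : κ₂ < κ₁)
    (hu : AEMeasurable u (volume.restrict (I ×ˢ Metric.ball y (r + ε)))) {Γ : ℝ≥0∞}
    (hDQ : DiffQuotientBound I (Metric.ball y (r + ε)) (fun X => max (κ₁ - u X) 0) Γ)
    (hs : ∀ t ∈ I, ∀ x ∈ Metric.ball y r, 2 * volume (Metric.ball x ε ∩ {x | κ₂ ≤ u (t, x)})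
      ≤ volume (Metric.ball (0 : E) ε)) :
    ENNReal.ofReal ((κ₁ - κ₂) ^ 2) * volume ((I ×ˢ Metric.ball y r) ∩ {X | κ₁ ≤ u X})
      ≤ 2 * (ENNReal.ofReal (ε ^ 2) * Γ) := by
  have hIK : MeasurableSet (I ×ˢ Metric.ball y (r + ε)) := hI.prod measurableSet_ball
  have hsub : Metric.ball y r ⊆ Metric.ball y (r + ε) := Metric.ball_subset_ball (by linarith)
  obtain ⟨w, hwm, huw⟩ : ∃ w, Measurable w ∧
      u =ᵐ[volume.restrict (I ×ˢ Metric.ball y (r + ε))] w :=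
    ⟨_, hu.measurable_mk, hu.ae_eq_mk⟩
  rw [measure_inter_congr_of_ae_restrict (hI.prod measurableSet_ball)
    (ae_restrict_of_ae_restrict_of_subset (prod_mono_right hsub) huw) (κ₁ ≤ ·)]
  have hDQ' : DiffQuotientBound I (Metric.ball y (r + ε)) (fun X => max (κ₁ - w X) 0) Γ := by
    refine hDQ.congr_ae hI measurableSet_ball ?_
    filter_upwards [huw] with X hX
    rw [hX]
  have hP : MeasurableSet ((I ×ˢ Metric.ball y r) ∩ {X | κ₁ ≤ w X}) :=
    (hI.prod measurableSet_ball).inter (measurableSet_le measurable_const hwm)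
  have := lintegral_le_of_diffQuotientBound (by fun_prop) hDQ' hε (P := (I ×ˢ Metric.ball y r) ∩ {X | κ₁ ≤ w X})
    (fun X hX => ⟨hX.1.1, hsub hX.1.2, fun z hz => add_mem_ball_add hX.1.2 hz⟩)
    (fun _ => ENNReal.ofReal ((κ₁ - κ₂) ^ 2)) ?_
  · rwa [setLIntegral_const] at this
  have h1 : ∀ᵐ t ∂volume.restrict I, ∀ x ∈ Metric.ball y r,
      2 * volume (Metric.ball x ε ∩ {x | κ₂ ≤ w (t, x)}) ≤ volume (Metric.ball (0 : E) ε) := by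
    filter_upwards [ae_slice_eq huw, ae_restrict_mem hI] with t ht htI x hx
    have hb : Metric.ball x ε ⊆ Metric.ball y (r + ε) := by
      intro x' hx'
      have := add_mem_ball_add hx (z := x' - x) (s := ε) (by
        rw [mem_ball_iff_norm] at hx' ⊢; simpa using hx')
      simpa using this
    rw [← measure_inter_congr_of_ae_restrict measurableSet_ball
      (ae_restrict_of_ae_restrict_of_subset hb ht) (κ₂ ≤ ·)]
    exact hs t htI x hx
  rw [ae_restrict_iff' hP]
  filter_upwards [ae_prod_of_ae_fst (d := d) ((ae_restrict_iff' hI).1 h1)] with X hX hXm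
  refine measure_le_two_mul_of_compl measure_ball_lt_top.ne
    (N := {z | X.2 + z ∈ {x | κ₂ ≤ w (X.1, x)}}) ?_ fun z hz hzN => ?_
  · rw [volume_ball_inter_translate]
    exact hX hXm.1.1 X.2 hXm.1.2
  -- The function `(κ₁ - w)₊` vanishes at `X` and exceeds `κ₁ - κ₂` at the displaced point.
  · have h2 : w (X.1, X.2 + z) < κ₂ := not_le.1 hzN
    have h3 : κ₁ ≤ w X := hXm.2
    show ENNReal.ofReal ((κ₁ - κ₂) ^ 2)
      ≤ ENNReal.ofReal ((max (κ₁ - w (X.1, X.2 + z)) 0 - max (κ₁ - w X) 0) ^ 2)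
    rw [max_eq_right (by linarith : κ₁ - w X ≤ 0), sub_zero]
    refine ENNReal.ofReal_le_ofReal (pow_le_pow_left₀ (by linarith) ?_ 2)
    exact le_max_of_le_left (by linarith)

/-! ### Localization to small balls, and volumes -/

/-- Averaging over the centre `z` replaces a covering argument: each point of `B_r(y)` lies in
`B_δ(z)` for a set of centres of measure `|B_δ|`, all of them in `B_{r+δ}(y)`. -/
theorem lintegral_ball_le_of_small_balls {I : Set ℝ} (hI : MeasurableSet I) (y : E) {r δ : ℝ}
    {f : ℝ × E → ℝ≥0∞}
    (hf : AEMeasurable f (volume.restrict (I ×ˢ Metric.ball y r))) {M : ℝ≥0∞}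
    (hM : ∀ z ∈ Metric.ball y (r + δ),
      ∫⁻ X in I ×ˢ (Metric.ball y r ∩ Metric.ball z δ), f X ≤ M) :
    volume (Metric.ball (0 : E) δ) * ∫⁻ X in I ×ˢ Metric.ball y r, f X
      ≤ volume (Metric.ball (0 : E) (r + δ)) * M := by
  set K := I ×ˢ Metric.ball y r with hKdef
  have hK : MeasurableSet K := hI.prod measurableSet_ball
  obtain ⟨g, hgm, hfg⟩ : ∃ g, Measurable g ∧ f =ᵐ[volume.restrict K] g :=
    ⟨_, hf.measurable_mk, hf.ae_eq_mk⟩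
  have hM' : ∀ z ∈ Metric.ball y (r + δ),
      ∫⁻ X in I ×ˢ (Metric.ball y r ∩ Metric.ball z δ), g X ≤ M := by
    intro z hz
    refine le_of_eq_of_le (lintegral_congr_ae ?_) (hM z hz)
    exact ae_eq_symm (ae_restrict_of_ae_restrict_of_subset (prod_mono_right inter_subset_left) hfg)
  rw [lintegral_congr_ae hfg]
  let T : Set ((ℝ × E) × E) := {p | dist p.2 p.1.2 < δ}
  have hT : MeasurableSet T := measurableSet_lt (by fun_prop) measurable_const
  let F : (ℝ × E) × E → ℝ≥0∞ := T.indicator fun p => g p.1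
  have hF : Measurable F := (hgm.comp measurable_fst).indicator hT
  calc volume (Metric.ball (0 : E) δ) * ∫⁻ X in K, g X
      = ∫⁻ X in K, volume (Metric.ball (0 : E) δ) * g X := by
        rw [lintegral_const_mul _ hgm]
    _ ≤ ∫⁻ X in K, ∫⁻ z in Metric.ball y (r + δ), F (X, z) := by
        refine setLIntegral_mono' hK fun X hX => ?_
        have hsub : Metric.ball X.2 δ ⊆ Metric.ball y (r + δ) := by
          refine Metric.ball_subset_ball' ?_
          have : dist X.2 y < r := hX.2
          linarith
        calc volume (Metric.ball (0 : E) δ) * g X = ∫⁻ z in Metric.ball X.2 δ, g X := by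
              rw [setLIntegral_const, volume_ball_eq_zero_center X.2, mul_comm]
          _ ≤ ∫⁻ z in Metric.ball X.2 δ, F (X, z) := by
              refine setLIntegral_mono' measurableSet_ball fun z hz => ?_
              have : (X, z) ∈ T := hz
              simp only [F]
              rw [indicator_of_mem this]
          _ ≤ _ := lintegral_mono_set hsub
    _ = ∫⁻ z in Metric.ball y (r + δ), ∫⁻ X in K, F (X, z) :=
        lintegral_lintegral_swap hF.aemeasurable
    _ ≤ ∫⁻ z in Metric.ball y (r + δ), M := by
        refine setLIntegral_mono' measurableSet_ball fun z hz => le_trans ?_ (hM' z hz)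
        have hKz : MeasurableSet (I ×ˢ (Metric.ball y r ∩ Metric.ball z δ)) :=
          hI.prod (measurableSet_ball.inter measurableSet_ball)
        rw [← lintegral_indicator hK, ← lintegral_indicator hKz]
        refine lintegral_mono fun X => ?_
        by_cases hX : X ∈ K
        · rw [indicator_of_mem hX]
          by_cases hXz : (X, z) ∈ T
          · have : X ∈ I ×ˢ (Metric.ball y r ∩ Metric.ball z δ) := by
              refine ⟨hX.1, hX.2, ?_⟩
              rw [Metric.mem_ball']
              exact hXz
            rw [indicator_of_mem this]
            simp only [F]
            rw [indicator_of_mem hXz]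
          · simp [F, hXz]
        · simp [hX]
    _ = _ := by rw [setLIntegral_const, volume_ball_eq_zero_center, mul_comm]

/-- The volume of the unit ball of `ℝ^d`. -/
noncomputable def unitBallVolume (d : ℕ) : ℝ :=
  (volume (Metric.ball (0 : EuclideanSpace ℝ (Fin d)) 1)).toReal

theorem unitBallVolume_pos (d : ℕ) : 0 < unitBallVolume d :=
  ENNReal.toReal_pos (Metric.measure_ball_pos volume 0 one_pos).ne' measure_ball_lt_top.ne

theorem volume_ball_eq_ofReal (x : E) {r : ℝ} (hr : 0 < r) :
    volume (Metric.ball x r) = ENNReal.ofReal (unitBallVolume d * r ^ d) := by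
  rw [Measure.addHaar_ball_of_pos volume x hr, finrank_euclideanSpace_fin, mul_comm,
    ENNReal.ofReal_mul (unitBallVolume_pos d).le, unitBallVolume,
    ENNReal.ofReal_toReal measure_ball_lt_top.ne]

theorem volume_Ioc_prod_ball (s t : ℝ) (x : E) {r : ℝ} (hr : 0 < r) (hst : s ≤ t) :
    volume (Ioc s t ×ˢ Metric.ball x r)
      = ENNReal.ofReal ((t - s) * (unitBallVolume d * r ^ d)) := by
  rw [Measure.volume_eq_prod, Measure.prod_prod, Real.volume_Ioc, volume_ball_eq_ofReal x hr,
    ENNReal.ofReal_mul (sub_nonneg.2 hst)]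

theorem volume_Ioo_prod_ball (s t : ℝ) (x : E) {r : ℝ} (hr : 0 < r) (hst : s ≤ t) :
    volume (Ioo s t ×ˢ Metric.ball x r)
      = ENNReal.ofReal ((t - s) * (unitBallVolume d * r ^ d)) := by
  rw [Measure.volume_eq_prod, Measure.prod_prod, Real.volume_Ioo, volume_ball_eq_ofReal x hr,
    ENNReal.ofReal_mul (sub_nonneg.2 hst)]

/-! ### The working class of non-negative functions -/

/-- The properties of a non-negative function in the class `pDG⁻(Q_1, S)` with `|S| ≤ σ` from which
the weak Harnack inequality is derived. -/
structure NonnegDeGiorgi (C σ : ℝ) (u : ℝ × E → ℝ) : Prop where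
  aemeasurable : AEMeasurable u (volume.restrict (Ioc (-1) 0 ×ˢ Metric.ball 0 1))
  aemeasurable_section : ∀ t ∈ Ioc (-1 : ℝ) 0,
    AEMeasurable (fun x => u (t, x)) (volume.restrict (Metric.ball 0 1))
  nonneg : ∀ t ∈ Ioc (-1 : ℝ) 0, ∀ᵐ x ∂volume.restrict (Metric.ball 0 1), 0 ≤ u (t, x)
  nonneg_ae : ∀ᵐ X ∂volume.restrict (Ioc (-1) 0 ×ˢ Metric.ball 0 1), 0 ≤ u X
  energy : ∀ κ : ℝ, ∃ G : ℝ × E → E,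
    IsWeakSpatialGradient (Ioo (-1) 0 ×ˢ Metric.ball 0 1) (fun X => max (κ - u X) 0) G ∧
    ∀ (t : ℝ) (x : E) (r R : ℝ), t ≤ 0 → 0 < r → r < R → -1 ≤ t - R ^ 2 →
      Metric.ball x R ⊆ Metric.ball 0 1 →
      (∀ s ∈ Ioc (t - r ^ 2) t,
        ∫⁻ x in Metric.ball x r, ENNReal.ofReal (max (κ - u (s, x)) 0 ^ 2)
        ≤ ENNReal.ofReal (C * (1 / (R - r) ^ 2 + 1 / r ^ 2)) *
          (∫⁻ X in Ioc (t - R ^ 2) t ×ˢ Metric.ball x R, ENNReal.ofReal (max (κ - u X) 0 ^ 2))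
          + ENNReal.ofReal (C * σ) *
          (∫⁻ X in Ioc (t - R ^ 2) t ×ˢ Metric.ball x R, ENNReal.ofReal (max (κ - u X) 0))) ∧
      ∫⁻ X in Ioc (t - r ^ 2) t ×ˢ Metric.ball x r, ENNReal.ofReal (‖G X‖ ^ 2)
        ≤ ENNReal.ofReal (C * (1 / (R - r) ^ 2 + 1 / r ^ 2)) *
          (∫⁻ X in Ioc (t - R ^ 2) t ×ˢ Metric.ball x R, ENNReal.ofReal (max (κ - u X) 0 ^ 2))
          + ENNReal.ofReal (C * σ) *
          (∫⁻ X in Ioc (t - R ^ 2) t ×ˢ Metric.ball x R, ENNReal.ofReal (max (κ - u X) 0))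
  propagation : ∀ (y : E) (r R t₁ t₂ κ : ℝ), 0 < r → r < R → Metric.ball y R ⊆ Metric.ball 0 1 →
    R ≤ 1 → -1 < t₁ → t₁ < t₂ → t₂ ≤ 0 → t₂ - t₁ < R ^ 2 →
    ∫⁻ x in Metric.ball y r, ENNReal.ofReal (max (κ - u (t₂, x)) 0 ^ 2)
      ≤ (∫⁻ x in Metric.ball y R, ENNReal.ofReal (max (κ - u (t₁, x)) 0 ^ 2))
        + ENNReal.ofReal (C / (R - r) ^ 2) *
          (∫⁻ X in Ioc t₁ t₂ ×ˢ Metric.ball y R, ENNReal.ofReal (max (κ - u X) 0 ^ 2))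
        + ENNReal.ofReal (C * σ) *
          (∫⁻ X in Ioc t₁ t₂ ×ˢ Metric.ball y R, ENNReal.ofReal (max (κ - u X) 0))

namespace NonnegDeGiorgi

variable {C σ : ℝ} {u : ℝ × EuclideanSpace ℝ (Fin d) → ℝ}

theorem cylinder_subset {t s R : ℝ} {x : E} (ht : t ≤ 0) (hs : -1 ≤ s)
    (hx : Metric.ball x R ⊆ Metric.ball 0 1) :
    Ioc s t ×ˢ Metric.ball x R ⊆ Ioc (-1) 0 ×ˢ Metric.ball (0 : E) 1 :=
  prod_mono (Ioc_subset_Ioc hs ht) hx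

theorem aemeasurable_cylinder (h : NonnegDeGiorgi C σ u) {t s R : ℝ} {x : E} (ht : t ≤ 0)
    (hs : -1 ≤ s) (hx : Metric.ball x R ⊆ Metric.ball 0 1) :
    AEMeasurable u (volume.restrict (Ioc s t ×ˢ Metric.ball x R)) :=
  h.aemeasurable.mono_measure (Measure.restrict_mono (cylinder_subset ht hs hx) le_rfl)

theorem aemeasurable_cylinder_Ioo (h : NonnegDeGiorgi C σ u) {t s R : ℝ} {x : E} (ht : t ≤ 0)
    (hs : -1 ≤ s) (hx : Metric.ball x R ⊆ Metric.ball 0 1) :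
    AEMeasurable u (volume.restrict (Ioo s t ×ˢ Metric.ball x R)) :=
  (h.aemeasurable_cylinder ht hs hx).mono_measure
    (Measure.restrict_mono (prod_mono_left Ioo_subset_Ioc_self) le_rfl)

theorem truncation_le (h : NonnegDeGiorgi C σ u) {κ : ℝ} (hκ : 0 ≤ κ) {s t R : ℝ} {x : E}
    (ht : t ≤ 0) (hs : -1 ≤ s) (hx : Metric.ball x R ⊆ Metric.ball 0 1) :
    ∀ᵐ X ∂volume.restrict (Ioc s t ×ˢ Metric.ball x R), max (κ - u X) 0 ≤ κ := by
  filter_upwards [ae_restrict_of_ae_restrict_of_subset (cylinder_subset ht hs hx) h.nonneg_ae]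
    with X hX
  exact max_le (by linarith) hκ

theorem lintegral_truncation_le (h : NonnegDeGiorgi C σ u) {κ : ℝ} (hκ : 0 ≤ κ) {s t R : ℝ} {x : E}
    (ht : t ≤ 0) (hs : -1 ≤ s) (hst : s ≤ t) (hR : 0 < R)
    (hx : Metric.ball x R ⊆ Metric.ball 0 1) :
    ∫⁻ X in Ioc s t ×ˢ Metric.ball x R, ENNReal.ofReal (max (κ - u X) 0)
      ≤ ENNReal.ofReal (κ * ((t - s) * (unitBallVolume d * R ^ d))) := by
  calc _ ≤ ∫⁻ X in Ioc s t ×ˢ Metric.ball x R, ENNReal.ofReal κ := by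
        refine lintegral_mono_ae ?_
        filter_upwards [h.truncation_le hκ ht hs hx] with X hX
        exact ENNReal.ofReal_le_ofReal hX
    _ = _ := by
        rw [setLIntegral_const, volume_Ioc_prod_ball s t x hR hst, ← ENNReal.ofReal_mul hκ]

theorem lintegral_truncation_sq_le (h : NonnegDeGiorgi C σ u) {κ : ℝ} (hκ : 0 ≤ κ) {s t R : ℝ}
    {x : E} (ht : t ≤ 0) (hs : -1 ≤ s) (hst : s ≤ t) (hR : 0 < R)
    (hx : Metric.ball x R ⊆ Metric.ball 0 1) :
    ∫⁻ X in Ioc s t ×ˢ Metric.ball x R, ENNReal.ofReal (max (κ - u X) 0 ^ 2)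
      ≤ ENNReal.ofReal (κ ^ 2 * ((t - s) * (unitBallVolume d * R ^ d))) := by
  calc _ ≤ ∫⁻ X in Ioc s t ×ˢ Metric.ball x R, ENNReal.ofReal (κ ^ 2) := by
        refine lintegral_mono_ae ?_
        filter_upwards [h.truncation_le hκ ht hs hx] with X hX
        exact ENNReal.ofReal_le_ofReal (pow_le_pow_left₀ (le_max_right _ _) hX 2)
    _ = _ := by
        rw [setLIntegral_const, volume_Ioc_prod_ball s t x hR hst,
          ← ENNReal.ofReal_mul (sq_nonneg κ)]

theorem diffQuotientBound (h : NonnegDeGiorgi C σ u) {κ : ℝ} (hκ : 0 ≤ κ) {G : ℝ × E → E}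
    (hG : IsWeakSpatialGradient (Ioo (-1) 0 ×ˢ Metric.ball 0 1) (fun X => max (κ - u X) 0) G)
    {s t R : ℝ} {x : E} (ht : t ≤ 0) (hs : -1 ≤ s)
    (hx : Metric.ball x R ⊆ Metric.ball 0 1) :
    DiffQuotientBound (Ioo s t) (Metric.ball x R) (fun X => max (κ - u X) 0)
      (∫⁻ X in Ioo s t ×ˢ Metric.ball x R, ENNReal.ofReal (‖G X‖ ^ 2)) := by
  have hfin : volume (Ioo s t ×ˢ Metric.ball x R) ≠ ∞ := by
    rw [Measure.volume_eq_prod, Measure.prod_prod]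
    exact ENNReal.mul_ne_top (by simp) measure_ball_lt_top.ne
  refine hG.diffQuotientBound Metric.isOpen_ball (convex_ball x R)
    (prod_mono (Ioo_subset_Ioo hs ht) hx) ?_ hfin
  have hum := h.aemeasurable_cylinder_Ioo ht hs hx
  have hfm : IsFiniteMeasure (volume.restrict (Ioo s t ×ˢ Metric.ball x R)) :=
    ⟨by simpa using hfin.lt_top⟩
  refine Integrable.of_bound (C := κ)
    ((hum.const_sub κ).max aemeasurable_const).aestronglyMeasurable ?_
  filter_upwards [ae_restrict_of_ae_restrict_of_subset
    (prod_mono_left Ioo_subset_Ioc_self) (h.truncation_le hκ ht hs hx)] with X hX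
  rw [Real.norm_eq_abs, abs_of_nonneg (le_max_right _ _)]
  exact hX

/-! ### De Giorgi's first lemma -/

/-- One step of the De Giorgi iteration. -/
theorem iteration_step (h : NonnegDeGiorgi C σ u) (hC : 0 ≤ C) (hσ : 0 ≤ σ)
    {t l l' g ρ r' A y : ℝ} {x : E} (hl' : 0 ≤ l') (hl : l' < l)
    (hg : 0 < g) (hρ : 0 < ρ) (hρg : ρ ≤ g) (hr' : 0 < r') (ht : t ≤ 0)
    (hcyl : -1 ≤ t - (r' + 2 * g) ^ 2)
    (hball : Metric.ball x (r' + 2 * g) ⊆ Metric.ball 0 1)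
    (hA : C * (1 / g ^ 2 + 1 / (r' + g) ^ 2) + C * σ / ((l - l') / 2) ≤ A)
    (hY : ∫⁻ X in Ioc (t - (r' + 2 * g) ^ 2) t ×ˢ Metric.ball x (r' + 2 * g),
      ENNReal.ofReal (max (l - u X) 0 ^ 2) ≤ ENNReal.ofReal y) :
    (∀ s ∈ Ioc (t - (r' + g) ^ 2) t,
      ∫⁻ x in Metric.ball x (r' + g), ENNReal.ofReal (max (l' - u (s, x)) 0 ^ 2)
        ≤ ENNReal.ofReal (A * y)) ∧
    (2 * (A * y) ≤ ((l - l') / 2) ^ 2 * (unitBallVolume d * ρ ^ d) →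
      ∫⁻ X in Ioc (t - r' ^ 2) t ×ˢ Metric.ball x r', ENNReal.ofReal (max (l' - u X) 0 ^ 2)
        ≤ ENNReal.ofReal (2 * ρ ^ 2 * (A * y))) := by
  set l'' := (l + l') / 2 with hl''
  set Q := Ioc (t - (r' + 2 * g) ^ 2) t ×ˢ Metric.ball x (r' + 2 * g) with hQ
  have hδ : 0 < (l - l') / 2 := by linarith
  have hA1 : 0 ≤ C * (1 / g ^ 2 + 1 / (r' + g) ^ 2) := by positivity
  have hA2 : 0 ≤ C * σ / ((l - l') / 2) := by positivity
  have hA0 : 0 ≤ A := le_trans (add_nonneg hA1 hA2) hA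
  -- the right-hand side of the energy estimate, for levels up to `l''`
  have hE : ∀ k ≤ l'', ENNReal.ofReal
      (C * (1 / (r' + 2 * g - (r' + g)) ^ 2 + 1 / (r' + g) ^ 2)) *
        (∫⁻ X in Q, ENNReal.ofReal (max (k - u X) 0 ^ 2)) + ENNReal.ofReal (C * σ) *
        (∫⁻ X in Q, ENNReal.ofReal (max (k - u X) 0)) ≤ ENNReal.ofReal (A * y) := by
    intro k hk
    have h1 : ∫⁻ X in Q, ENNReal.ofReal (max (k - u X) 0 ^ 2)
        ≤ ∫⁻ X in Q, ENNReal.ofReal (max (l - u X) 0 ^ 2) := by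
      refine lintegral_mono fun X => ENNReal.ofReal_le_ofReal ?_
      refine pow_le_pow_left₀ (le_max_right _ _) (max_le_max_right _ ?_) 2
      linarith
    -- Where `u < k ≤ l''` one has `l - u ≥ (l - l') / 2`, so the linear source term is dominated by
    -- the quadratic one at the higher level `l`.
    have h2 : ∫⁻ X in Q, ENNReal.ofReal (max (k - u X) 0)
        ≤ ENNReal.ofReal (1 / ((l - l') / 2)) *
          ∫⁻ X in Q, ENNReal.ofReal (max (l - u X) 0 ^ 2) := by
      rw [← lintegral_const_mul' _ _ ENNReal.ofReal_ne_top]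
      refine lintegral_mono fun X => ?_
      rw [← ENNReal.ofReal_mul (by positivity)]
      refine ENNReal.ofReal_le_ofReal ?_
      rw [one_div_mul_eq_div, le_div_iff₀ hδ]
      rcases le_total (k - u X) 0 with h3 | h3
      · rw [max_eq_right h3]; simp only [zero_mul]; positivity
      · have h4 : (l - l') / 2 ≤ l - u X := by linarith
        rw [max_eq_left h3, max_eq_left (by linarith), sq]
        exact mul_le_mul (by linarith) h4 hδ.le (by linarith)
    have e : r' + 2 * g - (r' + g) = g := by ring
    rw [e]
    calc _ ≤ ENNReal.ofReal (C * (1 / g ^ 2 + 1 / (r' + g) ^ 2)) * ENNReal.ofReal y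
          + ENNReal.ofReal (C * σ) * (ENNReal.ofReal (1 / ((l - l') / 2)) * ENNReal.ofReal y) := by
          refine add_le_add (mul_le_mul_right (h1.trans hY) _) (mul_le_mul_right (h2.trans ?_) _)
          exact mul_le_mul_right hY _
      _ = ENNReal.ofReal (C * (1 / g ^ 2 + 1 / (r' + g) ^ 2) + C * σ / ((l - l') / 2))
          * ENNReal.ofReal y := by
          rw [ENNReal.ofReal_add hA1 hA2, add_mul, ← mul_assoc,
            ← ENNReal.ofReal_mul (by positivity : 0 ≤ C * σ), mul_one_div]
      _ ≤ ENNReal.ofReal A * ENNReal.ofReal y := by gcongr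
      _ = _ := by rw [ENNReal.ofReal_mul hA0]
  obtain ⟨G, hG, hGe⟩ := h.energy l'
  obtain ⟨G', hG', hGe'⟩ := h.energy l''
  have hrg : 0 < r' + g := by linarith
  have hb1 := hGe t x (r' + g) (r' + 2 * g) ht hrg (by linarith) hcyl hball
  have hb2 := hGe' t x (r' + g) (r' + 2 * g) ht hrg (by linarith) hcyl hball
  refine ⟨fun s hs => (hb1.1 s hs).trans (hE l' (by linarith)), fun hsmall => ?_⟩
  have hsubB : Metric.ball x (r' + ρ) ⊆ Metric.ball x (r' + g) :=
    Metric.ball_subset_ball (by linarith)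
  have hsubB1 : Metric.ball x (r' + g) ⊆ Metric.ball 0 1 :=
    (Metric.ball_subset_ball (by linarith)).trans hball
  have htg : -1 ≤ t - (r' + g) ^ 2 := by nlinarith
  -- the support of `(l' - u)₊` is small at all times
  have hsup : ∀ s ∈ Ioo (t - (r' + g) ^ 2) t, 2 * volume (Metric.ball x (r' + ρ) ∩
      {x | max (l' - u (s, x)) 0 ≠ 0}) ≤ volume (Metric.ball (0 : E) ρ) := by
    intro s hs
    have hs1 : s ∈ Ioc (-1 : ℝ) 0 := ⟨by linarith [hs.1], by linarith [hs.2]⟩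
    have hm : AEMeasurable (fun x => ENNReal.ofReal (max (l'' - u (s, x)) 0 ^ 2))
        (volume.restrict (Metric.ball x (r' + g))) := by
      have := (h.aemeasurable_section s hs1).mono_measure
        (Measure.restrict_mono hsubB1 le_rfl)
      exact (((this.const_sub l'').max aemeasurable_const).pow_const 2).ennreal_ofReal
    -- Chebyshev at the intermediate level: where `u < l'`, the truncation at `l''` exceeds `l'' -
    -- l' = (l - l') / 2`.
    have h1 := mul_meas_ge_le_lintegral₀ hm (ENNReal.ofReal (((l - l') / 2) ^ 2))
    have h2 := h1.trans ((hb2.1 s (Ioo_subset_Ioc_self hs)).trans (hE l'' le_rfl))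
    have h3 : volume (Metric.ball x (r' + ρ) ∩ {x | max (l' - u (s, x)) 0 ≠ 0})
        ≤ (volume.restrict (Metric.ball x (r' + g))) {x | ENNReal.ofReal (((l - l') / 2) ^ 2)
          ≤ ENNReal.ofReal (max (l'' - u (s, x)) 0 ^ 2)} := by
      rw [Measure.restrict_apply' measurableSet_ball, inter_comm]
      refine measure_mono (inter_subset_inter (fun z hz => ?_) hsubB)
      have h4 : 0 < l' - u (s, z) := by
        by_contra h5
        exact hz (max_eq_right (not_lt.1 h5))
      refine ENNReal.ofReal_le_ofReal (pow_le_pow_left₀ hδ.le (le_max_of_le_left ?_) 2)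
      linarith
    rw [volume_ball_eq_ofReal _ hρ]
    have hδ2 : 0 < ((l - l') / 2) ^ 2 := by positivity
    refine (ENNReal.mul_le_mul_iff_right (a := ENNReal.ofReal (((l - l') / 2) ^ 2))
      (ENNReal.ofReal_pos.2 hδ2).ne' ENNReal.ofReal_ne_top).1 ?_
    calc _ = 2 * (ENNReal.ofReal (((l - l') / 2) ^ 2) *
          volume (Metric.ball x (r' + ρ) ∩ {x | max (l' - u (s, x)) 0 ≠ 0})) := by ring
      _ ≤ 2 * ENNReal.ofReal (A * y) := by
          gcongr 2 * ?_
          exact le_trans (by gcongr) h2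
      _ = ENNReal.ofReal (2 * (A * y)) := by
          rw [ENNReal.ofReal_mul (by norm_num : (0 : ℝ) ≤ 2), ENNReal.ofReal_ofNat]
      _ ≤ ENNReal.ofReal (((l - l') / 2) ^ 2 * (unitBallVolume d * ρ ^ d)) :=
          ENNReal.ofReal_le_ofReal hsmall
      _ = _ := by rw [ENNReal.ofReal_mul hδ2.le]
  have hDQ := (h.diffQuotientBound hl' hG (R := r' + ρ) ht htg
    (hsubB.trans hsubB1)).mono_energy (Γ' := ENNReal.ofReal (A * y)) (by
      refine le_trans (lintegral_mono_set (prod_mono Ioo_subset_Ioc_self hsubB)) (hb1.2.trans ?_)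
      exact hE l' (by linarith))
  have hum : AEMeasurable (fun X => max (l' - u X) 0)
      (volume.restrict (Ioo (t - (r' + g) ^ 2) t ×ˢ Metric.ball x (r' + ρ))) := by
    exact ((h.aemeasurable_cylinder_Ioo ht htg (hsubB.trans hsubB1)).const_sub l').max
      aemeasurable_const
  -- The factor `ρ²` that makes the iteration contract enters here.
  have hFK := lintegral_sq_le_of_small_support measurableSet_Ioo x hρ hum hDQ hsup
  have hae : (Ioc (t - r' ^ 2) t ×ˢ Metric.ball x r' : Set (ℝ × E))
      =ᵐ[volume] (Ioo (t - r' ^ 2) t ×ˢ Metric.ball x r' : Set (ℝ × E)) := by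
    rw [Measure.volume_eq_prod]
    exact Measure.set_prod_ae_eq Ioo_ae_eq_Ioc.symm (ae_eq_refl _)
  rw [setLIntegral_congr hae]
  refine (lintegral_mono_set (prod_mono_left (Ioo_subset_Ioo_left ?_))).trans (hFK.trans ?_)
  · nlinarith
  · rw [← ENNReal.ofReal_mul (sq_nonneg ρ), ← ENNReal.ofReal_ofNat,
      ← ENNReal.ofReal_mul (by norm_num), mul_assoc]

end NonnegDeGiorgi

namespace NonnegDeGiorgi

/-- De Giorgi's first lemma: if `(κ - u)₊` is small in mean in a cylinder, then `u ≥ κ / 2` in a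
smaller one. -/
theorem exists_pointwise_bound_constant (d : ℕ) {C : ℝ} (hC : 1 ≤ C) :
    ∃ ν : ℝ, 0 < ν ∧ ∀ (σ : ℝ) (u : ℝ × EuclideanSpace ℝ (Fin d) → ℝ), NonnegDeGiorgi C σ u →
      0 ≤ σ → ∀ (κ r t : ℝ) (x : EuclideanSpace ℝ (Fin d)), 0 < κ → σ ≤ κ → 0 < r → t ≤ 0 →
      -1 ≤ t - r ^ 2 → Metric.ball x r ⊆ Metric.ball 0 1 →
      ∫⁻ X in Ioc (t - r ^ 2) t ×ˢ Metric.ball x r, ENNReal.ofReal (max (κ - u X) 0 ^ 2)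
        ≤ ENNReal.ofReal (ν * κ ^ 2 * r ^ (d + 2)) →
      ∀ s ∈ Ioc (t - (r / 2) ^ 2) t,
        ∀ᵐ y ∂volume.restrict (Metric.ball x (r / 2)), κ / 2 ≤ u (s, y) := by
  set β := unitBallVolume d with hβdef
  have hβ : 0 < β := unitBallVolume_pos d
  have hC0 : 0 < C := by linarith
  -- The ratio `2 ^ (d + 4)` of consecutive terms of the sequence `y` below.
  set b : ℝ := 16 * 2 ^ d with hb
  have hb1 : 16 ≤ b := by
    have : (1 : ℝ) ≤ 2 ^ d := one_le_pow₀ (by norm_num)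
    rw [hb]; linarith
  -- The ratio of the Faber–Krahn radius to `r p k`. A step multiplies the bound by `152 C c² = c /
  -- b`, which is below the required `1 / b`.
  set c : ℝ := 1 / (152 * C * b) with hc
  have hc0 : 0 < c := by positivity
  have hc8 : c ≤ 1 / 8 := by
    rw [hc]
    apply one_div_le_one_div_of_le (by norm_num)
    nlinarith
  have hcc : 152 * C * c ^ 2 * b = c := by
    rw [hc]; field_simp
  -- With this value the support condition of `iteration_step` is an equality at every `k`.
  set ν : ℝ := β * c ^ d / (64 * 152 * C) with hν
  have hν0 : 0 < ν := by positivity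
  refine ⟨ν, hν0, fun σ u h hσ κ r t x hκ hσκ hr ht hcyl hball hY s hs => ?_⟩
  have hr1 : r ^ 2 ≤ 1 := by linarith
  set p : ℕ → ℝ := fun k => (1 / 2) ^ k with hp
  have hp0 : ∀ k, 0 < p k := fun k => by positivity
  have hp1 : ∀ k, p k ≤ 1 := fun k => pow_le_one₀ (by norm_num) (by norm_num)
  have hps : ∀ k, p (k + 1) = p k / 2 := fun k => by simp only [hp, pow_succ]; ring
  set R : ℕ → ℝ := fun k => r / 2 + r / 2 * p k with hR
  set l : ℕ → ℝ := fun k => κ / 2 + κ / 2 * p k with hl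
  -- The support condition dictates the exponent `d + 4`: `A y k`, with `A` of order `(p k)⁻²`, has
  -- to match the squared level gap, of order `(p k)²`, times `(p k) ^ d`.
  set y : ℕ → ℝ := fun k => ν * κ ^ 2 * r ^ (d + 2) * (p k ^ 4 * p k ^ d) with hy
  have hRg : ∀ k, R (k + 1) + 2 * (r / 8 * p k) = R k := fun k => by
    simp only [hR, hps]; ring
  have hRle : ∀ k, R k ≤ r := fun k => by
    have := hp1 k
    simp only [hR]; nlinarith
  have hRge : ∀ k, r / 2 ≤ R k := fun k => by
    have := hp0 k
    simp only [hR]; nlinarith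
  have hRcyl : ∀ k, -1 ≤ t - R k ^ 2 := fun k => by
    have : R k ^ 2 ≤ r ^ 2 := pow_le_pow_left₀ (by linarith [hRge k]) (hRle k) 2
    linarith
  -- Here `76 = 64 + 4 + 8`, from the gap of the radii, the inner radius and the source; the last
  -- uses `σ ≤ κ` and `r ≤ 1`.
  have hA : ∀ k, C * (1 / (r / 8 * p k) ^ 2 + 1 / (R (k + 1) + r / 8 * p k) ^ 2)
      + C * σ / ((l k - l (k + 1)) / 2) ≤ 76 * C / (r ^ 2 * p k ^ 2) := by
    intro k
    have hk := hp0 k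
    have hP : 0 < r ^ 2 * p k ^ 2 := by positivity
    have e1 : 1 / (r / 8 * p k) ^ 2 = 64 / (r ^ 2 * p k ^ 2) := by
      field_simp; norm_num
    have e2 : 1 / (R (k + 1) + r / 8 * p k) ^ 2 ≤ 4 / (r ^ 2 * p k ^ 2) := by
      rw [div_le_div_iff₀ (by have := hRge (k + 1); positivity) hP]
      have h1 : r / 2 ≤ R (k + 1) + r / 8 * p k := by
        have := hRge (k + 1)
        have : 0 < r / 8 * p k := by positivity
        linarith
      have h2 : (r / 2) ^ 2 ≤ (R (k + 1) + r / 8 * p k) ^ 2 :=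
        pow_le_pow_left₀ (by positivity) h1 2
      have h3 : p k ^ 2 ≤ 1 := pow_le_one₀ hk.le (hp1 k)
      have h4 : r ^ 2 * p k ^ 2 ≤ r ^ 2 * 1 := by gcongr
      linarith
    have e3 : C * σ / ((l k - l (k + 1)) / 2) ≤ C * (8 / (r ^ 2 * p k ^ 2)) := by
      have : (l k - l (k + 1)) / 2 = κ / 8 * p k := by simp only [hl, hps]; ring
      rw [this, mul_div_assoc]
      refine mul_le_mul_of_nonneg_left ?_ hC0.le
      rw [div_le_div_iff₀ (by positivity) hP]
      have h4 : r ^ 2 * p k ^ 2 ≤ p k := by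
        calc r ^ 2 * p k ^ 2 ≤ 1 * (p k * 1) := by
              rw [sq (p k)]
              have := hp1 k
              gcongr
          _ = p k := by ring
      calc σ * (r ^ 2 * p k ^ 2) ≤ κ * p k := by gcongr
        _ = _ := by ring
    calc _ ≤ C * (64 / (r ^ 2 * p k ^ 2) + 4 / (r ^ 2 * p k ^ 2))
          + C * (8 / (r ^ 2 * p k ^ 2)) := by
          rw [e1]; gcongr
      _ = _ := by ring
  have hl0 : ∀ k, 0 ≤ l k := fun k => by have := hp0 k; simp only [hl]; positivity
  have hll : ∀ k, l (k + 1) < l k := fun k => by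
    have : 0 < κ / 2 * p k := by have := hp0 k; positivity
    simp only [hl, hps]; linarith
  have step : ∀ k, _ := fun k => h.iteration_step (t := t) (x := x) (l := l k) (l' := l (k + 1))
    (g := r / 8 * p k) (ρ := c * r * p k) (r' := R (k + 1)) (y := y k) hC0.le hσ (hl0 _) (hll k)
    (by have := hp0 k; positivity) (by have := hp0 k; positivity)
    (by have := hp0 k; calc c * r * p k ≤ 1 / 8 * r * p k := by gcongr
          _ = _ := by ring)
    (by have := hRge (k + 1); linarith) ht (by rw [hRg]; exact hRcyl k)
    (by rw [hRg]; exact (Metric.ball_subset_ball (hRle k)).trans hball) (hA k)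
  simp only [hRg] at step
  have hYk : ∀ k, ∫⁻ X in Ioc (t - R k ^ 2) t ×ˢ Metric.ball x (R k),
      ENNReal.ofReal (max (l k - u X) 0 ^ 2) ≤ ENNReal.ofReal (y k) := by
    intro k
    induction k with
    | zero =>
      have e1 : R 0 = r := by simp only [hR, hp]; ring
      have e2 : l 0 = κ := by simp only [hl, hp]; ring
      have e3 : y 0 = ν * κ ^ 2 * r ^ (d + 2) := by simp [hy, hp]
      rw [e1, e2, e3]
      exact hY
    | succ k ih =>
      refine ((step k ih).2 ?_).trans (ENNReal.ofReal_le_ofReal ?_)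
      · refine le_of_eq ?_
        have : (l k - l (k + 1)) / 2 = κ / 8 * p k := by simp only [hl, hps]; ring
        rw [this]
        have := hp0 k
        simp only [hy, hν, pow_add, mul_pow]
        field_simp
        norm_num
        linarith
      · have := hp0 k
        have e1 : 2 * (c * r * p k) ^ 2 * (76 * C / (r ^ 2 * p k ^ 2) * y k)
            = 152 * C * c ^ 2 * y k := by
          field_simp; ring
        have e2 : y (k + 1) = y k / b := by
          simp only [hy, hps, hb, div_pow]
          field_simp
          norm_num
        have e3 : 152 * C * c ^ 2 = c / b := by
          rw [eq_div_iff (by positivity)]; exact hcc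
        have hyk : 0 ≤ y k := by simp only [hy]; positivity
        rw [e1, e2, e3, div_mul_eq_mul_div]
        gcongr
        nlinarith
  -- The slice estimate of each step holds at every time, so the limit in `k` gives the bound for
  -- the given `s`, not merely for almost every one.
  have hbound : ∀ k, ∫⁻ z in Metric.ball x (r / 2), ENNReal.ofReal (max (κ / 2 - u (s, z)) 0 ^ 2)
      ≤ ENNReal.ofReal (76 * C * ν * κ ^ 2 * r ^ d * (1 / 2) ^ k) := by
    intro k
    have hk := hp0 k
    have hg : 0 < r / 8 * p k := by positivity
    have h1 : r / 2 ≤ R (k + 1) + r / 8 * p k := by linarith [hRge (k + 1)]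
    have hs' : s ∈ Ioc (t - (R (k + 1) + r / 8 * p k) ^ 2) t := by
      refine ⟨lt_of_le_of_lt ?_ hs.1, hs.2⟩
      have : (r / 2) ^ 2 ≤ (R (k + 1) + r / 8 * p k) ^ 2 :=
        pow_le_pow_left₀ (by positivity) h1 2
      linarith
    calc _ ≤ ∫⁻ z in Metric.ball x (R (k + 1) + r / 8 * p k),
          ENNReal.ofReal (max (κ / 2 - u (s, z)) 0 ^ 2) :=
          lintegral_mono_set (Metric.ball_subset_ball h1)
      _ ≤ ∫⁻ z in Metric.ball x (R (k + 1) + r / 8 * p k),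
          ENNReal.ofReal (max (l (k + 1) - u (s, z)) 0 ^ 2) := by
          refine lintegral_mono fun z => ENNReal.ofReal_le_ofReal ?_
          refine pow_le_pow_left₀ (le_max_right _ _) (max_le_max_right _ ?_) 2
          have : 0 < κ / 2 * p (k + 1) := by have := hp0 (k + 1); positivity
          simp only [hl]; linarith
      _ ≤ ENNReal.ofReal (76 * C / (r ^ 2 * p k ^ 2) * y k) := (step k (hYk k)).1 s hs'
      _ ≤ _ := by
          refine ENNReal.ofReal_le_ofReal ?_
          have e : 76 * C / (r ^ 2 * p k ^ 2) * y k
              = 76 * C * ν * κ ^ 2 * r ^ d * (p k * (p k * p k ^ d)) := by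
            simp only [hy, pow_add]
            field_simp
          have e2 : p k * (p k * p k ^ d) ≤ p k * 1 := by
            gcongr
            rw [← pow_succ']
            exact pow_le_one₀ hk.le (hp1 k)
          rw [e]
          calc _ ≤ 76 * C * ν * κ ^ 2 * r ^ d * (p k * 1) := by gcongr
            _ = _ := by simp [hp]
  have hzero : ∫⁻ z in Metric.ball x (r / 2), ENNReal.ofReal (max (κ / 2 - u (s, z)) 0 ^ 2) = 0 := by
    have hlim : Filter.Tendsto
        (fun k : ℕ => ENNReal.ofReal (76 * C * ν * κ ^ 2 * r ^ d * (1 / 2) ^ k))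
        Filter.atTop (nhds 0) := by
      rw [← ENNReal.ofReal_zero]
      refine ENNReal.tendsto_ofReal ?_
      have := (tendsto_pow_atTop_nhds_zero_of_lt_one (by norm_num : (0 : ℝ) ≤ 1 / 2)
        (by norm_num)).const_mul (76 * C * ν * κ ^ 2 * r ^ d)
      simpa using this
    exact le_antisymm (ge_of_tendsto' hlim hbound) (zero_le)
  have hs1 : s ∈ Ioc (-1 : ℝ) 0 := by
    refine ⟨?_, hs.2.trans ht⟩
    have := hs.1
    nlinarith
  have hsub : Metric.ball x (r / 2) ⊆ Metric.ball 0 1 :=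
    (Metric.ball_subset_ball (by linarith)).trans hball
  have hm : AEMeasurable (fun z => ENNReal.ofReal (max (κ / 2 - u (s, z)) 0 ^ 2))
      (volume.restrict (Metric.ball x (r / 2))) :=
    (((((h.aemeasurable_section s hs1).mono_measure
      (Measure.restrict_mono hsub le_rfl)).const_sub (κ / 2)).max
        aemeasurable_const).pow_const 2).ennreal_ofReal
  rw [lintegral_eq_zero_iff' hm] at hzero
  filter_upwards [hzero] with z hz
  have h1 : max (κ / 2 - u (s, z)) 0 ^ 2 ≤ 0 := by simpa using hz
  have h2 : max (κ / 2 - u (s, z)) 0 = 0 := by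
    have := sq_nonneg (max (κ / 2 - u (s, z)) 0)
    exact pow_eq_zero_iff (two_ne_zero) |>.1 (le_antisymm h1 this)
  have := le_max_left (κ / 2 - u (s, z)) 0
  linarith

end NonnegDeGiorgi

/-! ### Propagation in time and shrinking of sublevel sets -/

theorem one_add_pow_le_of_le_one (d : ℕ) {η : ℝ} (h0 : 0 ≤ η) (h1 : η ≤ 1) :
    (1 + η) ^ d ≤ 1 + 2 ^ d * η := by
  have key : ∀ d : ℕ, (1 + η) ^ d ≤ 1 + (2 ^ d - 1) * η := by
    intro d
    induction d with
    | zero => simp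
    | succ n ih =>
      have h2 : (1 : ℝ) ≤ 2 ^ n := one_le_pow₀ (by norm_num)
      calc (1 + η) ^ (n + 1) = (1 + η) ^ n * (1 + η) := pow_succ _ _
        _ ≤ (1 + (2 ^ n - 1) * η) * (1 + η) := by gcongr
        _ ≤ 1 + (2 ^ (n + 1) - 1) * η := by
          rw [pow_succ]
          nlinarith [mul_nonneg (sub_nonneg.2 h2) (mul_nonneg h0 (sub_nonneg.2 h1))]
  refine (key d).trans ?_
  nlinarith

namespace NonnegDeGiorgi

/-- Propagation in time of a lower bound on the measure of a superlevel set. -/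
theorem exists_propagation_constant (d : ℕ) {C : ℝ} (hC : 1 ≤ C) :
    ∃ c : ℝ, 0 < c ∧ c ≤ 1 ∧ ∀ (σ : ℝ) (u : ℝ × EuclideanSpace ℝ (Fin d) → ℝ),
      NonnegDeGiorgi C σ u → 0 ≤ σ →
      ∀ (κ α r t₁ t₂ : ℝ) (y : EuclideanSpace ℝ (Fin d)), 0 < κ → σ ≤ κ → 0 < α → α ≤ 1 →
      0 < r → 2 * r ≤ 1 → Metric.ball y (2 * r) ⊆ Metric.ball 0 1 → -1 < t₁ → t₁ < t₂ → t₂ ≤ 0 →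
      t₂ - t₁ ≤ c * α ^ 3 * r ^ 2 →
      ENNReal.ofReal (α * (unitBallVolume d * r ^ d))
        ≤ volume (Metric.ball y r ∩ {x | κ ≤ u (t₁, x)}) →
      ENNReal.ofReal (α / 2 * (unitBallVolume d * r ^ d))
        ≤ volume (Metric.ball y r ∩ {x | α * κ / 8 ≤ u (t₂, x)}) := by
  set β := unitBallVolume d with hβdef
  have hβ : 0 < β := unitBallVolume_pos d
  have hC0 : 0 < C := by linarith
  have h8d : (1 : ℝ) ≤ 8 ^ d := one_le_pow₀ (by norm_num)
  have h2d : (1 : ℝ) ≤ 2 ^ d := one_le_pow₀ (by norm_num)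
  -- The cut-off costs `(R - r)⁻²`, of order `α⁻² r⁻²`; over a time `c α³ r²` the evolution terms
  -- then stay below `α / 8` of `κ² |B_r|`.
  set c : ℝ := 1 / (1024 * C * 8 ^ d) with hc
  have hc0 : 0 < c := by positivity
  have hc1 : c ≤ 1 := by
    rw [hc, div_le_one (by positivity)]
    nlinarith
  refine ⟨c, hc0, hc1, fun σ u h hσ κ α r t₁ t₂ y hκ hσκ hα hα1 hr hr1 hball ht₁ ht ht₂ htc hm => ?_⟩
  -- The enlargement of the ball adds at most `α / 8` of its volume.
  set η : ℝ := α / (8 * 2 ^ d) with hη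
  have hη0 : 0 < η := by positivity
  have hη1 : η ≤ 1 := by
    rw [hη, div_le_one (by positivity)]; nlinarith
  set R : ℝ := (1 + η) * r with hR
  have hrR : r < R := by rw [hR]; nlinarith
  have hR2 : R ≤ 2 * r := by rw [hR]; nlinarith
  have hR0 : 0 < R := hr.trans hrR
  have hballR : Metric.ball y R ⊆ Metric.ball 0 1 := (Metric.ball_subset_ball hR2).trans hball
  have hballr : Metric.ball y r ⊆ Metric.ball 0 1 := (Metric.ball_subset_ball hrR.le).trans hballR
  have hr2 : 0 < r ^ 2 := by positivity
  have hα3 : α ^ 3 ≤ 1 := pow_le_one₀ hα.le hα1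
  have htR : t₂ - t₁ < R ^ 2 := by
    have h1 : c * α ^ 3 * r ^ 2 ≤ 1 * 1 * r ^ 2 := by gcongr
    have h2 : r ^ 2 < R ^ 2 := pow_lt_pow_left₀ hrR hr.le two_ne_zero
    linarith
  have hprop := h.propagation y r R t₁ t₂ κ hr hrR hballR (by linarith) ht₁ ht ht₂ htR
  set B : ℝ := β * r ^ d with hB
  have hB0 : 0 < B := by positivity
  have hRd : β * R ^ d ≤ (1 + α / 8) * B := by
    rw [hR, mul_pow]
    have h1 := one_add_pow_le_of_le_one d hη0.le hη1
    have h2 : 2 ^ d * η = α / 8 := by rw [hη]; field_simp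
    rw [h2] at h1
    calc β * ((1 + η) ^ d * r ^ d) = (1 + η) ^ d * B := by rw [hB]; ring
      _ ≤ _ := by gcongr
  have hRd2 : β * R ^ d ≤ 2 ^ d * B := by
    calc β * R ^ d ≤ β * (2 * r) ^ d := by gcongr
      _ = _ := by rw [mul_pow, hB]; ring
  have hs1 : t₁ ∈ Ioc (-1 : ℝ) 0 := ⟨ht₁, by linarith⟩
  have hs2 : t₂ ∈ Ioc (-1 : ℝ) 0 := ⟨by linarith, ht₂⟩
  -- the initial time
  have hinit : ∫⁻ x in Metric.ball y R, ENNReal.ofReal (max (κ - u (t₁, x)) 0 ^ 2)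
      ≤ ENNReal.ofReal (κ ^ 2 * ((1 + α / 8 - α) * B)) := by
    have hum : AEMeasurable (fun x => u (t₁, x)) (volume.restrict (Metric.ball y R)) :=
      (h.aemeasurable_section t₁ hs1).mono_measure (Measure.restrict_mono hballR le_rfl)
    set A : Set (EuclideanSpace ℝ (Fin d)) := {x | κ ≤ u (t₁, x)} with hA
    have hAm : NullMeasurableSet A (volume.restrict (Metric.ball y R)) :=
      nullMeasurableSet_le aemeasurable_const hum
    have h1 := measure_add_measure_compl₀ hAm
    rw [Measure.restrict_apply_univ, volume_ball_eq_ofReal y hR0] at h1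
    have h2 : ENNReal.ofReal (α * B) ≤ (volume.restrict (Metric.ball y R)) A := by
      refine hm.trans ?_
      rw [Measure.restrict_apply' measurableSet_ball, inter_comm]
      gcongr
    have h3 : (volume.restrict (Metric.ball y R)) Aᶜ ≤ ENNReal.ofReal ((1 + α / 8 - α) * B) := by
      refine (ENNReal.add_le_add_iff_left (a := ENNReal.ofReal (α * B)) ENNReal.ofReal_ne_top).1 ?_
      have h0 : 0 ≤ (1 + α / 8 - α) * B := mul_nonneg (by linarith) hB0.le
      rw [← ENNReal.ofReal_add (by positivity) h0]
      calc _ ≤ (volume.restrict (Metric.ball y R)) A + (volume.restrict (Metric.ball y R)) Aᶜ := by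
            gcongr
        _ = ENNReal.ofReal (β * R ^ d) := h1
        _ ≤ _ := ENNReal.ofReal_le_ofReal (by linarith)
    calc _ ≤ ∫⁻ x in Metric.ball y R, Aᶜ.indicator (fun _ => ENNReal.ofReal (κ ^ 2)) x := by
          refine lintegral_mono_ae ?_
          filter_upwards [ae_restrict_of_ae_restrict_of_subset hballR (h.nonneg t₁ hs1)] with x hx
          by_cases hxA : x ∈ A
          · have h4 : κ ≤ u (t₁, x) := hxA
            rw [max_eq_right (by linarith)]
            simp
          · rw [indicator_of_mem (by exact hxA)]
            refine ENNReal.ofReal_le_ofReal (pow_le_pow_left₀ (le_max_right _ _) ?_ 2)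
            exact max_le (by linarith) hκ.le
      _ = ENNReal.ofReal (κ ^ 2) * (volume.restrict (Metric.ball y R)) Aᶜ :=
          lintegral_indicator_const₀ hAm.compl _
      _ ≤ ENNReal.ofReal (κ ^ 2) * ENNReal.ofReal ((1 + α / 8 - α) * B) := by gcongr
      _ = _ := by rw [ENNReal.ofReal_mul (sq_nonneg κ)]
  -- the evolution terms
  have hevol : ENNReal.ofReal (C / (R - r) ^ 2) *
        (∫⁻ X in Ioc t₁ t₂ ×ˢ Metric.ball y R, ENNReal.ofReal (max (κ - u X) 0 ^ 2))
      + ENNReal.ofReal (C * σ) *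
        (∫⁻ X in Ioc t₁ t₂ ×ˢ Metric.ball y R, ENNReal.ofReal (max (κ - u X) 0))
      ≤ ENNReal.ofReal (κ ^ 2 * (α / 8 * B)) := by
    have h1 := h.lintegral_truncation_sq_le hκ.le ht₂ ht₁.le ht.le hR0 hballR
    have h2 := h.lintegral_truncation_le hκ.le ht₂ ht₁.le ht.le hR0 hballR
    have htt : 0 < t₂ - t₁ := by linarith
    refine (add_le_add (mul_le_mul_right h1 _) (mul_le_mul_right h2 _)).trans ?_
    rw [← ENNReal.ofReal_mul (by positivity), ← ENNReal.ofReal_mul (by positivity),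
      ← ENNReal.ofReal_add (by positivity) (by positivity)]
    refine ENNReal.ofReal_le_ofReal ?_
    have e1 : R - r = η * r := by rw [hR]; ring
    -- Since `η r ≤ 1` and `σ ≤ κ`, the source term obeys the same bound as the cut-off term.
    have h3 : 1 ≤ 1 / (η * r) ^ 2 := by
      rw [le_div_iff₀ (by positivity), one_mul]
      exact pow_le_one₀ (by positivity) (by nlinarith)
    have h4 : (t₂ - t₁) * (β * R ^ d) ≤ (c * α ^ 3 * r ^ 2) * (2 ^ d * B) := by
      have : 0 ≤ β * R ^ d := by positivity
      gcongr
    calc C / (R - r) ^ 2 * (κ ^ 2 * ((t₂ - t₁) * (β * R ^ d)))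
          + C * σ * (κ * ((t₂ - t₁) * (β * R ^ d)))
        ≤ C / (R - r) ^ 2 * (κ ^ 2 * ((t₂ - t₁) * (β * R ^ d)))
          + C * (κ * (1 / (η * r) ^ 2)) * (κ * ((t₂ - t₁) * (β * R ^ d))) := by
          have : σ ≤ κ * (1 / (η * r) ^ 2) := by nlinarith
          gcongr
      _ = 2 * C / (η * r) ^ 2 * κ ^ 2 * ((t₂ - t₁) * (β * R ^ d)) := by rw [e1]; ring
      _ ≤ 2 * C / (η * r) ^ 2 * κ ^ 2 * ((c * α ^ 3 * r ^ 2) * (2 ^ d * B)) := by gcongr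
      _ = κ ^ 2 * (α / 8 * B) := by
          have e8 : (8 : ℝ) ^ d = (2 ^ d) ^ 3 := by
            rw [← pow_mul, mul_comm, pow_mul]; norm_num
          rw [hη, hc, e8]
          field_simp
          norm_num
  have htot : ∫⁻ x in Metric.ball y r, ENNReal.ofReal (max (κ - u (t₂, x)) 0 ^ 2)
      ≤ ENNReal.ofReal (κ ^ 2 * ((1 - 3 * α / 4) * B)) := by
    refine hprop.trans ?_
    rw [add_assoc]
    refine (add_le_add hinit hevol).trans ?_
    rw [← ENNReal.ofReal_add (mul_nonneg (sq_nonneg _) (mul_nonneg (by linarith) hB0.le))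
      (by positivity)]
    refine ENNReal.ofReal_le_ofReal (le_of_eq ?_)
    ring
  -- the final time
  have hum : AEMeasurable (fun x => u (t₂, x)) (volume.restrict (Metric.ball y r)) :=
    (h.aemeasurable_section t₂ hs2).mono_measure (Measure.restrict_mono hballr le_rfl)
  set A : Set (EuclideanSpace ℝ (Fin d)) := {x | α * κ / 8 ≤ u (t₂, x)} with hA
  have hAm : NullMeasurableSet A (volume.restrict (Metric.ball y r)) :=
    nullMeasurableSet_le aemeasurable_const hum
  have hsum := measure_add_measure_compl₀ hAm
  rw [Measure.restrict_apply_univ, volume_ball_eq_ofReal y hr] at hsum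
  -- Chebyshev: off `A` the truncation is at least `(1 - α/8) κ`. The fraction `1 - 3α/4` becomes `1
  -- - α/2` through `1 - 3α/4 ≤ (1 - α/8)² (1 - α/2)`.
  have hcompl : (volume.restrict (Metric.ball y r)) Aᶜ ≤ ENNReal.ofReal ((1 - α / 2) * B) := by
    have h1 : ENNReal.ofReal (((1 - α / 8) * κ) ^ 2) * (volume.restrict (Metric.ball y r)) Aᶜ
        ≤ ENNReal.ofReal (κ ^ 2 * ((1 - 3 * α / 4) * B)) := by
      refine le_trans ?_ htot
      rw [← lintegral_indicator_const₀ hAm.compl]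
      refine lintegral_mono fun x => ?_
      by_cases hxA : x ∈ A
      · simp [hxA]
      · rw [indicator_of_mem (by exact hxA)]
        have h4 : u (t₂, x) < α * κ / 8 := not_le.1 hxA
        refine ENNReal.ofReal_le_ofReal (pow_le_pow_left₀ (by nlinarith) ?_ 2)
        exact le_max_of_le_left (by linarith)
    have hk : 0 < ((1 - α / 8) * κ) ^ 2 := by
      have : 0 < 1 - α / 8 := by linarith
      positivity
    refine (ENNReal.mul_le_mul_iff_right (ENNReal.ofReal_pos.2 hk).ne' ENNReal.ofReal_ne_top).1
      (h1.trans ?_)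
    rw [← ENNReal.ofReal_mul hk.le]
    refine ENNReal.ofReal_le_ofReal ?_
    have h5 : 1 - 3 * α / 4 ≤ (1 - α / 8) ^ 2 * (1 - α / 2) := by nlinarith [sq_nonneg α]
    calc κ ^ 2 * ((1 - 3 * α / 4) * B) ≤ κ ^ 2 * ((1 - α / 8) ^ 2 * (1 - α / 2) * B) := by gcongr
      _ = _ := by ring
  rw [inter_comm, ← Measure.restrict_apply' measurableSet_ball]
  refine (ENNReal.add_le_add_iff_right (a := ENNReal.ofReal ((1 - α / 2) * B))
    ENNReal.ofReal_ne_top).1 ?_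
  rw [← ENNReal.ofReal_add (by positivity) (mul_nonneg (by linarith) hB0.le)]
  calc ENNReal.ofReal (α / 2 * B + (1 - α / 2) * B) = ENNReal.ofReal B := by congr 1; ring
    _ = _ := hsum.symm
    _ ≤ _ := by gcongr

/-- The energy estimate in a cylinder that is short in time. -/
theorem diffQuotientBound_short_cylinder {C σ : ℝ} {u : ℝ × EuclideanSpace ℝ (Fin d) → ℝ}
    (h : NonnegDeGiorgi C σ u) (hC : 0 ≤ C) (hσ : 0 ≤ σ) {κ r δ t : ℝ} {y : E} (hκ : 0 < κ)
    (hσκ : σ ≤ κ) (hδ : 0 < δ) (hδr : δ ≤ r) (ht : t ≤ 0) (htδ : -1 ≤ t - (2 * δ) ^ 2)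
    (hball : Metric.ball y (r + 3 * δ) ⊆ Metric.ball 0 1) :
    DiffQuotientBound (Ioo (t - δ ^ 2) t) (Metric.ball y r) (fun X => max (κ - u X) 0)
      (ENNReal.ofReal (12 * C * 4 ^ d * unitBallVolume d * κ ^ 2 * r ^ d)) := by
  set β := unitBallVolume d with hβdef
  have hβ : 0 < β := unitBallVolume_pos d
  have hr : 0 < r := hδ.trans_le hδr
  have hδ1 : δ ^ 2 ≤ 1 := by nlinarith
  obtain ⟨G, hG, hGe⟩ := h.energy κ
  have hyr : Metric.ball y r ⊆ Metric.ball 0 1 :=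
    (Metric.ball_subset_ball (by linarith)).trans hball
  have ht1 : -1 ≤ t - δ ^ 2 := by nlinarith
  refine (h.diffQuotientBound hκ.le hG ht ht1 hyr).mono_energy ?_
  have hGm : AEMeasurable (fun X => ENNReal.ofReal (‖G X‖ ^ 2))
      (volume.restrict (Ioo (t - δ ^ 2) t ×ˢ Metric.ball y r)) := by
    have h1 := (hG.locallyIntegrable_grad.aestronglyMeasurable.mono_measure
      (Measure.restrict_mono (prod_mono (Ioo_subset_Ioo ht1 ht) hyr) le_rfl)).aemeasurable
    exact (h1.norm.pow_const 2).ennreal_ofReal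
  -- The energy estimate ties the time scale to the space scale, so it is applied on balls of radius
  -- `δ` rather than on `B_r`. It then needs only a past of length `(2δ)²`, and averaging over the
  -- centres gives a bound free of `δ`.
  have hz : ∀ z ∈ Metric.ball y (r + δ),
      ∫⁻ X in Ioo (t - δ ^ 2) t ×ˢ (Metric.ball y r ∩ Metric.ball z δ), ENNReal.ofReal (‖G X‖ ^ 2)
        ≤ ENNReal.ofReal (12 * C * 2 ^ d * β * κ ^ 2 * δ ^ d) := by
    intro z hz
    have hzb : Metric.ball z (2 * δ) ⊆ Metric.ball 0 1 := by
      refine (Metric.ball_subset_ball' ?_).trans hball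
      have : dist z y < r + δ := hz
      linarith
    refine (lintegral_mono_set (prod_mono Ioo_subset_Ioc_self inter_subset_right)).trans
      ((hGe t z δ (2 * δ) ht hδ (by linarith) htδ hzb).2.trans ?_)
    have h1 := h.lintegral_truncation_sq_le hκ.le ht htδ (by nlinarith) (by positivity) hzb
    have h2 := h.lintegral_truncation_le hκ.le ht htδ (by nlinarith) (by positivity) hzb
    refine (add_le_add (mul_le_mul_right h1 _) (mul_le_mul_right h2 _)).trans ?_
    have e : t - (t - (2 * δ) ^ 2) = 4 * δ ^ 2 := by ring
    have e' : 2 * δ - δ = δ := by ring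
    rw [e, e', ← ENNReal.ofReal_mul (by positivity), ← ENNReal.ofReal_mul (by positivity),
      ← ENNReal.ofReal_add (by positivity) (by positivity)]
    refine ENNReal.ofReal_le_ofReal ?_
    rw [← hβdef]
    calc C * (1 / δ ^ 2 + 1 / δ ^ 2) * (κ ^ 2 * (4 * δ ^ 2 * (β * (2 * δ) ^ d)))
          + C * σ * (κ * (4 * δ ^ 2 * (β * (2 * δ) ^ d)))
        ≤ C * (1 / δ ^ 2 + 1 / δ ^ 2) * (κ ^ 2 * (4 * δ ^ 2 * (β * (2 * δ) ^ d)))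
          + C * κ * (κ * (4 * 1 * (β * (2 * δ) ^ d))) := by gcongr
      _ = _ := by rw [mul_pow]; field_simp; ring
  have hav := lintegral_ball_le_of_small_balls measurableSet_Ioo y hGm hz
  rw [volume_ball_eq_ofReal _ hδ, volume_ball_eq_ofReal _ (by linarith : 0 < r + δ),
    ← ENNReal.ofReal_mul (by positivity)] at hav
  have hβδ : 0 < β * δ ^ d := by positivity
  refine (ENNReal.mul_le_mul_iff_right (ENNReal.ofReal_pos.2 hβδ).ne' ENNReal.ofReal_ne_top).1
    (hav.trans ?_)
  rw [← ENNReal.ofReal_mul hβδ.le]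
  refine ENNReal.ofReal_le_ofReal ?_
  calc β * (r + δ) ^ d * (12 * C * 2 ^ d * β * κ ^ 2 * δ ^ d)
      ≤ β * (2 * r) ^ d * (12 * C * 2 ^ d * β * κ ^ 2 * δ ^ d) := by
        gcongr; linarith
    _ = _ := by
        rw [mul_pow, show (4 : ℝ) = 2 * 2 by norm_num, mul_pow]; ring

end NonnegDeGiorgi

namespace NonnegDeGiorgi

/-- Shrinking of sublevel sets: if `u ≥ κ` on a fixed fraction of the ball at all times, then
the sublevel sets `{u ≤ κ / 2 ^ J}` have small measure. -/
theorem measure_sublevel_le {C σ : ℝ} {u : ℝ × EuclideanSpace ℝ (Fin d) → ℝ}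
    (h : NonnegDeGiorgi C σ u) (hC : 0 ≤ C) (hσ : 0 ≤ σ) {κ r δ t α μ : ℝ} {y : E} (hκ : 0 < κ)
    {J : ℕ} (hσκ : σ ≤ κ / 2 ^ J) (hδ : 0 < δ) (hδr : δ ≤ r) (ht : t ≤ 0)
    (htδ : -1 ≤ t - (2 * δ) ^ 2) (hball : Metric.ball y (r + 3 * δ) ⊆ Metric.ball 0 1)
    (hα : 0 < α) (hμ : 0 < μ)
    (hm : ∀ s ∈ Ioo (t - δ ^ 2) t, ENNReal.ofReal (α * (unitBallVolume d * r ^ d))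
      ≤ volume (Metric.ball y r ∩ {x | κ ≤ u (s, x)})) :
    J * (volume ((Ioo (t - δ ^ 2) t ×ˢ Metric.ball y r) ∩ {X | u X ≤ κ / 2 ^ J})).toReal
      ≤ 2 * 2 ^ d / α * (4 * (12 * C * 4 ^ d * unitBallVolume d) * (J * μ)
        + unitBallVolume d / μ) * r ^ (d + 2) := by
  set β := unitBallVolume d with hβdef
  have hβ : 0 < β := unitBallVolume_pos d
  have hr : 0 < r := hδ.trans_le hδr
  set C₁ : ℝ := 12 * C * 4 ^ d * β with hC₁
  have hC₁0 : 0 ≤ C₁ := by positivity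
  set I := Ioo (t - δ ^ 2) t with hI
  set K := Metric.ball y r with hK
  have hδ2 : 0 < δ ^ 2 := by positivity
  have hyr : K ⊆ Metric.ball 0 1 := (Metric.ball_subset_ball (by linarith)).trans hball
  have ht1 : -1 ≤ t - δ ^ 2 := by nlinarith
  have hum : AEMeasurable u (volume.restrict (I ×ˢ K)) := h.aemeasurable_cylinder_Ioo ht ht1 hyr
  have hvol : volume (I ×ˢ K) = ENNReal.ofReal (δ ^ 2 * (β * r ^ d)) := by
    rw [hI, hK, volume_Ioo_prod_ball _ _ _ hr (by linarith)]
    congr 2; ring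
  have hfin : ∀ s : Set (ℝ × E), volume ((I ×ˢ K) ∩ s) ≠ ∞ := fun s =>
    ((measure_mono inter_subset_left).trans_lt (by rw [hvol]; exact ENNReal.ofReal_lt_top)).ne
  let κ' : ℕ → ℝ := fun j => κ / 2 ^ j
  have hκ0 : ∀ j, 0 < κ' j := fun j => by positivity
  have hκs : ∀ j, κ' (j + 1) = κ' j / 2 := fun j => by simp only [κ', pow_succ]; field_simp
  have hanti : Antitone κ' := antitone_nat_of_succ_le fun j => by
    rw [hκs]; linarith [hκ0 j]
  set a := (volume ((I ×ˢ K) ∩ {X | u X ≤ κ / 2 ^ J})).toReal with ha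
  let A : ℕ → Set (ℝ × E) := fun j => {X | κ' (j + 1) < u X ∧ u X < κ' j}
  -- one level
  have hstep : ∀ j < J, a ≤ 2 * 2 ^ d / α * (4 * C₁ * μ * r ^ (d + 2)
      + (volume ((I ×ˢ K) ∩ A j)).toReal / μ) := by
    intro j hj
    have hk := hκ0 j
    have hσj : σ ≤ κ' j := hσκ.trans (hanti hj.le)
    have hDQ := h.diffQuotientBound_short_cylinder hC hσ hk hσj hδ hδr ht htδ hball
    have hm' : ∀ s ∈ I, ENNReal.ofReal (α * (β * r ^ d))
        ≤ volume (Metric.ball y r ∩ {x | κ' j ≤ u (s, x)}) := by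
      intro s hs
      refine (hm s hs).trans (measure_mono (inter_subset_inter_right _ fun x hx => ?_))
      have h1 : κ ≤ u (s, x) := hx
      have h2 : κ' j ≤ κ' 0 := hanti (Nat.zero_le j)
      simp only [κ', pow_zero, div_one] at h2 ⊢
      exact h2.trans h1
    -- With `c = μ / κ' j` every term is linear in `κ' j`, so the level cancels.
    have hiso := isoperimetric measurableSet_Ioo y hum (κ₁ := κ' j) (κ₂ := κ' (j + 1))
      (by rw [hκs]; linarith) hDQ hm' (c := μ / κ' j) (by positivity)
    rw [volume_ball_eq_ofReal _ (by positivity : 0 < 2 * r)] at hiso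
    have h1 := ENNReal.toReal_mono (by
      refine ENNReal.mul_ne_top ENNReal.ofReal_ne_top (ENNReal.add_ne_top.2 ⟨?_, ?_⟩)
      · exact ENNReal.mul_ne_top ENNReal.ofReal_ne_top ENNReal.ofReal_ne_top
      · exact ENNReal.mul_ne_top ENNReal.ofReal_ne_top (hfin _)) hiso
    rw [ENNReal.toReal_mul, ENNReal.toReal_mul, ENNReal.toReal_mul, ENNReal.toReal_add
      (ENNReal.mul_ne_top ENNReal.ofReal_ne_top ENNReal.ofReal_ne_top)
      (ENNReal.mul_ne_top ENNReal.ofReal_ne_top (hfin _)), ENNReal.toReal_mul, ENNReal.toReal_mul,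
      ENNReal.toReal_ofReal (by positivity), ENNReal.toReal_ofReal (by rw [hκs]; linarith),
      ENNReal.toReal_ofReal (by positivity), ENNReal.toReal_ofReal (by positivity),
      ENNReal.toReal_ofReal (by positivity), ENNReal.toReal_ofReal (by positivity)] at h1
    have h2 : a ≤ (volume ((I ×ˢ K) ∩ {X | u X ≤ κ' (j + 1)})).toReal := by
      refine ENNReal.toReal_mono (hfin _) (measure_mono (inter_subset_inter_right _ fun X hX => ?_))
      have h3 : u X ≤ κ' J := hX
      exact h3.trans (hanti hj)
    have h3 : α * (β * r ^ d) * (κ' j / 2) * a ≤ β * (2 * r) ^ d *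
        (μ / κ' j * (2 * r) ^ 2 * (C₁ * κ' j ^ 2 * r ^ d)
        + 1 / (μ / κ' j) * (volume ((I ×ˢ K) ∩ A j)).toReal) := by
      refine le_trans ?_ h1
      have e : κ' j - κ' (j + 1) = κ' j / 2 := by rw [hκs]; ring
      rw [e]
      gcongr
    have hpos : 0 < α * (β * r ^ d) * (κ' j / 2) := by positivity
    rw [← mul_le_mul_iff_right₀ hpos]
    refine h3.trans (le_of_eq ?_)
    rw [mul_pow, pow_add]
    field_simp
    ring
  -- The bands are disjoint, so their measures sum to at most that of the cylinder, independently of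
  -- `J`. This is the gain obtained by summing over the levels.
  have hsum : ∑ j ∈ Finset.range J, (volume ((I ×ˢ K) ∩ A j)).toReal ≤ β * r ^ (d + 2) := by
    have h1 : ∑ j ∈ Finset.range J, (volume.restrict (I ×ˢ K)) (A j)
        ≤ (volume.restrict (I ×ˢ K)) univ := by
      refine sum_measure_le_measure_univ (fun j _ => ?_) fun i _ j _ hij => ?_
      · exact (nullMeasurableSet_lt aemeasurable_const hum).inter
          (nullMeasurableSet_lt hum aemeasurable_const)
      · refine Disjoint.aedisjoint (disjoint_left.2 fun X hXi hXj => ?_)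
        have h2 : κ' (i + 1) < u X := hXi.1
        have h3 : u X < κ' i := hXi.2
        have h4 : κ' (j + 1) < u X := hXj.1
        have h5 : u X < κ' j := hXj.2
        rcases lt_or_gt_of_ne hij with hlt | hlt
        · have := hanti (show i + 1 ≤ j from hlt)
          linarith
        · have := hanti (show j + 1 ≤ i from hlt)
          linarith
    have h2 : ∀ j, (volume.restrict (I ×ˢ K)) (A j) = volume ((I ×ˢ K) ∩ A j) := fun j => by
      rw [Measure.restrict_apply' (measurableSet_Ioo.prod measurableSet_ball), inter_comm]
    simp only [h2, Measure.restrict_apply_univ, hvol] at h1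
    rw [← ENNReal.toReal_sum fun j _ => hfin _]
    refine ENNReal.toReal_le_of_le_ofReal (by positivity) (h1.trans (ENNReal.ofReal_le_ofReal ?_))
    calc δ ^ 2 * (β * r ^ d) ≤ r ^ 2 * (β * r ^ d) := by gcongr
      _ = _ := by rw [pow_add]; ring
  calc J * a = ∑ j ∈ Finset.range J, a := by simp
    _ ≤ ∑ j ∈ Finset.range J, 2 * 2 ^ d / α * (4 * C₁ * μ * r ^ (d + 2)
      + (volume ((I ×ˢ K) ∩ A j)).toReal / μ) :=
        Finset.sum_le_sum fun j hj => hstep j (Finset.mem_range.1 hj)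
    _ = 2 * 2 ^ d / α * (J * (4 * C₁ * μ * r ^ (d + 2))
      + (∑ j ∈ Finset.range J, (volume ((I ×ˢ K) ∩ A j)).toReal) / μ) := by
        rw [← Finset.mul_sum, Finset.sum_add_distrib, Finset.sum_div]
        simp
    _ ≤ 2 * 2 ^ d / α * (J * (4 * C₁ * μ * r ^ (d + 2)) + β * r ^ (d + 2) / μ) := by gcongr
    _ = _ := by ring

theorem exists_measure_sublevel_constant (d : ℕ) {C α ε : ℝ} (hC : 0 ≤ C) (hα : 0 < α)
    (hε : 0 < ε) :
    ∃ J : ℕ, ∀ (σ : ℝ) (u : ℝ × EuclideanSpace ℝ (Fin d) → ℝ), NonnegDeGiorgi C σ u → 0 ≤ σ →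
      ∀ (κ r δ t : ℝ) (y : EuclideanSpace ℝ (Fin d)), 0 < κ → σ ≤ κ / 2 ^ J → 0 < δ → δ ≤ r →
      t ≤ 0 → -1 ≤ t - (2 * δ) ^ 2 → Metric.ball y (r + 3 * δ) ⊆ Metric.ball 0 1 →
      (∀ s ∈ Ioo (t - δ ^ 2) t, ENNReal.ofReal (α * (unitBallVolume d * r ^ d))
        ≤ volume (Metric.ball y r ∩ {x | κ ≤ u (s, x)})) →
      volume ((Ioo (t - δ ^ 2) t ×ˢ Metric.ball y r) ∩ {X | u X ≤ κ / 2 ^ J})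
        ≤ ENNReal.ofReal (ε * r ^ (d + 2)) := by
  have hβ : 0 < unitBallVolume d := unitBallVolume_pos d
  set D : ℝ := 2 * 2 ^ d / α with hD
  set C₂ : ℝ := 4 * (12 * C * 4 ^ d * unitBallVolume d) with hC₂
  have hD0 : 0 < D := by positivity
  have hC₂0 : 0 ≤ C₂ := by positivity
  -- The energy term does not decay with `J`, so `μ` first makes it at most `ε / 2`; a large `J`
  -- then handles the band term, of order `1 / (μ J)`.
  set μ : ℝ := ε / (2 * D * (C₂ + 1)) with hμ
  have hμ0 : 0 < μ := by positivity
  obtain ⟨J, hJ⟩ := exists_nat_gt (2 * D * unitBallVolume d / (μ * ε))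
  have hJ0 : (0 : ℝ) < J := lt_trans (by positivity) hJ
  refine ⟨J, fun σ u h hσ κ r δ t y hκ hσκ hδ hδr ht htδ hball hm => ?_⟩
  have hr : 0 < r := hδ.trans_le hδr
  have key := h.measure_sublevel_le hC hσ hκ hσκ hδ hδr ht htδ hball hα hμ0 hm
  have hfin : volume ((Ioo (t - δ ^ 2) t ×ˢ Metric.ball y r) ∩ {X | u X ≤ κ / 2 ^ J}) ≠ ∞ := by
    refine ((measure_mono inter_subset_left).trans_lt ?_).ne
    rw [volume_Ioo_prod_ball _ _ _ hr (by nlinarith)]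
    exact ENNReal.ofReal_lt_top
  rw [← ENNReal.ofReal_toReal hfin]
  refine ENNReal.ofReal_le_ofReal ?_
  rw [← mul_le_mul_iff_right₀ hJ0]
  refine key.trans ?_
  rw [← hD, ← hC₂, ← mul_assoc (J : ℝ)]
  refine mul_le_mul_of_nonneg_right ?_ (by positivity : 0 ≤ r ^ (d + 2))
  have h1 : D * (C₂ * (J * μ)) ≤ J * (ε / 2) := by
    have : D * (C₂ * μ) ≤ ε / 2 := by
      calc D * (C₂ * μ) ≤ D * ((C₂ + 1) * μ) := by gcongr; linarith
        _ = ε / 2 := by rw [hμ]; field_simp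
    calc _ = J * (D * (C₂ * μ)) := by ring
      _ ≤ _ := by gcongr
  have h2 : D * (unitBallVolume d / μ) ≤ J * (ε / 2) := by
    rw [div_lt_iff₀ (by positivity)] at hJ
    rw [← mul_div_assoc, div_le_iff₀ hμ0]
    linarith
  calc D * (C₂ * (J * μ) + unitBallVolume d / μ)
      = D * (C₂ * (J * μ)) + D * (unitBallVolume d / μ) := mul_add _ _ _
    _ ≤ J * ε := by linarith

/-! ### Expansion of positivity -/

set_option maxHeartbeats 1000000 in
/-- Expansion of positivity: if `u ≥ κ` on half of a ball, then some time later `u ≥ η κ` on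
the doubled ball. -/
theorem exists_expansion_constants (d : ℕ) {C : ℝ} (hC : 1 ≤ C) :
    ∃ θ : ℝ, ∃ m : ℕ, 0 < θ ∧ θ ≤ 1 ∧
      ∀ (σ : ℝ) (u : ℝ × EuclideanSpace ℝ (Fin d) → ℝ), NonnegDeGiorgi C σ u → 0 ≤ σ →
      ∀ (κ ρ s t : ℝ) (y : EuclideanSpace ℝ (Fin d)), 0 < κ → σ ≤ (1 / 2) ^ m * κ → 0 < ρ →
      8 * ρ ≤ 1 → Metric.ball y (8 * ρ) ⊆ Metric.ball 0 1 → -1 < s → t ≤ 0 →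
      θ / 2 * ρ ^ 2 ≤ t - s → t - s ≤ θ * ρ ^ 2 →
      ENNReal.ofReal (1 / 2 * (unitBallVolume d * ρ ^ d))
        ≤ volume (Metric.ball y ρ ∩ {x | κ ≤ u (s, x)}) →
      ∀ᵐ x ∂volume.restrict (Metric.ball y (2 * ρ)), (1 / 2) ^ m * κ ≤ u (t, x) := by
  have hβ : 0 < unitBallVolume d := unitBallVolume_pos d
  have hC0 : 0 ≤ C := by linarith
  obtain ⟨ν, hν, hDG⟩ := exists_pointwise_bound_constant d hC
  obtain ⟨c, hc, hc1, hP⟩ := exists_propagation_constant d hC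
  -- Half of `B_ρ` as a fraction of `B_{4ρ}`.
  set α : ℝ := 1 / 2 / 4 ^ d with hα
  have h4d : (1 : ℝ) ≤ 4 ^ d := one_le_pow₀ (by norm_num)
  have hα0 : 0 < α := by positivity
  have hα1 : α ≤ 1 := by
    rw [hα, div_le_one (by positivity)]; linarith
  set τ : ℝ := c * α ^ 3 with hτ
  have hτ0 : 0 < τ := by positivity
  have hα3 : α ^ 3 ≤ 1 / 8 := by
    calc α ^ 3 ≤ (1 / 2) ^ 3 := by
          refine pow_le_pow_left₀ hα0.le ?_ 3
          rw [hα]; exact div_le_self (by norm_num) h4d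
      _ = _ := by norm_num
  have hτ1 : τ ≤ 1 / 8 := by
    calc τ ≤ 1 * (1 / 8) := by rw [hτ]; gcongr
      _ = _ := by norm_num
  -- For `r = 4ρ` and `δ = τρ` this makes `ε r^(d+2) = ν δ^(d+2)`, the smallness that De Giorgi's
  -- first lemma requires in a cylinder of radius `δ`.
  obtain ⟨J, hJ⟩ := exists_measure_sublevel_constant d (C := C) (α := α / 2)
    (ε := ν * (τ / 4) ^ (d + 2)) hC0 (by positivity) (by positivity)
  obtain ⟨m, hm⟩ := exists_pow_lt_of_lt_one (show 0 < α / 8 / 2 ^ J / 2 by positivity)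
    (show (1 / 2 : ℝ) < 1 by norm_num)
  -- For `θ = 8 τ²` the waiting time is at least `(2δ)²`, which leaves room for the energy cylinders
  -- after time `s`, and at most `16 τ ρ² = c α³ r²`, the range of the propagation lemma.
  refine ⟨8 * τ ^ 2, m, by positivity, by nlinarith, ?_⟩
  intro σ u h hσ κ ρ s t y hκ hσκ hρ hρ1 hball hs ht hts1 hts2 hmeas
  have hρ2 : 0 < ρ ^ 2 := by positivity
  have hst : s < t := by
    have : 0 < 8 * τ ^ 2 / 2 * ρ ^ 2 := by positivity
    linarith
  have hm1 : (1 / 2 : ℝ) ^ m ≤ 1 := pow_le_one₀ (by norm_num) (by norm_num)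
  have hσκ1 : σ ≤ κ := by nlinarith
  set r : ℝ := 4 * ρ with hr
  set δ : ℝ := τ * ρ with hδ
  have hr0 : 0 < r := by positivity
  have hδ0 : 0 < δ := by positivity
  have hδρ : δ ≤ ρ := by rw [hδ]; nlinarith
  set κ' : ℝ := α * κ / 8 with hκ'
  have hκ'0 : 0 < κ' := by positivity
  have hball2 : Metric.ball y (2 * r) ⊆ Metric.ball 0 1 := by
    rw [hr, ← mul_assoc]; norm_num; exact hball
  -- propagation of the measure information
  have hmeas' : ENNReal.ofReal (α * (unitBallVolume d * r ^ d))
      ≤ volume (Metric.ball y r ∩ {x | κ ≤ u (s, x)}) := by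
    have e : α * (unitBallVolume d * r ^ d) = 1 / 2 * (unitBallVolume d * ρ ^ d) := by
      rw [hα, hr, mul_pow]; field_simp
    rw [e]
    exact hmeas.trans (measure_mono (inter_subset_inter_left _
      (Metric.ball_subset_ball (by linarith))))
  have h4δ : (2 * δ) ^ 2 ≤ t - s := by
    refine le_trans (le_of_eq ?_) hts1
    rw [hδ]; ring
  have hδ2 : 0 < δ ^ 2 := by positivity
  have hprop : ∀ s' ∈ Ioo (t - δ ^ 2) t, ENNReal.ofReal (α / 2 * (unitBallVolume d * r ^ d))
      ≤ volume (Metric.ball y r ∩ {x | κ' ≤ u (s', x)}) := by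
    intro s' hs'
    refine hP σ u h hσ κ α r s s' y hκ hσκ1 hα0 hα1 hr0 (by linarith) hball2 hs
      (by nlinarith [hs'.1]) (hs'.2.le.trans ht) ?_ hmeas'
    have h1 : 8 * τ ^ 2 ≤ 16 * τ := by nlinarith
    calc s' - s ≤ t - s := by linarith [hs'.2]
      _ ≤ 8 * τ ^ 2 * ρ ^ 2 := hts2
      _ ≤ 16 * τ * ρ ^ 2 := by gcongr
      _ = c * α ^ 3 * r ^ 2 := by rw [hτ, hr]; ring
  have hball3 : Metric.ball y (r + 3 * δ) ⊆ Metric.ball 0 1 :=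
    (Metric.ball_subset_ball (by linarith)).trans hball
  have htδ : -1 ≤ t - (2 * δ) ^ 2 := by linarith
  have hmκ : (1 / 2) ^ m * κ ≤ κ' / 2 ^ J / 2 := by
    calc (1 / 2) ^ m * κ ≤ α / 8 / 2 ^ J / 2 * κ := by gcongr
      _ = _ := by rw [hκ']; ring
  have hκJ : 0 < κ' / 2 ^ J := by positivity
  have hσJ : σ ≤ κ' / 2 ^ J := by linarith
  have hsmall := hJ σ u h hσ κ' r δ t y hκ'0 hσJ hδ0 (by linarith) ht htδ hball3 hprop
  -- pointwise information near every point
  have hloc : ∀ x ∈ Metric.ball y (2 * ρ),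
      ∀ᵐ z ∂volume.restrict (Metric.ball x (δ / 2)), κ' / 2 ^ J / 2 ≤ u (t, z) := by
    intro x hx
    have hxb : Metric.ball x δ ⊆ Metric.ball y r := by
      refine Metric.ball_subset_ball' ?_
      have : dist x y < 2 * ρ := hx
      linarith
    have hyr : Metric.ball y r ⊆ Metric.ball 0 1 :=
      (Metric.ball_subset_ball (by linarith)).trans hball2
    have htδ1 : -1 ≤ t - δ ^ 2 := by nlinarith
    refine hDG σ u h hσ (κ' / 2 ^ J) δ t x hκJ hσJ hδ0 ht htδ1 (hxb.trans hyr) ?_ t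
      ⟨sub_lt_self t (by positivity), le_rfl⟩
    set Q : Set (ℝ × EuclideanSpace ℝ (Fin d)) := Ioo (t - δ ^ 2) t ×ˢ Metric.ball x δ with hQ
    have hQm : MeasurableSet Q := measurableSet_Ioo.prod measurableSet_ball
    have hae : (Ioc (t - δ ^ 2) t ×ˢ Metric.ball x δ : Set (ℝ × EuclideanSpace ℝ (Fin d))) =ᵐ[volume] Q := by
      rw [Measure.volume_eq_prod]
      exact Measure.set_prod_ae_eq Ioo_ae_eq_Ioc.symm (ae_eq_refl _)
    rw [setLIntegral_congr hae]
    have hum : AEMeasurable u (volume.restrict Q) :=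
      h.aemeasurable_cylinder_Ioo ht htδ1 (hxb.trans hyr)
    have hAm : NullMeasurableSet {X | u X ≤ κ' / 2 ^ J} (volume.restrict Q) :=
      nullMeasurableSet_le hum aemeasurable_const
    calc ∫⁻ X in Q, ENNReal.ofReal (max (κ' / 2 ^ J - u X) 0 ^ 2)
        ≤ ∫⁻ X in Q, indicator {X | u X ≤ κ' / 2 ^ J}
          (fun _ => ENNReal.ofReal ((κ' / 2 ^ J) ^ 2)) X := by
          refine lintegral_mono_ae ?_
          filter_upwards [ae_restrict_of_ae_restrict_of_subset (prod_mono_left Ioo_subset_Ioc_self)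
            (h.truncation_le hκJ.le ht htδ1 (hxb.trans hyr))] with X hX
          by_cases hXA : u X ≤ κ' / 2 ^ J
          · rw [indicator_of_mem (by exact hXA)]
            exact ENNReal.ofReal_le_ofReal (pow_le_pow_left₀ (le_max_right _ _) hX 2)
          · rw [max_eq_right (by linarith)]
            simp
      _ = ENNReal.ofReal ((κ' / 2 ^ J) ^ 2) * volume (Q ∩ {X | u X ≤ κ' / 2 ^ J}) := by
          rw [lintegral_indicator_const₀ hAm, Measure.restrict_apply' hQm, inter_comm]
      _ ≤ ENNReal.ofReal ((κ' / 2 ^ J) ^ 2) *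
          ENNReal.ofReal (ν * (τ / 4) ^ (d + 2) * r ^ (d + 2)) := by
          gcongr
          refine le_trans (measure_mono (inter_subset_inter_left _ ?_)) hsmall
          exact prod_mono_right hxb
      _ ≤ _ := by
          rw [← ENNReal.ofReal_mul (by positivity)]
          refine ENNReal.ofReal_le_ofReal (le_of_eq ?_)
          have e : δ = τ / 4 * r := by rw [hδ, hr]; ring
          have e2 : δ ^ (d + 2) = (τ / 4) ^ (d + 2) * r ^ (d + 2) := by rw [e, mul_pow]
          rw [e2]
          generalize (τ / 4) ^ (d + 2) = P
          generalize r ^ (d + 2) = R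
          ring
  -- The exceptional set is null near each of its points, hence null.
  rw [ae_restrict_iff' measurableSet_ball, ae_iff]
  refine measure_null_of_locally_null _ fun x hx => ?_
  simp only [mem_ofPred_eq, Classical.not_imp] at hx
  refine ⟨Metric.ball x (δ / 2) ∩ {z | ¬(z ∈ Metric.ball y (2 * ρ) → (1 / 2) ^ m * κ ≤ u (t, z))},
    Filter.inter_mem (mem_nhdsWithin_of_mem_nhds (Metric.ball_mem_nhds x (by positivity)))
      self_mem_nhdsWithin, ?_⟩
  have h1 := hloc x hx.1
  rw [ae_iff, Measure.restrict_apply' measurableSet_ball] at h1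
  refine measure_mono_null (fun z hz => ?_) h1
  refine ⟨fun hle => hz.2 fun _ => hmκ.trans hle, hz.1⟩

end NonnegDeGiorgi

/-! ### From the De Giorgi classes to the working class -/

theorem lintegral_source_mul_le {σ : ℝ} (hσ : 0 ≤ σ) {S f : ℝ × E → ℝ}
    {Q P : Set (ℝ × E)} (hPQ : P ⊆ Q) (hS : ∀ᵐ X ∂volume.restrict Q, |S X| ≤ σ)
    (hf : ∀ X, 0 ≤ f X) :
    ∫⁻ X in P, ENNReal.ofReal (|S X| * f X)
      ≤ ENNReal.ofReal σ * ∫⁻ X in P, ENNReal.ofReal (f X) := by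
  rw [← lintegral_const_mul' _ _ ENNReal.ofReal_ne_top]
  refine lintegral_mono_ae ?_
  filter_upwards [ae_restrict_of_ae_restrict_of_subset hPQ hS] with X hX
  rw [← ENNReal.ofReal_mul hσ]
  exact ENNReal.ofReal_le_ofReal (mul_le_mul_of_nonneg_right hX (hf X))

/-- For `-u` at the level `-κ` the positive part is `(κ - u)₊`. -/
theorem MemPDGMinus.energy_estimate {Cplus Cminus C σ : ℝ} {S u : ℝ × EuclideanSpace ℝ (Fin d) → ℝ}
    (h : MemPDGMinus Cplus Cminus (-1) 0 0 1 S u) (hC : Cplus ≤ C) (hC0 : 0 ≤ C) (hσ : 0 ≤ σ)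
    (hS : ∀ᵐ X ∂volume.restrict (Ioc (-1) 0 ×ˢ Metric.ball (0 : E) 1), |S X| ≤ σ) (κ : ℝ) :
    ∃ G : ℝ × E → E,
    IsWeakSpatialGradient (Ioo (-1) 0 ×ˢ Metric.ball 0 1) (fun X => max (κ - u X) 0) G ∧
    ∀ (t : ℝ) (x : E) (r R : ℝ), t ≤ 0 → 0 < r → r < R → -1 ≤ t - R ^ 2 →
      Metric.ball x R ⊆ Metric.ball 0 1 →
      (∀ s ∈ Ioc (t - r ^ 2) t,
        ∫⁻ x in Metric.ball x r, ENNReal.ofReal (max (κ - u (s, x)) 0 ^ 2)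
        ≤ ENNReal.ofReal (C * (1 / (R - r) ^ 2 + 1 / r ^ 2)) *
          (∫⁻ X in Ioc (t - R ^ 2) t ×ˢ Metric.ball x R, ENNReal.ofReal (max (κ - u X) 0 ^ 2))
          + ENNReal.ofReal (C * σ) *
          (∫⁻ X in Ioc (t - R ^ 2) t ×ˢ Metric.ball x R, ENNReal.ofReal (max (κ - u X) 0))) ∧
      ∫⁻ X in Ioc (t - r ^ 2) t ×ˢ Metric.ball x r, ENNReal.ofReal (‖G X‖ ^ 2)
        ≤ ENNReal.ofReal (C * (1 / (R - r) ^ 2 + 1 / r ^ 2)) *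
          (∫⁻ X in Ioc (t - R ^ 2) t ×ˢ Metric.ball x R, ENNReal.ofReal (max (κ - u X) 0 ^ 2))
          + ENNReal.ofReal (C * σ) *
          (∫⁻ X in Ioc (t - R ^ 2) t ×ˢ Metric.ball x R, ENNReal.ofReal (max (κ - u X) 0)) := by
  obtain ⟨G, hG, hGe⟩ := h.neg_memPDGPlus.energy (-κ)
  have e : ∀ X, max (-u X - -κ) 0 = max (κ - u X) 0 := fun X => by congr 1; ring
  simp only [e] at hG hGe
  refine ⟨G, hG, fun t x r R ht hr hrR htR hball => ?_⟩
  have hR : 0 < R := hr.trans hrR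
  have hsub : parabolicCylinder (t, x) R ⊆ Ioc (-1) 0 ×ˢ Metric.ball (0 : E) 1 :=
    prod_mono (Ioc_subset_Ioc htR ht) hball
  have hX₀ : (t, x) ∈ Ioc (-1) 0 ×ˢ Metric.ball (0 : E) 1 :=
    ⟨⟨by dsimp only; nlinarith, ht⟩, hball (Metric.mem_ball_self hR)⟩
  have h1 := hGe (t, x) hX₀ r R hr hrR hsub
  have h2 : ENNReal.ofReal (Cplus * (1 / (R - r) ^ 2 + 1 / r ^ 2)) *
          (∫⁻ X in parabolicCylinder (t, x) R, ENNReal.ofReal (max (κ - u X) 0 ^ 2))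
        + ENNReal.ofReal Cplus *
          (∫⁻ X in parabolicCylinder (t, x) R, ENNReal.ofReal (|S X| * max (κ - u X) 0))
      ≤ ENNReal.ofReal (C * (1 / (R - r) ^ 2 + 1 / r ^ 2)) *
          (∫⁻ X in Ioc (t - R ^ 2) t ×ˢ Metric.ball x R, ENNReal.ofReal (max (κ - u X) 0 ^ 2))
          + ENNReal.ofReal (C * σ) *
          (∫⁻ X in Ioc (t - R ^ 2) t ×ˢ Metric.ball x R, ENNReal.ofReal (max (κ - u X) 0)) := by
    have h3 := lintegral_source_mul_le hσ hsub hS (f := fun X => max (κ - u X) 0)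
      fun X => le_max_right _ _
    rw [ENNReal.ofReal_mul hC0 (q := σ), mul_assoc]
    refine add_le_add ?_ ?_
    · refine mul_le_mul_left (ENNReal.ofReal_le_ofReal ?_) _
      exact mul_le_mul_of_nonneg_right hC (by positivity)
    · exact mul_le_mul' (ENNReal.ofReal_le_ofReal hC) h3
  refine ⟨fun s hs => ?_, ?_⟩
  · refine le_trans ?_ ((le_self_add.trans h1).trans h2)
    exact le_iSup₂ (f := fun s (_ : s ∈ Ioc (t - r ^ 2) t) =>
      ∫⁻ x in Metric.ball x r, ENNReal.ofReal (max (κ - u (s, x)) 0 ^ 2)) s hs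
  · exact (le_add_self.trans h1).trans h2

/-- At level `0` the right-hand side of the energy estimate vanishes, while its left-hand side
controls each time slice. This upgrades the sign from almost everywhere in space-time to every time.
-/
theorem MemPDGMinus.nonneg_section {Cplus Cminus σ : ℝ} {S u : ℝ × EuclideanSpace ℝ (Fin d) → ℝ}
    (h : MemPDGMinus Cplus Cminus (-1) 0 0 1 S u) (hC0 : 0 ≤ Cplus) (hσ : 0 ≤ σ)
    (hS : ∀ᵐ X ∂volume.restrict (Ioc (-1) 0 ×ˢ Metric.ball (0 : E) 1), |S X| ≤ σ)
    (hu : ∀ᵐ X ∂volume.restrict (Ioc (-1) 0 ×ˢ Metric.ball (0 : E) 1), 0 ≤ u X)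
    {t : ℝ} (ht : t ∈ Ioc (-1 : ℝ) 0) :
    ∀ᵐ x ∂volume.restrict (Metric.ball (0 : E) 1), 0 ≤ u (t, x) := by
  obtain ⟨G, -, hG⟩ := h.energy_estimate le_rfl hC0 hσ hS 0
  have hloc : ∀ x ∈ Metric.ball (0 : E) 1, ∃ r > 0,
      ∀ᵐ z ∂volume.restrict (Metric.ball x r), 0 ≤ u (t, z) := by
    intro x hx
    have hx1 : dist x 0 < 1 := hx
    set R := min (1 - dist x 0) (t + 1) with hR
    have hR0 : 0 < R := lt_min (by linarith) (by linarith [ht.1])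
    have hR1 : R ≤ 1 - dist x 0 := min_le_left _ _
    have hR2 : R ≤ t + 1 := min_le_right _ _
    have hRle : R ≤ 1 := by linarith [ht.2]
    have hball : Metric.ball x R ⊆ Metric.ball 0 1 := Metric.ball_subset_ball' (by linarith)
    have htR : -1 ≤ t - R ^ 2 := by nlinarith
    refine ⟨R / 2, by positivity, ?_⟩
    have h1 := (hG t x (R / 2) R ht.2 (by positivity) (by linarith) htR hball).1 t
      ⟨sub_lt_self t (by positivity), le_rfl⟩
    have h2 : ∀ᵐ X ∂volume.restrict (Ioc (t - R ^ 2) t ×ˢ Metric.ball x R), max (0 - u X) 0 = 0 := by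
      filter_upwards [ae_restrict_of_ae_restrict_of_subset
        (prod_mono (Ioc_subset_Ioc htR ht.2) hball) hu] with X hX
      exact max_eq_right (by linarith)
    have h3 : ∫⁻ X in Ioc (t - R ^ 2) t ×ˢ Metric.ball x R, ENNReal.ofReal (max (0 - u X) 0 ^ 2)
        = 0 := by
      rw [lintegral_congr_ae (g := fun _ => 0), lintegral_zero]
      filter_upwards [h2] with X hX
      rw [hX]; simp
    have h4 : ∫⁻ X in Ioc (t - R ^ 2) t ×ˢ Metric.ball x R, ENNReal.ofReal (max (0 - u X) 0)
        = 0 := by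
      rw [lintegral_congr_ae (g := fun _ => 0), lintegral_zero]
      filter_upwards [h2] with X hX
      rw [hX]; simp
    rw [h3, h4, mul_zero, mul_zero, add_zero] at h1
    have hm : AEMeasurable (fun z => ENNReal.ofReal (max (0 - u (t, z)) 0 ^ 2))
        (volume.restrict (Metric.ball x (R / 2))) := by
      have h5 := ((h.neg_memPDGPlus.aestronglyMeasurable_section t ht).mono_measure
        (Measure.restrict_mono ((Metric.ball_subset_ball (by linarith)).trans hball)
          le_rfl)).aemeasurable (μ := volume.restrict (Metric.ball x (R / 2)))
      have h6 := ((h5.max (aemeasurable_const (b := (0 : ℝ)))).pow_const 2).ennreal_ofReal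
      refine h6.congr (ae_of_all _ fun z => ?_)
      simp
    have h7 := (lintegral_eq_zero_iff' hm).1 (le_antisymm h1 zero_le)
    filter_upwards [h7] with z hz
    have h8 : max (0 - u (t, z)) 0 ^ 2 ≤ 0 := by simpa using hz
    by_contra h9
    have h10 : 0 < max (0 - u (t, z)) 0 := lt_max_of_lt_left (by linarith)
    have : 0 < max (0 - u (t, z)) 0 ^ 2 := by positivity
    linarith
  rw [ae_restrict_iff' measurableSet_ball, ae_iff]
  refine measure_null_of_locally_null _ fun x hx => ?_
  simp only [mem_ofPred_eq, Classical.not_imp] at hx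
  obtain ⟨r, hr, h1⟩ := hloc x hx.1
  refine ⟨Metric.ball x r ∩ {z | ¬(z ∈ Metric.ball (0 : E) 1 → 0 ≤ u (t, z))},
    Filter.inter_mem (mem_nhdsWithin_of_mem_nhds (Metric.ball_mem_nhds x hr))
      self_mem_nhdsWithin, ?_⟩
  rw [ae_iff, Measure.restrict_apply' measurableSet_ball] at h1
  refine measure_mono_null (fun z hz => ?_) h1
  exact ⟨fun hle => hz.2 fun _ => hle, hz.1⟩

theorem MemPDGMinus.nonnegDeGiorgi {Cplus Cminus C σ : ℝ}
    {S u : ℝ × EuclideanSpace ℝ (Fin d) → ℝ}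
    (h : MemPDGMinus Cplus Cminus (-1) 0 0 1 S u) (hCp : 0 ≤ Cplus) (hC1 : Cplus ≤ C)
    (hC2 : Cminus ≤ C) (hσ : 0 ≤ σ)
    (hS : ∀ᵐ X ∂volume.restrict (Ioc (-1) 0 ×ˢ Metric.ball (0 : E) 1), |S X| ≤ σ)
    (hu : ∀ᵐ X ∂volume.restrict (Ioc (-1) 0 ×ˢ Metric.ball (0 : E) 1), 0 ≤ u X) :
    NonnegDeGiorgi C σ u where
  aemeasurable := by
    have := h.neg_memPDGPlus.aestronglyMeasurable.aemeasurable.neg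
    exact this.congr (ae_of_all _ fun X => by simp)
  aemeasurable_section t ht := by
    have := (h.neg_memPDGPlus.aestronglyMeasurable_section t ht).aemeasurable.neg
    exact this.congr (ae_of_all _ fun X => by simp)
  nonneg t ht := h.nonneg_section hCp hσ hS hu ht
  nonneg_ae := hu
  energy κ := h.energy_estimate hC1 (hCp.trans hC1) hσ hS κ
  propagation := by
    intro y r R t₁ t₂ κ hr hrR hball hR1 ht₁ ht ht₂ htR
    have hR : 0 < R := hr.trans hrR
    have hR2 : R ^ 2 ≤ 1 := pow_le_one₀ hR.le hR1
    have hC0 : 0 ≤ C := hCp.trans hC1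
    -- The top of the cylinder is raised above `t₂` when the cylinder ending at `t₂` would start
    -- before `-1`; its time interval still contains `t₁`.
    set T := max t₂ (-1 + R ^ 2) with hT
    have hT0 : T ≤ 0 := max_le ht₂ (by linarith)
    have hT1 : -1 + R ^ 2 ≤ T := le_max_right _ _
    have hT2 : t₂ ≤ T := le_max_left _ _
    have hTt : T - R ^ 2 < t₁ := by
      have : T < t₁ + R ^ 2 := max_lt (by linarith) (by linarith)
      linarith
    have hsub : parabolicCylinder (T, y) R ⊆ Ioc (-1) 0 ×ˢ Metric.ball (0 : E) 1 :=
      prod_mono (Ioc_subset_Ioc (by dsimp only; linarith) hT0) hball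
    have hX₀ : (T, y) ∈ Ioc (-1) 0 ×ˢ Metric.ball (0 : E) 1 :=
      ⟨⟨by dsimp only; linarith, hT0⟩, hball (Metric.mem_ball_self hR)⟩
    refine (h.propagation (T, y) hX₀ r R hr hrR hsub κ t₁ ⟨hTt, by dsimp only; linarith⟩ t₂
      ⟨by dsimp only; linarith, hT2⟩ ht).trans ?_
    have hsub2 : Ioc t₁ t₂ ×ˢ Metric.ball y R ⊆ Ioc (-1) 0 ×ˢ Metric.ball (0 : E) 1 :=
      prod_mono (Ioc_subset_Ioc ht₁.le ht₂) hball
    have h3 := lintegral_source_mul_le hσ hsub2 hS (f := fun X => max (κ - u X) 0)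
      fun X => le_max_right _ _
    rw [ENNReal.ofReal_mul hC0 (q := σ), mul_assoc]
    refine add_le_add (add_le_add le_rfl ?_) ?_
    · exact mul_le_mul_left (ENNReal.ofReal_le_ofReal
        (div_le_div_of_nonneg_right hC2 (sq_nonneg _))) _
    · exact mul_le_mul' (ENNReal.ofReal_le_ofReal hC2) h3

/-! ### Time slices and space-time measure -/

theorem half_measure_le_of_ae {y : E} {R r k : ℝ} (hr : 0 < r) (hrR : r ≤ R) {f : E → ℝ}
    (h : ∀ᵐ x ∂volume.restrict (Metric.ball y R), k ≤ f x) :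
    ENNReal.ofReal (1 / 2 * (unitBallVolume d * r ^ d))
      ≤ volume (Metric.ball y r ∩ {x | k ≤ f x}) := by
  have h1 : volume (Metric.ball y r) ≤ volume (Metric.ball y r ∩ {x | k ≤ f x}) := by
    refine measure_mono_ae ?_
    filter_upwards [(ae_restrict_iff' measurableSet_ball).1 h] with x hx hxr
    exact ⟨hxr, hx (Metric.ball_subset_ball hrR hxr)⟩
  refine le_trans ?_ h1
  rw [volume_ball_eq_ofReal y hr]
  have : 0 < unitBallVolume d * r ^ d := by have := unitBallVolume_pos d; positivity
  exact ENNReal.ofReal_le_ofReal (by linarith)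

theorem measure_prod_ge_of_slices {I : Set ℝ} (hI : MeasurableSet I) {K : Set E}
    (hK : MeasurableSet K) {u : ℝ × E → ℝ} (hu : AEMeasurable u (volume.restrict (I ×ˢ K)))
    {k : ℝ} {m : ℝ≥0∞} (hm : ∀ t ∈ I, m ≤ volume (K ∩ {x | k ≤ u (t, x)})) :
    m * volume I ≤ volume ((I ×ˢ K) ∩ {X | k ≤ u X}) := by
  obtain ⟨w, hwm, huw⟩ : ∃ w, Measurable w ∧ u =ᵐ[volume.restrict (I ×ˢ K)] w :=
    ⟨_, hu.measurable_mk, hu.ae_eq_mk⟩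
  rw [measure_inter_congr_of_ae_restrict (hI.prod hK) huw (k ≤ ·)]
  have hms : MeasurableSet ((I ×ˢ K) ∩ {X | k ≤ w X}) :=
    (hI.prod hK).inter (measurableSet_le measurable_const hwm)
  rw [Measure.volume_eq_prod, Measure.prod_apply hms]
  calc m * volume I = ∫⁻ t in I, m := by rw [setLIntegral_const]
    _ ≤ ∫⁻ t in I, volume (Prod.mk t ⁻¹' ((I ×ˢ K) ∩ {X | k ≤ w X})) := by
        refine setLIntegral_mono_ae' hI ?_
        filter_upwards [(ae_restrict_iff' hI).1 (ae_slice_eq huw)] with t ht htI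
        refine (hm t htI).trans ?_
        rw [measure_inter_congr_of_ae_restrict hK (ht htI) (k ≤ ·)]
        exact measure_mono fun x hx => ⟨⟨htI, hx.1⟩, hx.2⟩
    _ ≤ _ := setLIntegral_le_lintegral _ _

theorem measure_prod_le_of_slices {I : Set ℝ} (hI : MeasurableSet I) {K : Set E}
    (hK : MeasurableSet K) {u : ℝ × E → ℝ} (hu : AEMeasurable u (volume.restrict (I ×ˢ K)))
    (p : ℝ → Prop) (hp : MeasurableSet {s | p s}) {m : ℝ≥0∞}
    (hm : ∀ t ∈ I, volume (K ∩ {x | p (u (t, x))}) ≤ m) :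
    volume ((I ×ˢ K) ∩ {X | p (u X)}) ≤ m * volume I := by
  obtain ⟨w, hwm, huw⟩ : ∃ w, Measurable w ∧ u =ᵐ[volume.restrict (I ×ˢ K)] w :=
    ⟨_, hu.measurable_mk, hu.ae_eq_mk⟩
  rw [measure_inter_congr_of_ae_restrict (hI.prod hK) huw p]
  have hms : MeasurableSet ((I ×ˢ K) ∩ {X | p (w X)}) := (hI.prod hK).inter (hwm hp)
  rw [Measure.volume_eq_prod, Measure.prod_apply hms]
  calc ∫⁻ t, volume (Prod.mk t ⁻¹' ((I ×ˢ K) ∩ {X | p (w X)}))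
      ≤ ∫⁻ t, I.indicator (fun _ => m) t := by
        refine lintegral_mono_ae ?_
        filter_upwards [(ae_restrict_iff' hI).1 (ae_slice_eq huw)] with t ht
        by_cases htI : t ∈ I
        · rw [indicator_of_mem htI]
          refine le_trans ?_ (hm t htI)
          rw [measure_inter_congr_of_ae_restrict hK (ht htI) p]
          exact measure_mono fun x hx => ⟨hx.1.2, hx.2⟩
        · rw [indicator_of_notMem htI, nonpos_iff_eq_zero]
          refine measure_mono_null (fun x hx => ?_) measure_empty
          exact htI hx.1.1
    _ = _ := by rw [lintegral_indicator_const hI]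

theorem ae_prod_of_slices {I : Set ℝ} (hI : MeasurableSet I) {K : Set E}
    (hK : MeasurableSet K) {u : ℝ × E → ℝ} (hu : AEMeasurable u (volume.restrict (I ×ˢ K)))
    {k : ℝ} (h : ∀ t ∈ I, ∀ᵐ x ∂volume.restrict K, k ≤ u (t, x)) :
    ∀ᵐ X ∂volume.restrict (I ×ˢ K), k ≤ u X := by
  have h1 := measure_prod_le_of_slices hI hK hu (fun s => ¬ k ≤ s)
    (measurableSet_le measurable_const measurable_id).compl (m := 0) fun t ht => by
      have := h t ht
      rw [ae_iff, Measure.restrict_apply' hK, inter_comm] at this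
      exact this.le
  rw [zero_mul, nonpos_iff_eq_zero] at h1
  rw [ae_iff, Measure.restrict_apply' (hI.prod hK), inter_comm]
  exact h1

/-! ### Iterating the expansion of positivity -/

/-- The expansion of positivity property with time scale `θ` and loss `(1 / 2) ^ m`. -/
def ExpandsPositivity (σ θ : ℝ) (m : ℕ) (u : ℝ × E → ℝ) : Prop :=
  ∀ (κ ρ s t : ℝ) (y : E), 0 < κ → σ ≤ (1 / 2) ^ m * κ → 0 < ρ →
    8 * ρ ≤ 1 → Metric.ball y (8 * ρ) ⊆ Metric.ball 0 1 → -1 < s → t ≤ 0 →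
    θ / 2 * ρ ^ 2 ≤ t - s → t - s ≤ θ * ρ ^ 2 →
    ENNReal.ofReal (1 / 2 * (unitBallVolume d * ρ ^ d))
      ≤ volume (Metric.ball y ρ ∩ {x | κ ≤ u (s, x)}) →
    ∀ᵐ x ∂volume.restrict (Metric.ball y (2 * ρ)), (1 / 2) ^ m * κ ≤ u (t, x)

namespace ExpandsPositivity

variable {σ θ : ℝ} {m : ℕ} {u : ℝ × EuclideanSpace ℝ (Fin d) → ℝ}

/-- A doubling from radius `R` takes a time `θ R²`. These times form a geometric series, whose sum
is bounded by `θ` times the square of the final radius. -/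
theorem iterate_doubling (h : ExpandsPositivity σ θ m u) (hθ : 0 < θ)
    {κ ρ s : ℝ} {y : E} (hκ : 0 < κ) (hρ : 0 < ρ) (hs : -1 < s)
    (hs0 : ENNReal.ofReal (1 / 2 * (unitBallVolume d * ρ ^ d))
      ≤ volume (Metric.ball y ρ ∩ {x | κ ≤ u (s, x)})) (J : ℕ) :
    σ ≤ (1 / 2) ^ (m * J) * κ → 8 * (2 ^ J * ρ) ≤ 1 →
    Metric.ball y (8 * (2 ^ J * ρ)) ⊆ Metric.ball 0 1 → s + θ * (2 ^ J * ρ) ^ 2 ≤ 0 →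
    ∃ t, s ≤ t ∧ t ≤ s + θ * (2 ^ J * ρ) ^ 2 ∧
      ENNReal.ofReal (1 / 2 * (unitBallVolume d * (2 ^ J * ρ) ^ d))
        ≤ volume (Metric.ball y (2 ^ J * ρ) ∩ {x | (1 / 2) ^ (m * J) * κ ≤ u (t, x)}) := by
  induction J with
  | zero =>
    intro _ _ _ _
    refine ⟨s, le_rfl, ?_, by simpa using hs0⟩
    have : 0 ≤ θ * (2 ^ 0 * ρ) ^ 2 := by positivity
    linarith
  | succ J ih =>
    intro hσ h8 hball ht0
    set R := 2 ^ J * ρ with hR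
    have hR0 : 0 < R := by positivity
    have e : 2 ^ (J + 1) * ρ = 2 * R := by rw [hR, pow_succ]; ring
    rw [e] at h8 hball ht0 ⊢
    have em : (1 / 2 : ℝ) ^ (m * (J + 1)) = (1 / 2) ^ m * (1 / 2) ^ (m * J) := by
      rw [← pow_add]; congr 1; ring
    rw [em] at hσ ⊢
    have hlev : 0 < (1 / 2 : ℝ) ^ (m * J) * κ := by positivity
    have hm1 : (1 / 2 : ℝ) ^ m ≤ 1 := pow_le_one₀ (by norm_num) (by norm_num)
    have hball' : Metric.ball y (8 * R) ⊆ Metric.ball 0 1 :=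
      (Metric.ball_subset_ball (by linarith)).trans hball
    have hθR : 0 < θ * R ^ 2 := by positivity
    have e4 : θ * (2 * R) ^ 2 = 4 * (θ * R ^ 2) := by ring
    rw [e4] at ht0 ⊢
    obtain ⟨t, hst, htR, ht⟩ := ih (by nlinarith) (by linarith) hball' (by linarith)
    refine ⟨t + θ * R ^ 2, by linarith, by linarith, ?_⟩
    have h1 := h ((1 / 2) ^ (m * J) * κ) R t (t + θ * R ^ 2) y hlev (by rwa [← mul_assoc]) hR0
      (by linarith) hball' (by linarith) (by linarith) (by linarith) (by linarith) ht
    rw [← mul_assoc] at h1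
    exact half_measure_le_of_ae (by positivity) le_rfl h1

/-- The bound obtained on `B_{2ρ}` is used only to restart at the same radius `ρ`; the ball stays in
the domain while the total waiting time grows. -/
theorem iterate_steps (h : ExpandsPositivity σ θ m u)
    {κ ρ s Δ : ℝ} {y : E} (hκ : 0 < κ) (hρ : 0 < ρ) (hs : -1 < s)
    (h8 : 8 * ρ ≤ 1) (hball : Metric.ball y (8 * ρ) ⊆ Metric.ball 0 1) (hΔ0 : 0 ≤ Δ)
    (hΔ1 : θ / 2 * ρ ^ 2 ≤ Δ) (hΔ2 : Δ ≤ θ * ρ ^ 2)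
    (hs0 : ENNReal.ofReal (1 / 2 * (unitBallVolume d * ρ ^ d))
      ≤ volume (Metric.ball y ρ ∩ {x | κ ≤ u (s, x)})) (n : ℕ) :
    σ ≤ (1 / 2) ^ (m * (n + 1)) * κ → s + (n + 1) * Δ ≤ 0 →
    ∀ᵐ x ∂volume.restrict (Metric.ball y (2 * ρ)),
      (1 / 2) ^ (m * (n + 1)) * κ ≤ u (s + (n + 1) * Δ, x) := by
  induction n with
  | zero =>
    intro hσ ht
    simp only [Nat.cast_zero, zero_add, mul_one, one_mul] at hσ ht ⊢
    exact h κ ρ s (s + Δ) y hκ hσ hρ h8 hball hs ht (by linarith) (by linarith) hs0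
  | succ n ih =>
    intro hσ ht
    push_cast at hσ ht ⊢
    have em : (1 / 2 : ℝ) ^ (m * (n + 1 + 1)) = (1 / 2) ^ m * (1 / 2) ^ (m * (n + 1)) := by
      rw [← pow_add]; congr 1; ring
    rw [em] at hσ ⊢
    have hlev : 0 < (1 / 2 : ℝ) ^ (m * (n + 1)) * κ := by positivity
    have hm1 : (1 / 2 : ℝ) ^ m ≤ 1 := pow_le_one₀ (by norm_num) (by norm_num)
    have hn : 0 ≤ ((n : ℝ) + 1) * Δ := by positivity
    have h1 := ih (by nlinarith) (by nlinarith)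
    have h2 := half_measure_le_of_ae hρ (by linarith) h1
    rw [mul_assoc]
    exact h _ ρ (s + (n + 1) * Δ) (s + (n + 1 + 1) * Δ) y hlev (by rwa [← mul_assoc]) hρ h8 hball
      (by linarith) ht (by linarith) (by linarith) h2

/-- Positivity in half of a small ball at an early time spreads to the future cylinder. -/
theorem spread (hθ : 0 < θ) (hθ1 : θ ≤ 1) (h : ExpandsPositivity σ θ m u)
    {κ s : ℝ} {y : E} {J N : ℕ} (hN : 256 / θ ≤ N) (hκ : 0 < κ) (hs : -1 < s)
    (hs1 : s ≤ -1 + 2 * (1 / 16) ^ 2) (hy : y ∈ Metric.ball (0 : E) (1 / 16))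
    (hσ : σ ≤ (1 / 2) ^ (m * (J + (N + 1))) * κ)
    (hs0 : ENNReal.ofReal (1 / 2 * (unitBallVolume d * ((1 / 2) ^ J * (1 / 16)) ^ d))
      ≤ volume (Metric.ball y ((1 / 2) ^ J * (1 / 16)) ∩ {x | κ ≤ u (s, x)})) :
    ∀ t ∈ Ioc (-(1 / 16) ^ 2 : ℝ) 0, ∀ᵐ x ∂volume.restrict (Metric.ball (0 : E) (1 / 16)),
      (1 / 2) ^ (m * (J + (N + 1))) * κ ≤ u (t, x) := by
  intro t ht
  have hy1 : dist y 0 < 1 / 16 := hy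
  have eJ : (2 : ℝ) ^ J * ((1 / 2) ^ J * (1 / 16)) = 1 / 16 := by
    rw [← mul_assoc, ← mul_pow]; norm_num
  have hball : Metric.ball y (8 * (1 / 16)) ⊆ Metric.ball 0 1 :=
    Metric.ball_subset_ball' (by linarith)
  have hanti : ∀ i j : ℕ, i ≤ j → (1 / 2 : ℝ) ^ j * κ ≤ (1 / 2) ^ i * κ := fun i j hij =>
    mul_le_mul_of_nonneg_right (pow_le_pow_of_le_one (by norm_num) (by norm_num) hij) hκ.le
  obtain ⟨t', hst', ht', h1⟩ := h.iterate_doubling hθ hκ (by positivity) hs hs0 J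
    (hσ.trans (hanti _ _ (Nat.mul_le_mul_left _ (Nat.le_add_right _ _))))
    (by rw [eJ]; norm_num) (by rw [eJ]; exact hball) (by rw [eJ]; norm_num at hs1 ⊢; linarith)
  rw [eJ] at ht' h1
  norm_num at ht' hs1 ht
  set D := t - t' with hD
  have hD1 : 1 / 2 ≤ D := by linarith [ht.1]
  have hD2 : D ≤ 1 := by linarith [ht.2]
  -- The remaining time is cut into `n` equal steps, each between `θ / 512` and `θ / 256`. Rounding
  -- up respects the lower bound because `D ≥ 1/2` and `θ ≤ 1`.
  set n := ⌈256 * D / θ⌉₊ with hn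
  have hn1 : 256 * D / θ ≤ n := Nat.le_ceil _
  have hn2 : (n : ℝ) < 256 * D / θ + 1 := Nat.ceil_lt_add_one (by positivity)
  have hnD : 256 * D ≤ n * θ := by rwa [div_le_iff₀ hθ] at hn1
  have hnD2 : n * θ < 256 * D + θ := by
    have := mul_lt_mul_of_pos_right hn2 hθ
    rwa [add_mul, div_mul_cancel₀ _ hθ.ne', one_mul] at this
  have hnpos : (0 : ℝ) < n := by
    have : 0 < 256 * D / θ := by positivity
    linarith
  obtain ⟨k, hk⟩ : ∃ k, n = k + 1 := Nat.exists_eq_succ_of_ne_zero (by exact_mod_cast hnpos.ne')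
  have hkN : n ≤ N + 1 := by
    have h2 : 256 * D / θ ≤ 256 / θ := div_le_div_of_nonneg_right (by linarith) hθ.le
    have h3 : (n : ℝ) < N + 1 := by linarith
    exact_mod_cast h3.le
  have hΔ1 : θ / 2 * (1 / 16) ^ 2 ≤ D / n := by
    rw [le_div_iff₀ hnpos]
    norm_num
    linarith
  have hΔ2 : D / n ≤ θ * (1 / 16) ^ 2 := by
    rw [div_le_iff₀ hnpos]
    norm_num
    linarith
  have eD : t' + ((k : ℝ) + 1) * (D / n) = t := by
    have : ((k : ℝ) + 1) = n := by rw [hk]; push_cast; ring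
    rw [this, mul_div_cancel₀ _ hnpos.ne', hD]
    ring
  have em : (1 / 2 : ℝ) ^ (m * (k + 1)) * ((1 / 2) ^ (m * J) * κ) = (1 / 2) ^ (m * (J + n)) * κ := by
    rw [← mul_assoc, ← pow_add, hk]; congr 2; ring
  have hle := hanti (m * (J + n)) (m * (J + (N + 1))) (Nat.mul_le_mul_left _ (by omega))
  have h4 := h.iterate_steps (κ := (1 / 2) ^ (m * J) * κ) (ρ := 1 / 16) (s := t') (Δ := D / n)
    (by positivity) (by norm_num) (by linarith) (by norm_num) hball (by positivity) hΔ1 hΔ2 h1 k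
    (by rw [em]; exact hσ.trans hle) (by rw [eD]; exact ht.2)
  rw [em, eD] at h4
  have hsub : Metric.ball (0 : E) (1 / 16) ⊆ Metric.ball y (2 * (1 / 16)) := by
    refine Metric.ball_subset_ball' ?_
    rw [dist_comm]; linarith
  filter_upwards [ae_restrict_of_ae_restrict_of_subset hsub h4] with x hx
  exact hle.trans hx

end ExpandsPositivity

/-! ### Clustering and expansion with a power law -/

namespace NonnegDeGiorgi

/-- Clustering: if `u ≥ l` on a fraction `α` of a ball, then shortly after `u ≥ α l / 16` on half of
some small ball whose radius is comparable to a power of `α`. -/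
theorem exists_clustering_constant (d : ℕ) {C : ℝ} (hC : 1 ≤ C) :
    ∃ c : ℝ, 0 < c ∧ c ≤ 1 ∧
      ∀ (σ : ℝ) (u : ℝ × EuclideanSpace ℝ (Fin d) → ℝ), NonnegDeGiorgi C σ u → 0 ≤ σ →
      ∀ (l α ε s : ℝ), 0 < l → 0 < α → α ≤ 1 → σ ≤ α * l / 8 → 0 < ε →
      ε ≤ c * α ^ 3 * (1 / 16) → -1 < s → s ≤ -1 + (1 / 16) ^ 2 →
      ENNReal.ofReal (α * (unitBallVolume d * (1 / 16) ^ d))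
        ≤ volume (Metric.ball 0 (1 / 16) ∩ {x | l ≤ u (s, x)}) →
      ∃ t, -1 < t ∧ t ≤ -1 + 2 * (1 / 16) ^ 2 ∧
        ∃ y ∈ Metric.ball (0 : EuclideanSpace ℝ (Fin d)) (1 / 16),
          ENNReal.ofReal (1 / 2 * (unitBallVolume d * ε ^ d))
            ≤ volume (Metric.ball y ε ∩ {x | α * l / 16 ≤ u (t, x)}) := by
  set β := unitBallVolume d with hβdef
  have hβ : 0 < β := unitBallVolume_pos d
  have hC0 : 0 < C := by linarith
  obtain ⟨c, hc, hc1, hP⟩ := exists_propagation_constant d hC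
  have h8d : (1 : ℝ) ≤ 8 ^ d := one_le_pow₀ (by norm_num)
  -- Failure of clustering will imply `δ² α ≤ 192 · 8^d C ε²`. The left side is of order `α⁵` and
  -- the right side at most of order `α⁶`; this constant makes the inequality impossible for all `α
  -- ≤ 1`.
  set c₂ : ℝ := c / (3072 * 8 ^ d * C) with hc₂
  have hc₂0 : 0 < c₂ := by positivity
  have hden : 1 < 3072 * 8 ^ d * C := by nlinarith
  have hc₂1 : c₂ ≤ 1 := by
    rw [hc₂, div_le_one (by positivity)]
    linarith
  refine ⟨c₂, hc₂0, hc₂1, ?_⟩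
  intro σ u h hσ l α ε s hl hα hα1 hσl hε hεc hs hs1 hm
  set ω : ℝ := 1 / 16 with hω
  have hω0 : 0 < ω := by norm_num [hω]
  set κ : ℝ := α * l / 8 with hκ
  have hκ0 : 0 < κ := by positivity
  have hα3 : α ^ 3 ≤ 1 := pow_le_one₀ hα.le hα1
  have hεω : ε ≤ ω := by
    calc ε ≤ c₂ * α ^ 3 * ω := hεc
      _ ≤ 1 * 1 * ω := by gcongr
      _ = ω := by ring
  set T : ℝ := s + c * α ^ 3 * ω ^ 2 with hT
  -- Small enough that `(2δ)² ≤ T - s`: the energy cylinders below `T` start no earlier than `s`.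
  set δ : ℝ := c * α ^ 2 * ω / 4 with hδ
  have hδ0 : 0 < δ := by positivity
  have hα2 : α ^ 2 ≤ 1 := pow_le_one₀ hα.le hα1
  have hδω : δ ≤ ω := by
    calc δ ≤ 1 * 1 * ω / 4 := by rw [hδ]; gcongr
      _ ≤ ω := by linarith
  have h4δ : (2 * δ) ^ 2 ≤ c * α ^ 3 * ω ^ 2 := by
    calc (2 * δ) ^ 2 = (c * α) * (c * α ^ 3 * ω ^ 2) / 4 := by rw [hδ]; ring
      _ ≤ (1 * 1) * (c * α ^ 3 * ω ^ 2) / 4 := by gcongr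
      _ ≤ _ := by
        rw [one_mul, one_mul]
        exact div_le_self (by positivity) (by norm_num)
  have hδ2 : 0 < δ ^ 2 := by positivity
  have hcα : c * α ^ 3 * ω ^ 2 ≤ ω ^ 2 := by
    calc c * α ^ 3 * ω ^ 2 ≤ 1 * 1 * ω ^ 2 := by gcongr
      _ = _ := by ring
  have hT1 : T ≤ -1 + 2 * ω ^ 2 := by linarith
  have hT0 : T ≤ 0 := by
    refine hT1.trans ?_
    norm_num [hω]
  have hTδ : s < T - δ ^ 2 := by nlinarith
  set I := Ioo (T - δ ^ 2) T with hI
  -- With no half-filled ball, `u` is below `κ / 2` on half of every `ε`-ball, although `{κ ≤ u}`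
  -- has density at least `α / 2` at all times of `I`. Such oscillation at scale `ε` needs more
  -- energy than the class allows.
  by_contra hcon
  push Not at hcon
  have hball1 : ∀ r : ℝ, r ≤ 1 → Metric.ball (0 : EuclideanSpace ℝ (Fin d)) r ⊆ Metric.ball 0 1 :=
    fun r hr => Metric.ball_subset_ball hr
  have hprop : ∀ t ∈ I, ENNReal.ofReal (α / 2 * (β * ω ^ d))
      ≤ volume (Metric.ball 0 ω ∩ {x | κ ≤ u (t, x)}) := by
    intro t ht
    refine hP σ u h hσ l α ω s t 0 hl ?_ hα hα1 hω0 (by norm_num [hω])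
      (hball1 _ (by norm_num [hω])) hs (hTδ.trans ht.1) (ht.2.le.trans hT0) (by linarith [ht.2]) hm
    have : α * l / 8 ≤ l := by nlinarith
    linarith
  have hhalf : ∀ t ∈ I, ∀ x ∈ Metric.ball (0 : EuclideanSpace ℝ (Fin d)) ω,
      2 * volume (Metric.ball x ε ∩ {x | κ / 2 ≤ u (t, x)})
        ≤ volume (Metric.ball (0 : EuclideanSpace ℝ (Fin d)) ε) := by
    intro t ht x hx
    have h1 := hcon t (by linarith [ht.1]) (ht.2.le.trans hT1) x hx
    have e : α * l / 16 = κ / 2 := by rw [hκ]; ring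
    rw [e] at h1
    rw [volume_ball_eq_ofReal _ hε]
    calc _ ≤ 2 * ENNReal.ofReal (1 / 2 * (β * ε ^ d)) := by gcongr
      _ = _ := by
        rw [← ENNReal.ofReal_ofNat, ← ENNReal.ofReal_mul (by norm_num), ← mul_assoc]
        norm_num
        rfl
  have hωε : ω + ε + 3 * δ ≤ 1 := by
    have : ω + ε + 3 * δ ≤ 5 * ω := by linarith
    refine this.trans ?_
    norm_num [hω]
  have hTδ1 : -1 ≤ T - (2 * δ) ^ 2 := by linarith
  have hDQ := h.diffQuotientBound_short_cylinder hC0.le hσ (r := ω + ε) (y := 0) hκ0 hσl hδ0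
    (by linarith) hT0 hTδ1 (hball1 _ hωε)
  have hum : AEMeasurable u (volume.restrict (I ×ˢ Metric.ball 0 (ω + ε))) :=
    h.aemeasurable_cylinder_Ioo hT0 (by nlinarith) (hball1 _ (by linarith))
  have hkey := measure_ge_le_of_half_balls measurableSet_Ioo 0 hε (half_lt_self hκ0) hum hDQ hhalf
  have hlow := measure_prod_ge_of_slices (measurableSet_Ioo (a := T - δ ^ 2) (b := T))
    (measurableSet_ball (x := (0 : EuclideanSpace ℝ (Fin d))) (ε := ω))
    (hum.mono_measure (Measure.restrict_mono
      (prod_mono_right (Metric.ball_subset_ball (by linarith))) le_rfl)) hprop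
  rw [Real.volume_Ioo, ← ENNReal.ofReal_mul (by positivity)] at hlow
  have hcomb := (mul_le_mul_right hlow (ENNReal.ofReal ((κ - κ / 2) ^ 2))).trans hkey
  rw [← ENNReal.ofReal_mul (sq_nonneg _), ← ENNReal.ofReal_mul (sq_nonneg ε),
    ← ENNReal.ofReal_ofNat, ← ENNReal.ofReal_mul (by norm_num),
    ENNReal.ofReal_le_ofReal_iff (by positivity)] at hcomb
  have h2 : (ω + ε) ^ d ≤ 2 ^ d * ω ^ d := by
    rw [← mul_pow]
    exact pow_le_pow_left₀ (by positivity) (by linarith) d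
  have h3 : κ ^ 2 * β * ω ^ d * (δ ^ 2 * α)
      ≤ κ ^ 2 * β * ω ^ d * (192 * 8 ^ d * C * ε ^ 2) := by
    have e8 : (8 : ℝ) ^ d = 4 ^ d * 2 ^ d := by rw [← mul_pow]; norm_num
    calc κ ^ 2 * β * ω ^ d * (δ ^ 2 * α)
        = 8 * ((κ - κ / 2) ^ 2 * (α / 2 * (β * ω ^ d) * (T - (T - δ ^ 2)))) := by ring
      _ ≤ 8 * (2 * (ε ^ 2 * (12 * C * 4 ^ d * β * κ ^ 2 * (ω + ε) ^ d))) := by gcongr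
      _ ≤ 8 * (2 * (ε ^ 2 * (12 * C * 4 ^ d * β * κ ^ 2 * (2 ^ d * ω ^ d)))) := by gcongr
      _ = _ := by rw [e8]; ring
  have h4 : δ ^ 2 * α ≤ 192 * 8 ^ d * C * ε ^ 2 := le_of_mul_le_mul_left h3 (by positivity)
  have h5 : ε ^ 2 ≤ (c₂ * α ^ 3 * ω) ^ 2 := pow_le_pow_left₀ hε.le hεc 2
  have h6 : 192 * 8 ^ d * C * (c₂ * α ^ 3 * ω) ^ 2
      = δ ^ 2 * α * (α / (3072 * 8 ^ d * C)) := by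
    rw [hc₂, hδ]
    field_simp
    norm_num
  have h7 : δ ^ 2 * α * (α / (3072 * 8 ^ d * C)) < δ ^ 2 * α * 1 := by
    refine mul_lt_mul_of_pos_left ?_ (by positivity)
    rw [div_lt_one (by positivity)]
    linarith
  have h8 : 192 * 8 ^ d * C * ε ^ 2 ≤ 192 * 8 ^ d * C * (c₂ * α ^ 3 * ω) ^ 2 := by gcongr
  rw [mul_one] at h7
  exact absurd (h4.trans (h8.trans h6.le)) (not_le.2 h7)

/-- Positivity with a power-like dependence on the density: if `u ≥ l` on a fraction `α` of a ball
at an early time, then `u ≥ c α ^ q l` in the future cylinder. -/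
theorem exists_power_expansion_constants (d : ℕ) {C : ℝ} (hC : 1 ≤ C) :
    ∃ c : ℝ, ∃ q : ℕ, 0 < c ∧ 0 < q ∧
      ∀ (σ : ℝ) (u : ℝ × EuclideanSpace ℝ (Fin d) → ℝ), NonnegDeGiorgi C σ u → 0 ≤ σ →
      ∀ (l α s : ℝ), 0 < l → 0 < α → α ≤ 1 → σ ≤ c * α ^ q * l →
      -1 < s → s ≤ -1 + (1 / 16) ^ 2 →
      ENNReal.ofReal (α * (unitBallVolume d * (1 / 16) ^ d))
        ≤ volume (Metric.ball 0 (1 / 16) ∩ {x | l ≤ u (s, x)}) →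
      ∀ t ∈ Ioc (-(1 / 16) ^ 2 : ℝ) 0,
        ∀ᵐ x ∂volume.restrict (Metric.ball (0 : EuclideanSpace ℝ (Fin d)) (1 / 16)),
          c * α ^ q * l ≤ u (t, x) := by
  obtain ⟨θ, m, hθ, hθ1, hEP⟩ := exists_expansion_constants d hC
  obtain ⟨b, hb, hb1, hCL⟩ := exists_clustering_constant d hC
  obtain ⟨N, hN⟩ := exists_nat_ge (256 / θ)
  -- The doublings lose at most `(b α³ / 2) ^ m`, the steps at fixed radius `(1/2) ^ (m (N + 1))`,
  -- and clustering `α / 16`; hence the exponent `3 m + 1`.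
  set c : ℝ := (b / 2) ^ m * (1 / 2) ^ (m * (N + 1)) / 16 with hc
  have hc0 : 0 < c := by positivity
  refine ⟨c, 3 * m + 1, hc0, by omega, ?_⟩
  intro σ u h hσ l α s hl hα hα1 hσc hs hs1 hm
  have hα3 : α ^ 3 ≤ 1 := pow_le_one₀ hα.le hα1
  have hx0 : 0 < b * α ^ 3 := by positivity
  have hx1 : b * α ^ 3 ≤ 1 := by
    calc b * α ^ 3 ≤ 1 * 1 := by gcongr
      _ = 1 := by ring
  -- The dyadic radius is below `b α³ / 16`, as clustering requires, and at least half of it, which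
  -- bounds the number of doublings.
  obtain ⟨n, hn1, hn2⟩ := exists_nat_pow_near_of_lt_one hx0 hx1 (by norm_num : (0 : ℝ) < 1 / 2)
    (by norm_num)
  set J := n + 1 with hJ
  have hJ2 : b * α ^ 3 / 2 ≤ (1 / 2 : ℝ) ^ J := by
    calc b * α ^ 3 / 2 ≤ (1 / 2 : ℝ) ^ n / 2 := div_le_div_of_nonneg_right hn2 zero_le_two
      _ = _ := by rw [hJ, pow_succ]; ring
  -- the levels
  have hlev : c * α ^ (3 * m + 1) * l ≤ (1 / 2) ^ (m * (J + (N + 1))) * (α * l / 16) := by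
    have e1 : (1 / 2 : ℝ) ^ (m * (J + (N + 1))) = ((1 / 2) ^ J) ^ m * (1 / 2) ^ (m * (N + 1)) := by
      rw [← pow_mul, ← pow_add]; congr 1; ring
    calc c * α ^ (3 * m + 1) * l
        = (b * α ^ 3 / 2) ^ m * (1 / 2) ^ (m * (N + 1)) * (α * l / 16) := by
          have e2 : (b * α ^ 3 / 2) ^ m = (b / 2) ^ m * α ^ (3 * m) := by
            rw [pow_mul, ← mul_pow]; congr 1; ring
          rw [e2, hc, pow_succ]; ring
      _ ≤ ((1 / 2) ^ J) ^ m * (1 / 2) ^ (m * (N + 1)) * (α * l / 16) := by gcongr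
      _ = _ := by rw [e1]
  have hpow1 : (1 / 2 : ℝ) ^ (m * (J + (N + 1))) ≤ 1 := pow_le_one₀ (by norm_num) (by norm_num)
  have hαl : 0 < α * l / 16 := by positivity
  have hσl : σ ≤ α * l / 8 := by nlinarith
  obtain ⟨t₀, ht₀, ht₀1, y, hy, hty⟩ := hCL σ u h hσ l α ((1 / 2) ^ J * (1 / 16)) s hl hα hα1 hσl
    (by positivity) (by gcongr) hs hs1 hm
  have hexp : ExpandsPositivity σ θ m u := hEP σ u h hσ
  intro t ht
  have h1 := hexp.spread hθ hθ1 hN hαl ht₀ ht₀1 hy (hσc.trans hlev) hty t ht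
  filter_upwards [h1] with x hx
  exact hlev.trans hx

end NonnegDeGiorgi

/-! ### From a weak bound to an `L^p` bound -/

theorem lintegral_Ioc_rpow {p L : ℝ} (hp : 0 < p) (hL : 0 ≤ L) :
    ∫⁻ t in Ioc 0 L, ENNReal.ofReal (t ^ (p - 1)) = ENNReal.ofReal (L ^ p / p) := by
  have hint : IntegrableOn (fun t : ℝ => t ^ (p - 1)) (Ioc 0 L) :=
    (intervalIntegrable_iff_integrableOn_Ioc_of_le hL).1
      (intervalIntegral.intervalIntegrable_rpow' (by linarith))
  rw [← ofReal_integral_eq_lintegral_ofReal hint, ← intervalIntegral.integral_of_le hL,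
    integral_rpow (Or.inl (by linarith)), sub_add_cancel, Real.zero_rpow hp.ne', sub_zero]
  filter_upwards [ae_restrict_mem measurableSet_Ioc] with t ht
  exact Real.rpow_nonneg ht.1.le _

theorem lintegral_Ioi_rpow {p L : ℝ} (hp : 0 < p) (hL : 0 < L) :
    ∫⁻ t in Ioi L, ENNReal.ofReal (t ^ (-p - 1)) = ENNReal.ofReal (L ^ (-p) / p) := by
  rw [← ofReal_integral_eq_lintegral_ofReal (integrableOn_Ioi_rpow_of_lt (by linarith) hL),
    integral_Ioi_rpow_of_lt (by linarith) hL, sub_add_cancel, neg_div_neg_eq]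
  filter_upwards [ae_restrict_mem measurableSet_Ioi] with t ht
  exact Real.rpow_nonneg (hL.trans ht).le _

/-- A weak `L^{2p}` bound on a finite measure space gives an `L^p` bound. -/
theorem lintegral_rpow_le_of_weak_bound {α : Type*} [MeasurableSpace α] (μ : Measure α) {f : α → ℝ}
    (hf : 0 ≤ᵐ[μ] f) (hfm : AEMeasurable f μ) {p V L : ℝ} (hp : 0 < p) (hV : 0 ≤ V) (hL : 0 < L)
    (huniv : μ univ ≤ ENNReal.ofReal V)
    (hdecay : ∀ l, 0 < l → μ {a | l ≤ f a} ≤ ENNReal.ofReal (V * (L / l) ^ (2 * p))) :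
    ∫⁻ a, ENNReal.ofReal (f a ^ p) ∂μ ≤ ENNReal.ofReal (2 * V * L ^ p) := by
  -- Layer cake split at the level `L`: below it the measure is at most `V`, above it the decay
  -- applies. Each part contributes `V L^p`.
  rw [lintegral_rpow_eq_lintegral_meas_le_mul μ hf hfm hp, ← Ioc_union_Ioi_eq_Ioi hL.le]
  have h1 : ∫⁻ t in Ioc 0 L, μ {a | t ≤ f a} * ENNReal.ofReal (t ^ (p - 1))
      ≤ ENNReal.ofReal (V * (L ^ p / p)) := by
    rw [ENNReal.ofReal_mul hV, ← lintegral_Ioc_rpow hp hL.le,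
      ← lintegral_const_mul' _ _ ENNReal.ofReal_ne_top]
    refine lintegral_mono fun t => ?_
    gcongr
    exact (measure_mono (subset_univ _)).trans huniv
  have h2 : ∫⁻ t in Ioi L, μ {a | t ≤ f a} * ENNReal.ofReal (t ^ (p - 1))
      ≤ ENNReal.ofReal (V * L ^ (2 * p) * (L ^ (-p) / p)) := by
    rw [ENNReal.ofReal_mul (by positivity), ← lintegral_Ioi_rpow hp hL,
      ← lintegral_const_mul' _ _ ENNReal.ofReal_ne_top]
    refine setLIntegral_mono' measurableSet_Ioi fun t ht => ?_
    have ht0 : 0 < t := hL.trans ht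
    calc _ ≤ ENNReal.ofReal (V * (L / t) ^ (2 * p)) * ENNReal.ofReal (t ^ (p - 1)) := by
          gcongr; exact hdecay t ht0
      _ = _ := by
          rw [← ENNReal.ofReal_mul (by positivity), ← ENNReal.ofReal_mul (by positivity),
            Real.div_rpow hL.le ht0.le, mul_assoc, mul_assoc, div_mul_eq_mul_div, mul_div_assoc,
            ← Real.rpow_sub ht0]
          congr 4
          ring
  calc _ ≤ ENNReal.ofReal p * (ENNReal.ofReal (V * (L ^ p / p))
        + ENNReal.ofReal (V * L ^ (2 * p) * (L ^ (-p) / p))) := by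
        gcongr
        exact (lintegral_union_le _ _ _).trans (add_le_add h1 h2)
    _ = _ := by
        rw [← ENNReal.ofReal_add (by positivity) (by positivity),
          ← ENNReal.ofReal_mul hp.le]
        have e : L ^ (2 * p) * L ^ (-p) = L ^ p := by
          rw [← Real.rpow_add hL]; congr 1; ring
        congr 1
        rw [mul_assoc V, ← mul_div_assoc (L ^ (2 * p)), e]
        field_simp
        ring

theorem eLpNorm_le_of_weak_bound {α : Type*} [MeasurableSpace α] (μ : Measure α) {f : α → ℝ}
    (hf : 0 ≤ᵐ[μ] f) (hfm : AEMeasurable f μ) {p V L : ℝ} (hp : 0 < p) (hV : 0 ≤ V) (hL : 0 < L)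
    (huniv : μ univ ≤ ENNReal.ofReal V)
    (hdecay : ∀ l, 0 < l → μ {a | l ≤ f a} ≤ ENNReal.ofReal (V * (L / l) ^ (2 * p))) :
    eLpNorm f (ENNReal.ofReal p) μ ≤ ENNReal.ofReal ((2 * V) ^ (1 / p) * L) := by
  rw [eLpNorm_eq_lintegral_rpow_enorm_toReal (by simpa using hp) ENNReal.ofReal_ne_top,
    ENNReal.toReal_ofReal hp.le]
  have e : ∫⁻ a, ‖f a‖ₑ ^ p ∂μ = ∫⁻ a, ENNReal.ofReal (f a ^ p) ∂μ := by
    refine lintegral_congr_ae ?_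
    filter_upwards [hf] with a ha
    rw [Real.enorm_of_nonneg ha, ENNReal.ofReal_rpow_of_nonneg ha hp.le]
  have e2 : (2 * V) ^ (1 / p) * L = (2 * V * L ^ p) ^ (1 / p) := by
    rw [Real.mul_rpow (x := 2 * V) (by positivity) (by positivity), ← Real.rpow_mul hL.le,
      mul_one_div_cancel hp.ne', Real.rpow_one]
  rw [e, e2, ← ENNReal.ofReal_rpow_of_nonneg (by positivity) (by positivity)]
  exact ENNReal.rpow_le_rpow (lintegral_rpow_le_of_weak_bound μ hf hfm hp hV hL huniv hdecay)
    (by positivity)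

/-! ### The weak Harnack inequality -/

theorem theoremt (d : ℕ) (hd : 1 ≤ d) (Cplus Cminus : ℝ) (hCplus : 1 ≤ Cplus)
    (hCminus : 1 ≤ Cminus) :
    ∃ ω C p₀ : ℝ, 0 < ω ∧ ω < 1 ∧ 0 < C ∧ 0 < p₀ ∧
      ∀ S u : ℝ × EuclideanSpace ℝ (Fin d) → ℝ,
        MemPDGMinus Cplus Cminus (-1) 0 0 1 S u →
        MemLp S ∞ (volume.restrict (parabolicCylinder (0, 0) 1)) →
        (∀ᵐ X ∂(volume.restrict (parabolicCylinder (0, 0) 1)), 0 ≤ u X) →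
        eLpNorm u (ENNReal.ofReal p₀)
            (volume.restrict (parabolicCylinder (-1 + ω ^ 2, 0) ω))
          ≤ ENNReal.ofReal C *
            (essInf (fun X => ENNReal.ofReal (u X))
                (volume.restrict (parabolicCylinder (0, 0) ω))
              + eLpNorm S ∞ (volume.restrict (parabolicCylinder (0, 0) 1))) := by
  obtain ⟨c, q, hc, hq, hpos⟩ := NonnegDeGiorgi.exists_power_expansion_constants d
    (C := max Cplus Cminus) (hCplus.trans (le_max_left _ _))
  have hβ := unitBallVolume_pos d
  set β := unitBallVolume d with hβdef
  have hq0 : (0 : ℝ) < q := by exact_mod_cast hq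
  -- The slices decay like `l^(-1/q)`; taking `2 p = 1 / q` gives an integrable tail.
  set p : ℝ := 1 / (2 * q) with hpdef
  have hp : 0 < p := by positivity
  set B : ℝ := β * (1 / 16) ^ d with hB
  have hB0 : 0 < B := by positivity
  set V : ℝ := B * (1 / 16) ^ 2 with hV
  have hV0 : 0 < V := by positivity
  set K : ℝ := (2 * V) ^ (1 / p) with hK
  have hK0 : 0 < K := by positivity
  refine ⟨1 / 16, K / c, p, by norm_num, by norm_num, by positivity, hp, ?_⟩
  intro S u hmem hS hu
  have hQ1 : parabolicCylinder ((0 : ℝ), (0 : EuclideanSpace ℝ (Fin d))) 1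
      = Ioc (-1) 0 ×ˢ Metric.ball 0 1 := by
    simp [parabolicCylinder]
  have hQp : parabolicCylinder (-1 + (1 / 16 : ℝ) ^ 2, (0 : EuclideanSpace ℝ (Fin d))) (1 / 16)
      = Ioc (-1) (-1 + (1 / 16 : ℝ) ^ 2) ×ˢ Metric.ball 0 (1 / 16) := by
    simp [parabolicCylinder]
  have hQf : parabolicCylinder ((0 : ℝ), (0 : EuclideanSpace ℝ (Fin d))) (1 / 16)
      = Ioc (-(1 / 16) ^ 2) 0 ×ˢ Metric.ball 0 (1 / 16) := by
    simp [parabolicCylinder]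
  rw [hQp, hQf]
  rw [hQ1] at hS hu ⊢
  set μ := volume.restrict (Ioc (-1 : ℝ) 0 ×ˢ Metric.ball (0 : EuclideanSpace ℝ (Fin d)) 1) with hμ
  set σ : ℝ := (eLpNorm S ∞ μ).toReal with hσdef
  have hσ : 0 ≤ σ := ENNReal.toReal_nonneg
  have hσe : ENNReal.ofReal σ = eLpNorm S ∞ μ := ENNReal.ofReal_toReal hS.2.ne
  have hSσ : ∀ᵐ X ∂μ, |S X| ≤ σ := by
    filter_upwards [ae_le_eLpNormEssSup (f := S) (μ := μ)] with X hX
    rw [← eLpNorm_exponent_top, ← hσe, Real.enorm_eq_ofReal_abs] at hX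
    exact (ENNReal.ofReal_le_ofReal_iff hσ).1 hX
  have h : NonnegDeGiorgi (max Cplus Cminus) σ u :=
    hmem.nonnegDeGiorgi (by linarith) (le_max_left _ _) (le_max_right _ _) hσ hSσ hu
  have hball : Metric.ball (0 : EuclideanSpace ℝ (Fin d)) (1 / 16) ⊆ Metric.ball 0 1 :=
    Metric.ball_subset_ball (by norm_num)
  set M := essInf (fun X => ENNReal.ofReal (u X))
    (volume.restrict (Ioc (-(1 / 16) ^ 2 : ℝ) 0 ×ˢ
      Metric.ball (0 : EuclideanSpace ℝ (Fin d)) (1 / 16))) + eLpNorm S ∞ μ with hM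
  -- If the source is too large for the expansion lemma, then `σ` itself exceeds the claimed bound;
  -- `M` covers both cases.
  have hlower : ∀ l α s : ℝ, 0 < l → 0 < α → α ≤ 1 → -1 < s → s ≤ -1 + (1 / 16) ^ 2 →
      ENNReal.ofReal (α * B) ≤ volume (Metric.ball 0 (1 / 16) ∩ {x | l ≤ u (s, x)}) →
      ENNReal.ofReal (c * α ^ q * l) ≤ M := by
    intro l α s hl hα hα1 hs hs1 hm
    by_cases hcase : σ ≤ c * α ^ q * l
    · refine le_trans (le_essInf_of_ae_le _ ?_) le_self_add
      have h1 := ae_prod_of_slices measurableSet_Ioc measurableSet_ball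
        (h.aemeasurable_cylinder le_rfl (by norm_num) hball)
        (hpos σ u h hσ l α s hl hα hα1 hcase hs hs1 hm)
      filter_upwards [h1] with X hX
      exact ENNReal.ofReal_le_ofReal hX
    · refine le_trans ?_ le_add_self
      rw [← hσe]
      exact ENNReal.ofReal_le_ofReal (not_le.1 hcase).le
  have hum : AEMeasurable u (volume.restrict (Ioc (-1 : ℝ) (-1 + (1 / 16) ^ 2) ×ˢ
      Metric.ball (0 : EuclideanSpace ℝ (Fin d)) (1 / 16))) :=
    h.aemeasurable_cylinder (by norm_num) le_rfl hball
  have hu0 : 0 ≤ᵐ[volume.restrict (Ioc (-1 : ℝ) (-1 + (1 / 16) ^ 2) ×ˢ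
      Metric.ball (0 : EuclideanSpace ℝ (Fin d)) (1 / 16))] u :=
    ae_restrict_of_ae_restrict_of_subset
      (prod_mono (Ioc_subset_Ioc_right (by norm_num)) hball) hu
  have hvolI : volume (Ioc (-1 : ℝ) (-1 + (1 / 16) ^ 2)) = ENNReal.ofReal ((1 / 16) ^ 2) := by
    rw [Real.volume_Ioc]; congr 1; ring
  have hbound : ∀ L : ℝ, 0 < L → M ≤ ENNReal.ofReal (c * L) →
      eLpNorm u (ENNReal.ofReal p) (volume.restrict (Ioc (-1 : ℝ) (-1 + (1 / 16) ^ 2) ×ˢ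
        Metric.ball (0 : EuclideanSpace ℝ (Fin d)) (1 / 16))) ≤ ENNReal.ofReal (K * L) := by
    intro L hL hML
    refine eLpNorm_le_of_weak_bound _ hu0 hum hp hV0.le hL ?_ ?_
    · rw [Measure.restrict_apply_univ, volume_Ioc_prod_ball _ _ _ (by norm_num) (by norm_num)]
      refine ENNReal.ofReal_le_ofReal (le_of_eq ?_)
      rw [hV, hB]; ring
    · intro l hl
      rw [Measure.restrict_apply' (measurableSet_Ioc.prod measurableSet_ball), inter_comm]
      have hslice : ∀ s ∈ Ioc (-1 : ℝ) (-1 + (1 / 16) ^ 2),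
          volume (Metric.ball (0 : EuclideanSpace ℝ (Fin d)) (1 / 16) ∩ {x | l ≤ u (s, x)})
            ≤ ENNReal.ofReal (B * (L / l) ^ (2 * p)) := by
        intro s hs
        set v := volume (Metric.ball (0 : EuclideanSpace ℝ (Fin d)) (1 / 16) ∩ {x | l ≤ u (s, x)})
          with hv
        have hvB : v ≤ ENNReal.ofReal B := by
          rw [hv, hB, ← volume_ball_eq_ofReal 0 (by norm_num)]
          exact measure_mono inter_subset_left
        have hvt : v ≠ ∞ := ne_top_of_le_ne_top ENNReal.ofReal_ne_top hvB
        rcases eq_or_ne v 0 with h0 | h0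
        · rw [h0]; exact zero_le
        -- `v.toReal / B` is the density `α` of the slice, for which `hlower` gives `α ^ q ≤ L / l`.
        have hα0 : 0 < v.toReal / B := div_pos (ENNReal.toReal_pos h0 hvt) hB0
        have hαB : v.toReal / B * B = v.toReal := div_mul_cancel₀ _ hB0.ne'
        have hα1 : v.toReal / B ≤ 1 :=
          (div_le_one hB0).2 (ENNReal.toReal_le_of_le_ofReal hB0.le hvB)
        have h1 := (hlower l (v.toReal / B) s hl hα0 hα1 hs.1 hs.2
          (by rw [hαB, ENNReal.ofReal_toReal hvt])).trans hML
        rw [ENNReal.ofReal_le_ofReal_iff (by positivity), mul_assoc] at h1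
        have h2 : (v.toReal / B) ^ q ≤ L / l := (le_div_iff₀ hl).2 (le_of_mul_le_mul_left h1 hc)
        have h3 : v.toReal / B ≤ (L / l) ^ (2 * p) := by
          have e : 2 * p = (q : ℝ)⁻¹ := by rw [hpdef]; field_simp
          rw [e, Real.le_rpow_inv_iff_of_pos hα0.le (by positivity) hq0, Real.rpow_natCast]
          exact h2
        rw [← ENNReal.ofReal_toReal hvt]
        refine ENNReal.ofReal_le_ofReal ?_
        rw [div_le_iff₀ hB0] at h3
        linarith
      refine (measure_prod_le_of_slices measurableSet_Ioc measurableSet_ball hum (fun z => l ≤ z)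
        measurableSet_Ici hslice).trans (le_of_eq ?_)
      rw [hvolI, ← ENNReal.ofReal_mul (by positivity)]
      congr 1
      rw [hV]; ring
  rcases eq_or_ne M ∞ with hMt | hMt
  · rw [hMt, ENNReal.mul_top (by simpa using div_pos hK0 hc)]
    exact le_top
  -- `M` may vanish while `L` has to be positive; the margin `ε / K` in `L` becomes `ε` in the
  -- bound.
  refine ENNReal.le_of_forall_pos_le_add fun ε hε _ => ?_
  have hε0 : (0 : ℝ) < ε := hε
  have hL : 0 < M.toReal / c + ε / K := by positivity
  refine (hbound _ hL ?_).trans (le_of_eq ?_)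
  · refine (ENNReal.ofReal_toReal hMt).symm.le.trans (ENNReal.ofReal_le_ofReal ?_)
    rw [mul_add, mul_div_cancel₀ _ hc.ne']
    exact le_add_of_nonneg_right (by positivity)
  · have e : K * (M.toReal / c + ε / K) = K / c * M.toReal + ε := by
      field_simp
    rw [e, ENNReal.ofReal_add (by positivity) hε0.le, ENNReal.ofReal_mul (by positivity),
      ENNReal.ofReal_toReal hMt, ENNReal.ofReal_coe_nnreal]
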